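/- **Theorem 2.1.** Let $\mathcal G$ be a finite connected planar graph (multiple edges and loops allowed; a loop counts twice in the degree of its vertex) with a fixed planar embedding and at least one edge. Call the vertices adjacent to the infinite face *boundary vertices* and all the others *interior vertices*; a *boundary edge* joins an interior vertex to a boundary vertex. Let $e_1,\dots,e_{2N}$ be distinct boundary edges in counterclockwise order along the infinite face. The *wired UST* is a uniformly random spanning tree of the multigraph obtained from $\mathcal G$ by identifying all boundary vertices; in it, the *boundary branch* from an interior vertex is the unique simple path from it to the boundary. An *$N$-link pattern* $\alpha\in\mathsf{LP}_N$ is a planar (non-crossing) partition of $\{1,\dots,2N\}$ into pairs, called links, and $\mathrm{Conn}(\alpha)$ is the event that for each odd $a$, with $\{a,b\}$ the link of $a$ in $\alpha$, the boundary branch from the interior vertex of $e_a$ reaches the boundary through the edge $e_b$ (here $b$ is even). Fix valences $\varsigma=(s_1,\dots,s_d)\in\mathbb Z_{>0}^d$ with $s_1+\dots+s_d=2N$, let $q_j=s_1+\dots+s_j$, and call $\{q_{j-1}+1,\dots,q_j\}$ the $j$-th group of indices. Let $\mathsf{LP}_\varsigma$ be the set of $\varsigma$-valenced link patterns, identified through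 unfusing with the link patterns in $\mathsf{LP}_N$ that have no link inside a group. The Dyck path of $\beta\in\mathsf{LP}_N$ has an up-step at the left endpoint and a down-step at the right endpoint of every link; $\beta\succeq\alpha$ means that the Dyck path of $\beta$ stays weakly above that of $\alpha$. Then $\alpha/\beta$ denotes the skew Young diagram between the two paths, whose cells are squares with diagonals of length $2$ centered at integer points. A *Dyck tile* is a ribbon of cells centered at the points of a translated Dyck path (possibly of zero length), and $\#\mathcal C(\alpha/\beta)$ is the number of tilings of $\alpha/\beta$ by Dyck tiles that are *cover-inclusive*: whenever a cell of a tile $t$ lies directly above a cell of a tile $t'$, the horizontal extent of $t$ is contained in that of $t'$. For interior vertices $v,w$ let $\mathsf G(v,w)=\sum_{\omega}\prod_{k=0}^m \deg(v_k)^{-1}$, where the sum is over all walks $\omega$ from $v$ to $w$ visiting only interior vertices, with successive vertices $v_0=v,v_1,\dots,v_m=w$ (walks using different parallel edges, or a loop in different directions, being different). For boundary edges $e,e'$ with interior vertices $v,v'$ let $\mathsf K_{\mathcal G}(e,e')=\mathsf G(v,v')$. Let $D^{\mathrm{tan}}f(e_i)=f(e_{i+1})-f(e_i)$, with $D^{\mathrm{tan}}_1,D^{\mathrm{tan}}_2$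 acting on the first and on the second argument. For $a=q_{i-1}+m_a$ in the $i$-th group and $b=q_{j-1}+m_b$ in the $j$-th group, let $$\mathfrak K(a,b)=\begin{cases}(D^{\mathrm{tan}}_1)^{m_a-1}(D^{\mathrm{tan}}_2)^{m_b-1}\,\mathsf K_{\mathcal G}(e_{q_{i-1}+1},e_{q_{j-1}+1}), & i\ne j,\\ 0, & i=j,\end{cases}$$ and for $\beta\in\mathsf{LP}_N$ with links $\{a_1,b_1\},\dots,\{a_N,b_N\}$, where $a_1<\dots<a_N$ and $a_k<b_k$, let $\Delta^{\mathfrak K}_\beta=\det\big(\mathfrak K(a_k,b_\ell)\big)_{k,\ell=1}^N$. Then all the series $\mathsf G(v,w)$ converge, and for every $\alpha\in\mathsf{LP}_\varsigma$, $$\mathbb P[\mathrm{Conn}(\alpha)]=\sum_{\substack{\beta\in\mathsf{LP}_N\\ \beta\succeq\alpha}}\#\mathcal C(\alpha/\beta)\,\Delta^{\mathfrak K}_\beta .$$ -/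

import Mathlib

/-- A finite connected planar (multi)graph with at least one edge and with a fixed planar embedding,
encoded by its rotation system.  `V` is the set of vertices and `D` the set of oriented edges
("darts"): every edge consists of the two darts `d` and `rev d`.  The dart `d` starts at `org d` and
ends at `org (rev d)`; `rot` sends a dart to the next dart in counterclockwise order around its
starting vertex.  The faces of the embedding are the cycles of `d ↦ rot (rev d)`: traversing such a
cycle follows the boundary of a face, with the face lying on the right-hand side.  The embedding is
planar exactly when Euler's formula `|V| - |E| + |F| = 2` holds.  The infinite face is the face on
the right-hand side of the dart `outer`, so that its cycle travels counterclockwise around the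
graph. -/
structure PlaneGraph (V D : Type*) [Fintype V] [Fintype D] where
  org : D → V
  rev : Equiv.Perm D
  rot : Equiv.Perm D
  rev_rev : ∀ d, rev (rev d) = d
  rev_ne : ∀ d, rev d ≠ d
  org_eq_iff : ∀ d d', org d = org d' ↔ rot.SameCycle d d'
  connected : ∀ u v : V,
    Relation.ReflTransGen (fun x y => ∃ d, org d = x ∧ org (rev d) = y) u v
  euler : 2 * Fintype.card V
      + 2 * Nat.card (Quotient (Equiv.Perm.SameCycle.setoid (rot * rev))) = Fintype.card D + 4
  outer : D

namespace PlaneGraph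

variable {V D : Type*} [Fintype V] [Fintype D] (G : PlaneGraph V D)

/-- The end vertex of a dart. -/
def head (d : D) : V := G.org (G.rev d)

/-- The next dart along the face on the right-hand side of a dart. -/
def faceNext : Equiv.Perm D := G.rot * G.rev

/-- The dart `d` has the infinite face on its right-hand side. -/
def OnOuter (d : D) : Prop := G.faceNext.SameCycle G.outer d

/-- Boundary vertices: those adjacent to the infinite face. -/
def IsBoundary (v : V) : Prop := ∃ d, G.OnOuter d ∧ G.org d = v

/-- Interior vertices: all the others. -/
def IsInterior (v : V) : Prop := ¬ G.IsBoundary v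

/-- A boundary edge, represented by its dart from the interior vertex to the boundary vertex. -/
def IsBoundaryEdge (d : D) : Prop := G.IsInterior (G.org d) ∧ G.IsBoundary (G.head d)

/-- The number of steps of the closed walk around the infinite face. -/
noncomputable def contourLength : ℕ := {d | G.OnOuter d}.ncard

/-- Walk counterclockwise along the infinite face, starting with the dart `outer`.  After arriving
with the `k`-th dart at some vertex, turn clockwise around this vertex, through the graph, starting
from the edge of arrival, until the infinite face is met again.  The dart `x` is visited at
position `(k, j)` if it is the `j`-th dart seen during this turn (counting from `0`). -/
def VisitedAt (k j : ℕ) (x : D) : Prop :=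
  x = G.rot.symm^[j] (G.rev (G.faceNext^[k] G.outer)) ∧
    ∀ i < j, ¬ G.OnOuter (G.rot.symm^[i] (G.rev (G.faceNext^[k] G.outer)))

/-- The boundary edges `e 0, …, e (n - 1)` (darts from interior to boundary) are distinct and in
counterclockwise order along the infinite face: they are visited in this order during (at most) one
revolution of the counterclockwise walk along the infinite face, started anywhere. -/
def IsCounterclockwise {n : ℕ} (e : Fin n → D) : Prop :=
  ∃ k j : Fin n → ℕ,
    (∀ a, G.VisitedAt (k a) (j a) (G.rev (e a))) ∧
    (∀ a b, a < b → toLex (k a, j a) < toLex (k b, j b)) ∧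
    (∀ a b, toLex (k b, j b) < toLex (k a + G.contourLength, j a))

/-! ### The wired uniform spanning tree -/

/-- Identification of all boundary vertices with each other. -/
def wiredSetoid : Setoid V where
  r u v := u = v ∨ (G.IsBoundary u ∧ G.IsBoundary v)
  iseqv :=
    { refl := fun _ => Or.inl rfl
      symm := fun h => h.elim (fun h => Or.inl h.symm) (fun h => Or.inr ⟨h.2, h.1⟩)
      trans := by
        rintro u v w (rfl | h) (rfl | h')
        · exact Or.inl rfl
        · exact Or.inr h'
        · exact Or.inr h
        · exact Or.inr ⟨h.1, h'.2⟩ }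

/-- The vertices of the wired multigraph. -/
def WiredVertex : Type _ := Quotient G.wiredSetoid

/-- The quotient map to the vertices of the wired multigraph. -/
def wire (v : V) : G.WiredVertex := Quotient.mk G.wiredSetoid v

/-- `T` is (the set of darts of) the edge set of a spanning tree of the wired multigraph: it joins
all vertices, and it contains no cycle, i.e. no closed walk of positive length that uses distinct
edges. -/
def IsWiredSpanningTree (T : Set D) : Prop :=
  (∀ d, d ∈ T ↔ G.rev d ∈ T) ∧
  (∀ x y : G.WiredVertex, Relation.ReflTransGen
    (fun x y => ∃ d ∈ T, G.wire (G.org d) = x ∧ G.wire (G.head d) = y) x y) ∧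
  ¬ ∃ (n : ℕ) (c : Fin (n + 1) → D),
    (∀ i, c i ∈ T) ∧
    (∀ i, G.wire (G.head (c i)) = G.wire (G.org (c (i + 1)))) ∧
    (∀ i i', i ≠ i' → c i ≠ c i' ∧ c i ≠ G.rev (c i'))

/-- The list of darts `l` is a boundary branch from `v` in `T`: a simple path in `T` from the
interior vertex `v` to the boundary, whose vertices before the last one are interior. -/
def IsBoundaryBranch (T : Set D) (v : V) (l : List D) : Prop :=
  (∀ d ∈ l, d ∈ T ∧ G.IsInterior (G.org d)) ∧
  l.head?.map G.org = some v ∧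
  l.IsChain (fun d d' => G.head d = G.org d') ∧
  (l.map G.org).Nodup ∧
  ∃ d ∈ l.getLast?, G.IsBoundary (G.head d)

/-- The boundary branch from `v` in `T` connects to the boundary via the boundary edge `d`. -/
def BranchVia (T : Set D) (v : V) (d : D) : Prop :=
  ∃ l, G.IsBoundaryBranch T v l ∧ l.getLast? = some d

end PlaneGraph

/-! ### Link patterns, Dyck paths, and Dyck tilings

The index set `{1, …, 2N}` is represented by `Fin (2 * N)`; the index `a` of the mathematical text
is the element with value `a - 1`, so odd indices have even values and conversely. -/

/-- An `N`-link pattern: a planar partition of `2N` points into pairs; `partner a` is the other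
endpoint of the link of `a`. -/
@[ext] structure LinkPattern (N : ℕ) where
  partner : Fin (2 * N) → Fin (2 * N)
  partner_partner : ∀ a, partner (partner a) = a
  partner_ne : ∀ a, partner a ≠ a
  noncrossing : ∀ a b, a < b → b < partner a → ¬ partner a < partner b

namespace LinkPattern

variable {N : ℕ}

noncomputable instance : Fintype (LinkPattern N) :=
  Fintype.ofInjective LinkPattern.partner (fun _ _ h => LinkPattern.ext h)

/-- The Dyck path of a link pattern: up-steps at left endpoints of links, down-steps at right
endpoints. `height x` is its height after `x` steps. -/
def height (α : LinkPattern N) (x : ℕ) : ℤ :=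
  ∑ a : Fin (2 * N), if a.val < x then (if a < α.partner a then 1 else -1) else 0

/-- The partial order: `α ≤ β` if the Dyck path of `β` stays weakly above the one of `α`. -/
instance : LE (LinkPattern N) := ⟨fun α β => ∀ x : Fin (2 * N + 1), α.height x ≤ β.height x⟩

instance (α β : LinkPattern N) : Decidable (α ≤ β) :=
  inferInstanceAs (Decidable (∀ x : Fin (2 * N + 1), α.height x ≤ β.height x))

/-- The skew Young diagram between the Dyck paths of `α` and `β`.  A cell, which is the square with
corners `(x - 1, h), (x + 1, h), (x, h - 1), (x, h + 1)`, is represented by its center `(x, h)`. -/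
noncomputable def skewDiagram (α β : LinkPattern N) : Finset (ℕ × ℤ) :=
  (Finset.range (2 * N + 1) ×ˢ Finset.Icc 0 (N : ℤ)).filter
    (fun c => α.height c.1 < c.2 ∧ c.2 < β.height c.1 ∧ Odd ((c.1 : ℤ) + c.2))

end LinkPattern

/-- A Dyck tile: the ribbon of the cells centered at the points of a Dyck path (possibly of zero
length), translated to start at the point `(x, h 0)`. -/
def IsDyckTile (t : Finset (ℕ × ℤ)) : Prop :=
  ∃ (x n : ℕ) (h : ℕ → ℤ),
    (∀ i < 2 * n, h (i + 1) = h i + 1 ∨ h (i + 1) = h i - 1) ∧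
    (∀ i ≤ 2 * n, h 0 ≤ h i) ∧ h (2 * n) = h 0 ∧
    t = (Finset.range (2 * n + 1)).image (fun i => (x + i, h i))

namespace LinkPattern

variable {N : ℕ}

/-- Cover-inclusive Dyck tilings of the skew Young diagram between `α` and `β`: partitions into
Dyck tiles such that if some cell of the tile `t` lies directly above some cell of the tile `s`,
then the horizontal extent of `t` is contained in the one of `s`. -/
def CoverInclusiveTiling (α β : LinkPattern N) : Type :=
  {P : Finpartition (skewDiagram α β) //
    (∀ t ∈ P.parts, IsDyckTile t) ∧
    ∀ s ∈ P.parts, ∀ t ∈ P.parts,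
      (∃ x h, (x, h) ∈ s ∧ (x, h + 2) ∈ t) → t.image Prod.fst ⊆ s.image Prod.fst}

/-- The number of cover-inclusive Dyck tilings. -/
noncomputable def numTilings (α β : LinkPattern N) : ℕ := Nat.card (CoverInclusiveTiling α β)

/-- The Fomin type determinant `det (K (a_k, b_ℓ))`, where `a_1 < ⋯ < a_N` are the left endpoints of
the links of `β` and `b_ℓ` is the partner of `a_ℓ`.  Rows and columns are indexed by the left
endpoints. -/
noncomputable def fominDet (β : LinkPattern N) (K : Fin (2 * N) → Fin (2 * N) → ℝ) : ℝ :=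
  Matrix.det (Matrix.of fun a a' : {a : Fin (2 * N) // a < β.partner a} =>
    K a.val (β.partner a'.val))

end LinkPattern

/-! ### Valences -/

section Valences

variable {N d : ℕ} (s : Fin d → ℕ) (hs : ∑ i, s i = 2 * N)

/-- `groupStart s i = s_1 + ⋯ + s_{i-1}` (also written `q_{i-1}`): the first index of the `i`-th group
of fused indices, which consists of the `s i` consecutive indices from there. -/
def groupStart (i : Fin d) : ℕ := ∑ k ∈ Finset.Iio i, s k

/-- The group `i` that contains the index `a`. -/
def groupOf (a : Fin (2 * N)) : Fin d := (finSigmaFinEquiv.symm (Fin.cast hs.symm a)).1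

/-- The position of the index `a` in its group, counted from `0`: it is `m_a - 1` if `m_a` is the
position counted from `1`. -/
def offset (a : Fin (2 * N)) : ℕ := (finSigmaFinEquiv.symm (Fin.cast hs.symm a)).2.val

theorem offset_lt (a : Fin (2 * N)) : offset s hs a < s (groupOf s hs a) :=
  (finSigmaFinEquiv.symm (Fin.cast hs.symm a)).2.isLt

theorem groupStart_add_offset (a : Fin (2 * N)) :
    groupStart s (groupOf s hs a) + offset s hs a = a.val := by
  have h := finSigmaFinEquiv_apply (finSigmaFinEquiv.symm (Fin.cast hs.symm a))
  rw [Equiv.apply_symm_apply] at h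
  have key : ∀ i : Fin d, groupStart s i = ∑ j : Fin i, s (Fin.castLE i.2.le j) := by
    intro i
    unfold groupStart
    symm
    refine Finset.sum_bij (fun j _ => Fin.castLE i.2.le j) ?_ ?_ ?_ ?_
    · intro j _
      exact Finset.mem_Iio.2 (Fin.lt_def.2 j.2)
    · intro j _ j' _ hj
      exact Fin.castLE_injective _ hj
    · intro k hk
      exact ⟨⟨k.val, Fin.lt_def.1 (Finset.mem_Iio.1 hk)⟩, Finset.mem_univ _, rfl⟩
    · intro j _
      rfl
  rw [key]
  exact h.symm

/-- The valenced link patterns with valences `s`, viewed through the unfusing map as link patterns: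
those in which no link has both of its endpoints in the same group. -/
def LinkPattern.IsValenced (α : LinkPattern N) : Prop :=
  ∀ a, groupOf s hs (α.partner a) ≠ groupOf s hs a

end Valences

/-- The discrete tangential difference of a function on the consecutively indexed edges. -/
def tangentialDiff (f : ℕ → ℝ) : ℕ → ℝ := fun a => f (a + 1) - f a

namespace PlaneGraph

variable {V D : Type*} [Fintype V] [Fintype D] (G : PlaneGraph V D)

/-- The degree of a vertex (a loop counts twice). -/
noncomputable def degree (v : V) : ℕ := {d | G.org d = v}.ncard

/-- The list of darts `l` is a walk from `v` to `w` that only visits interior vertices (the empty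
list is the one-vertex walk). -/
def IsInteriorWalk (v w : V) : List D → Prop
  | [] => G.IsInterior v ∧ v = w
  | d :: l => G.IsInterior v ∧ G.org d = v ∧ IsInteriorWalk (G.head d) w l

/-- The random-walk weight of a walk started at `v`: the product of the inverse degrees of all of
its vertices, including the first and the last one. -/
noncomputable def walkWeight (v : V) (l : List D) : ℝ :=
  (G.degree v : ℝ)⁻¹ * (l.map fun d => (G.degree (G.head d) : ℝ)⁻¹).prod

/-- The random-walk Green's function with Dirichlet boundary conditions. -/
noncomputable def green (v w : V) : ℝ :=
  ∑' l : {l : List D // G.IsInteriorWalk v w l}, G.walkWeight v l.val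

/-- The excursion kernel between two boundary edges: the Green's function between their interior
vertices. -/
noncomputable def excursionKernel (d d' : D) : ℝ := G.green (G.org d) (G.org d')

/-- The excursion kernel as a function of the labels of the marked edges (the value `0` outside the
range of the labels is never used). -/
noncomputable def edgeKernel {n : ℕ} (e : Fin n → D) (a b : ℕ) : ℝ :=
  if h : a < n ∧ b < n then G.excursionKernel (e ⟨a, h.1⟩) (e ⟨b, h.2⟩) else 0

/-- The fused kernel: iterated discrete tangential differences of the excursion kernel, in both
arguments, if the two indices are in different groups, and zero if they are in the same group. -/
noncomputable def fusedKernel {N d : ℕ} (s : Fin d → ℕ) (hs : ∑ i, s i = 2 * N)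
    (e : Fin (2 * N) → D) (a b : Fin (2 * N)) : ℝ :=
  if groupOf s hs a = groupOf s hs b then 0
  else
    tangentialDiff^[offset s hs a]
      (fun x => tangentialDiff^[offset s hs b] (fun y => G.edgeKernel e x y)
        (groupStart s (groupOf s hs b)))
      (groupStart s (groupOf s hs a))

/-- The event `Conn(α)` for the marked boundary edges `e`: the boundary branches from the interior
vertices of the odd-index edges connect to the boundary via the even-index edges, in such a way that
the branch from the `a`-th edge uses the edge with which `α` pairs it (in particular, different
branches use different edges). Odd indices have even values. -/
def Conn {N : ℕ} (e : Fin (2 * N) → D) (α : LinkPattern N) (T : Set D) : Prop :=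
  ∀ a : Fin (2 * N), Even a.val →
    Odd (α.partner a).val ∧ G.BranchVia T (G.org (e a)) (e (α.partner a))

/-- The probability of `Conn(α)` for the wired uniform spanning tree. -/
noncomputable def connProb {N : ℕ} (e : Fin (2 * N) → D) (α : LinkPattern N) : ℝ :=
  ({T : Set D | G.IsWiredSpanningTree T ∧ G.Conn e α T}.ncard : ℝ)
    / ({T : Set D | G.IsWiredSpanningTree T}.ncard : ℝ)

end PlaneGraph

/-!
# Fomin determinants, Dyck tilings, and boundary branches of the wired spanning tree

A spanning tree of the wired graph is the same as a choice of an arrow (an outgoing dart) at each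
interior vertex, such that following the arrows leads from everywhere to the boundary
(`PlaneGraph.ncard_isWiredSpanningTree`); the boundary branches follow the arrows.  Expanding the
determinant of the Dirichlet Laplacian, bordered by rows and columns for the marked edges, in the
rows of the interior vertices gives two facts at once.  The determinant of the Laplacian counts the
acyclic arrows (`PlaneGraph.card_acyclic`), and a minor of its inverse, the Green's function, is the
signed expected number of ways in which the branches from given vertices exit through given edges
(`PlaneGraph.sum_det_exitsVia`, Fomin's identity; the loop-erasure of walks is not needed).

Expand such a determinant over permutations.  Each term counts the arrows whose branches realize a
matching of the marked edges, each link in a prescribed direction.  A crossing matching cannot be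
realized (`PlaneGraph.not_crossing`): a branch between two marked edges closes up along the infinite
face to a flow without sources, which by Euler's formula is the difference of a function on the faces
(`PlaneGraph.exists_faceDiff_eq`); this function is constant along a disjoint branch, but takes
different values at marked edges on different sides.  Reversal of a branch shows that the directions
of the links do not matter (`PlaneGraph.ncard_reversal`).  Thus the expected Fomin determinant of a
link pattern `β` is a sum over link patterns `α` of the probability of `α` times the Fomin determinant
of the matrix of links of `α` (`PlaneGraph.sum_fominDet_exitMatrix`).

This linear system is solved by the numbers of cover-inclusive Dyck tilings
(`LinkPattern.tilingSum_linkMatrix`).  The key is that `LinkPattern.tilingSum α`, the right-hand side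
of the theorem as a function of the kernel, behaves well under the transposition of two adjacent
indices (`LinkPattern.tilingSum_add_swap`): raising a valley of the Dyck path to a peak adds one
cell, which corresponds to the tilings in which the top cell below the peak is a tile
(`LinkPattern.numTopped_close`).  The other tilings only exist if `α` has a peak in the same column,
and they correspond to the tilings after the removal of both peaks (`LinkPattern.numUntopped_ins`).
In particular `tilingSum α` is antisymmetric under transpositions of indices in a group without
links of `α` inside.  Hence it vanishes on kernels with two equal variables in a group, and being
linear in each variable, it does not change when the excursion kernel is replaced by its iterated
differences (`tilingSum_fusedKernel`).
-/


/-! ### Partners and links -/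

namespace LinkPattern

variable {N : ℕ} (α β γ : LinkPattern N)

theorem partner_injective : Function.Injective α.partner :=
  Function.LeftInverse.injective α.partner_partner

theorem partner_eq_iff {a b : Fin (2 * N)} : α.partner a = b ↔ α.partner b = a :=
  ⟨fun h => h ▸ α.partner_partner a, fun h => h ▸ α.partner_partner b⟩

theorem not_lt_partner_iff {a : Fin (2 * N)} : ¬ a < α.partner a ↔ α.partner a < a :=
  ⟨fun h => lt_of_le_of_ne (not_lt.1 h) (α.partner_ne a), fun h => h.not_gt⟩

/-- The partner map as a permutation. -/
def partnerPerm : Equiv.Perm (Fin (2 * N)) :=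
  ⟨α.partner, α.partner, α.partner_partner, α.partner_partner⟩

/-! ### Heights of Dyck paths -/

@[simp] theorem height_zero : α.height 0 = 0 := by simp [height]

theorem height_succ (a : Fin (2 * N)) :
    α.height (a + 1) = α.height a + if a < α.partner a then 1 else -1 := by
  classical
  have : ∀ b : Fin (2 * N),
      (if b.val < a.val + 1 then (if b < α.partner b then (1 : ℤ) else -1) else 0)
        = (if b.val < a.val then (if b < α.partner b then (1 : ℤ) else -1) else 0)
          + if b = a then (if a < α.partner a then (1 : ℤ) else -1) else 0 := by
    intro b
    by_cases hb : b = a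
    · subst hb; simp
    · have : b.val ≠ a.val := fun h => hb (Fin.ext h)
      simp only [hb, if_false, add_zero]
      congr 1
      simp only [eq_iff_iff]
      omega
  unfold height
  rw [Finset.sum_congr rfl (fun b _ => this b), Finset.sum_add_distrib]
  simp

/-- Twice the height counts the endpoints of the links which are open at `x`. -/
theorem two_mul_height (x : ℕ) :
    2 * α.height x = ∑ a : Fin (2 * N), if (a.val < x ↔ ¬ (α.partner a).val < x) then 1 else 0 := by
  have h1 : α.height x = ∑ a : Fin (2 * N),
      if (α.partner a).val < x then (if α.partner a < a then 1 else -1) else 0 := by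
    unfold height
    rw [← Equiv.sum_comp α.partnerPerm]
    refine Finset.sum_congr rfl fun a _ => ?_
    simp [partnerPerm, α.partner_partner]
  rw [two_mul]
  nth_rw 2 [h1]
  unfold height
  rw [← Finset.sum_add_distrib]
  refine Finset.sum_congr rfl fun a _ => ?_
  have h2 := α.partner_ne a
  have h3 : (α.partner a).val ≠ a.val := fun h => h2 (Fin.ext h)
  simp only [Fin.lt_def]
  split_ifs <;> omega

theorem height_nonneg (x : ℕ) : 0 ≤ α.height x := by
  have h := α.two_mul_height x
  have : (0 : ℤ) ≤ ∑ a : Fin (2 * N), if (a.val < x ↔ ¬ (α.partner a).val < x) then 1 else 0 :=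
    Finset.sum_nonneg fun a _ => by split_ifs <;> simp
  omega

theorem height_le (x : ℕ) : α.height x ≤ N := by
  have h := α.two_mul_height x
  have : (∑ a : Fin (2 * N), if (a.val < x ↔ ¬ (α.partner a).val < x) then (1 : ℤ) else 0)
      ≤ ∑ a : Fin (2 * N), 1 := Finset.sum_le_sum fun a _ => by split_ifs <;> simp
  rw [← h] at this
  simp only [Finset.sum_const, Finset.card_univ, Fintype.card_fin, nsmul_eq_mul, mul_one,
    Nat.cast_mul, Nat.cast_ofNat] at this
  omega

theorem height_of_ge {x : ℕ} (hx : 2 * N ≤ x) : α.height x = 0 := by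
  have h := α.two_mul_height x
  rw [Finset.sum_eq_zero] at h
  · omega
  · intro a _
    have := a.2
    have := (α.partner a).2
    rw [if_neg]
    omega

theorem exists_open_of_height_pos {x : ℕ} (hx : 0 < α.height x) :
    ∃ a : Fin (2 * N), a.val < x ∧ x ≤ (α.partner a).val := by
  have h := α.two_mul_height x
  by_contra! hc
  rw [Finset.sum_eq_zero] at h
  · omega
  · intro a _
    have h1 := hc a
    have h2 := hc (α.partner a)
    rw [α.partner_partner] at h2
    rw [if_neg]
    omega

theorem height_parity {x : ℕ} (hx : x ≤ 2 * N) : Even (α.height x + x) := by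
  induction x with
  | zero => simp
  | succ x ih =>
    have h := α.height_succ ⟨x, hx⟩
    have h2 := ih (by omega)
    simp only at h
    rw [Int.even_iff] at *
    rw [h]
    push_cast
    split_ifs <;> omega

theorem height_eq_of_lt_iff {M : ℕ} {α : LinkPattern N} {β : LinkPattern M} {x k : ℕ} {i : ℤ}
    (t : ℕ) (h0 : α.height x = β.height k + i) (hx : x + t ≤ 2 * N) (hk : k + t ≤ 2 * M)
    (h : ∀ r < t, ∀ (h1 : x + r < 2 * N) (h2 : k + r < 2 * M),
      ((⟨x + r, h1⟩ : Fin (2 * N)) < α.partner ⟨x + r, h1⟩) ↔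
      ((⟨k + r, h2⟩ : Fin (2 * M)) < β.partner ⟨k + r, h2⟩)) :
    α.height (x + t) = β.height (k + t) + i := by
  induction t with
  | zero => exact h0
  | succ t ih =>
    have h1 := α.height_succ ⟨x + t, by omega⟩
    have h2 := β.height_succ ⟨k + t, by omega⟩
    have h3 := ih (by omega) (by omega) (fun r hr => h r (by omega))
    simp only at h1 h2
    rw [← add_assoc, ← add_assoc, h1, h2, h3]
    have := h t (by omega) (by omega) (by omega)
    simp only [this]
    ring

theorem le_def {α β : LinkPattern N} : α ≤ β ↔ ∀ x, α.height x ≤ β.height x := by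
  constructor
  · intro h x
    by_cases hx : x < 2 * N + 1
    · exact h ⟨x, hx⟩
    · rw [α.height_of_ge (by omega), β.height_of_ge (by omega)]
  · intro h x
    exact h x

protected theorem le_refl (α : LinkPattern N) : α ≤ α := le_def.2 fun _ => le_rfl

/-! ### Peaks and valleys -/

theorem partner_eq_of_adjacent {u v : Fin (2 * N)} (huv : v.val = u.val + 1)
    (hu : u < α.partner u) (hv : α.partner v < v) : α.partner u = v := by
  by_contra hne
  have h1 : α.partner v ≠ u := fun h => hne (by rw [← h, α.partner_partner])
  have h2 := α.noncrossing (α.partner v) u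
  rw [α.partner_partner] at h2
  simp only [Fin.lt_def, ne_eq, Fin.ext_iff] at *
  omega

/-- The values of the conjugate of the partner map by a transposition `(u d)` of two indices which
are not linked: the links `{u, p u}` and `{d, p d}` are replaced by `{u, p d}` and `{d, p u}`. -/
theorem conj_swap_cases {u d : Fin (2 * N)} (h : β.partner u ≠ d)
    (x : Fin (2 * N)) :
    (x = u ∧ Equiv.swap u d (β.partner (Equiv.swap u d x)) = β.partner d) ∨
    (x = d ∧ Equiv.swap u d (β.partner (Equiv.swap u d x)) = β.partner u) ∨
    (x = β.partner u ∧ Equiv.swap u d (β.partner (Equiv.swap u d x)) = d) ∨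
    (x = β.partner d ∧ Equiv.swap u d (β.partner (Equiv.swap u d x)) = u) ∨
    (x ≠ u ∧ x ≠ d ∧ x ≠ β.partner u ∧ x ≠ β.partner d ∧ β.partner x ≠ u ∧ β.partner x ≠ d ∧
      β.partner x ≠ β.partner u ∧ β.partner x ≠ β.partner d ∧
      Equiv.swap u d (β.partner (Equiv.swap u d x)) = β.partner x) := by
  have h' : β.partner d ≠ u := fun h' => h (β.partner_eq_iff.1 h')
  have hu := β.partner_ne u
  have hd := β.partner_ne d
  by_cases h1 : x = u
  · left
    refine ⟨h1, ?_⟩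
    rw [h1, Equiv.swap_apply_left, Equiv.swap_apply_of_ne_of_ne h' hd]
  by_cases h2 : x = d
  · right; left
    refine ⟨h2, ?_⟩
    rw [h2, Equiv.swap_apply_right, Equiv.swap_apply_of_ne_of_ne hu h]
  by_cases h3 : x = β.partner u
  · right; right; left
    refine ⟨h3, ?_⟩
    rw [h3, Equiv.swap_apply_of_ne_of_ne hu h, β.partner_partner, Equiv.swap_apply_left]
  by_cases h4 : x = β.partner d
  · right; right; right; left
    refine ⟨h4, ?_⟩
    rw [h4, Equiv.swap_apply_of_ne_of_ne h' hd, β.partner_partner, Equiv.swap_apply_right]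
  right; right; right; right
  have k1 : β.partner x ≠ u := fun h => h3 (by rw [← h, β.partner_partner])
  have k2 : β.partner x ≠ d := fun h => h4 (by rw [← h, β.partner_partner])
  refine ⟨h1, h2, h3, h4, k1, k2, fun h => h1 (β.partner_injective h),
    fun h => h2 (β.partner_injective h), ?_⟩
  rw [Equiv.swap_apply_of_ne_of_ne h1 h2, Equiv.swap_apply_of_ne_of_ne k1 k2]

theorem conj_swap_ne {u d : Fin (2 * N)} (a : Fin (2 * N)) :
    Equiv.swap u d (β.partner (Equiv.swap u d a)) ≠ a := by
  intro h
  have := β.partner_ne (Equiv.swap u d a)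
  rw [Equiv.swap_apply_eq_iff] at h
  exact this h

/-- The links of `β` with the links `{u, c}` and `{v, d}` replaced by `{u, v}` and `{c, d}`, where
`c` and `d` are the partners of the adjacent indices `u` and `v`: a valley of the Dyck path becomes
a peak. -/
def close (u v : Fin (2 * N)) (huv : v.val = u.val + 1) (hu : β.partner u < u)
    (hv : v < β.partner v) : LinkPattern N where
  partner x := Equiv.swap u (β.partner v) (β.partner (Equiv.swap u (β.partner v) x))
  partner_partner a := by simp [β.partner_partner]
  partner_ne a := β.conj_swap_ne a
  noncrossing := by
    have hpu := β.partner_partner u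
    have hpv := β.partner_partner v
    have hval := β.conj_swap_cases (u := u) (d := β.partner v)
      (by simp only [ne_eq, Fin.ext_iff, Fin.lt_def] at *; omega)
    have nc := β.noncrossing
    rw [hpv] at hval
    intro a b hab
    have n1 := nc a b
    have n2 := nc a (β.partner u)
    have n3 := nc a v
    have n4 := nc (β.partner u) b
    have n5 := nc v b
    rw [hpu] at n2 n4
    have ha := hval a
    have hb := hval b
    generalize Equiv.swap u (β.partner v) (β.partner (Equiv.swap u (β.partner v) a)) = qa at *
    generalize Equiv.swap u (β.partner v) (β.partner (Equiv.swap u (β.partner v) b)) = qb at *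
    generalize β.partner a = pa at *
    generalize β.partner b = pb at *
    generalize β.partner u = c at *
    generalize β.partner v = d at *
    clear hval nc hpu hpv
    simp only [ne_eq, Fin.ext_iff, Fin.lt_def] at *
    omega

/-- The links of `γ` with the links `{u, v}` and `{c, d}` replaced by `{u, c}` and `{v, d}`, where
`u` and `v` are adjacent and `{c, d}` is the innermost link around them: a peak of the Dyck path
becomes a valley. -/
def openPeak (u v c d : Fin (2 * N)) (huv : v.val = u.val + 1) (hu : γ.partner u = v)
    (hc : γ.partner c = d) (hcu : c < u) (hvd : v < d)
    (hin : ∀ a, c < a → a < u → ¬ v < γ.partner a) : LinkPattern N where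
  partner x := Equiv.swap u d (γ.partner (Equiv.swap u d x))
  partner_partner a := by simp [γ.partner_partner]
  partner_ne a := γ.conj_swap_ne a
  noncrossing := by
    have hv : γ.partner v = u := γ.partner_eq_iff.1 hu
    have hd : γ.partner d = c := γ.partner_eq_iff.1 hc
    have hval := γ.conj_swap_cases (u := u) (d := d)
      (by simp only [ne_eq, Fin.ext_iff, Fin.lt_def] at *; omega)
    have nc := γ.noncrossing
    rw [hu, hd] at hval
    intro a b hab
    have n1 := nc a b
    have n2 := nc a c
    have n3 := nc a u
    have n4 := nc c b
    have n5 := nc u b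
    have i1 := hin a
    have i2 := hin b
    rw [hc] at n2 n4
    rw [hu] at n3 n5
    have ha := hval a
    have hb := hval b
    generalize Equiv.swap u d (γ.partner (Equiv.swap u d a)) = qa at *
    generalize Equiv.swap u d (γ.partner (Equiv.swap u d b)) = qb at *
    generalize γ.partner a = pa at *
    generalize γ.partner b = pb at *
    clear hval nc hv hd hin hc hu
    simp only [ne_eq, Fin.ext_iff, Fin.lt_def] at *
    omega

end LinkPattern


namespace LinkPattern

section Close

variable {N : ℕ} (β : LinkPattern N) {u v : Fin (2 * N)}

theorem close_partner_left (huv : v.val = u.val + 1) (hu : β.partner u < u)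
    (hv : v < β.partner v) : (β.close u v huv hu hv).partner u = v := by
  have h1 : v ≠ u := by simp only [ne_eq, Fin.ext_iff]; omega
  simp only [close, Equiv.swap_apply_left, β.partner_partner]
  exact Equiv.swap_apply_of_ne_of_ne h1 hv.ne

theorem lt_close_partner_iff (huv : v.val = u.val + 1) (hu : β.partner u < u)
    (hv : v < β.partner v) (x : Fin (2 * N)) :
    x < (β.close u v huv hu hv).partner x ↔ x ≠ v ∧ (x = u ∨ x < β.partner x) := by
  have hval := β.conj_swap_cases (u := u) (d := β.partner v)
    (by simp only [ne_eq, Fin.ext_iff, Fin.lt_def] at *; omega) x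
  have hpu := β.partner_partner u
  have hpv := β.partner_partner v
  have hx : (β.close u v huv hu hv).partner x =
    Equiv.swap u (β.partner v) (β.partner (Equiv.swap u (β.partner v) x)) := rfl
  rw [hx]
  have k1 : x = β.partner u → β.partner x = u := fun h => by rw [h, hpu]
  have k2 : x = β.partner v → β.partner x = v := fun h => by rw [h, hpv]
  generalize Equiv.swap u (β.partner v) (β.partner (Equiv.swap u (β.partner v) x)) = q at *
  rcases hval with ⟨h1, h2⟩ | ⟨h1, h2⟩ | ⟨h1, h2⟩ | ⟨h1, h2⟩ |
      ⟨h1, a2, a3, a4, a5, a6, a7, a8, h2⟩ <;>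
    rw [h2] <;> clear h2 <;>
    simp only [hpu, hpv, ne_eq, Fin.ext_iff, Fin.lt_def] at * <;> omega

theorem height_close (huv : v.val = u.val + 1) (hu : β.partner u < u)
    (hv : v < β.partner v) (x : ℕ) :
    (β.close u v huv hu hv).height x = β.height x + if x = v.val then 2 else 0 := by
  have key : ∀ a : Fin (2 * N),
      (if a.val < x then (if a < (β.close u v huv hu hv).partner a then (1 : ℤ) else -1) else 0)
      = (if a.val < x then (if a < β.partner a then (1 : ℤ) else -1) else 0)
        + (if a = u then (if u.val < x then 2 else 0) else 0)
        + (if a = v then (if v.val < x then -2 else 0) else 0) := by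
    intro a
    have h := β.lt_close_partner_iff huv hu hv a
    by_cases h1 : a = u
    · subst h1
      have h2 : a ≠ v := by simp only [ne_eq, Fin.ext_iff]; omega
      have h3 : a < (β.close a v huv hu hv).partner a := by rw [h]; exact ⟨h2, Or.inl rfl⟩
      have h4 : ¬ a < β.partner a := hu.not_gt
      simp only [h2, h3, h4, if_true, if_false]
      split_ifs <;> simp
    · by_cases h2 : a = v
      · subst h2
        have h3 : ¬ a < (β.close u a huv hu hv).partner a := by rw [h]; simp
        simp only [h1, h3, hv, if_true, if_false]
        split_ifs <;> simp
      · simp only [h, h1, h2, ne_eq, not_false_eq_true, true_and, false_or, if_false, add_zero]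
  unfold height
  rw [Finset.sum_congr rfl fun a _ => key a, Finset.sum_add_distrib, Finset.sum_add_distrib]
  simp only [Finset.sum_ite_eq', Finset.mem_univ, if_true, add_assoc]
  congr 1
  split_ifs <;> omega

theorem close_injective {β₁ β₂ : LinkPattern N} (huv : v.val = u.val + 1)
    (hu₁ : β₁.partner u < u) (hv₁ : v < β₁.partner v)
    (hu₂ : β₂.partner u < u) (hv₂ : v < β₂.partner v)
    (h : β₁.close u v huv hu₁ hv₁ = β₂.close u v huv hu₂ hv₂) : β₁ = β₂ := by
  have hp : ∀ x, (β₁.close u v huv hu₁ hv₁).partner x = (β₂.close u v huv hu₂ hv₂).partner x :=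
    fun x => by rw [h]
  simp only [close] at hp
  have h1 : ∀ x, β₁.partner x = Equiv.swap u (β₁.partner v) (Equiv.swap u (β₂.partner v)
      (β₂.partner (Equiv.swap u (β₂.partner v) (Equiv.swap u (β₁.partner v) x)))) := by
    intro x
    rw [← hp]
    simp
  by_cases hd : β₁.partner v = β₂.partner v
  · ext x
    rw [h1, hd]
    simp
  · exfalso
    -- the links around `{u, v}` in the closed pattern, seen in the two valleys
    have main : ∀ (γ₁ γ₂ : LinkPattern N), γ₁.partner u < u → v < γ₁.partner v →
        γ₂.partner u < u → v < γ₂.partner v →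
        (∀ x, Equiv.swap u (γ₁.partner v) (γ₁.partner (Equiv.swap u (γ₁.partner v) x)) =
          Equiv.swap u (γ₂.partner v) (γ₂.partner (Equiv.swap u (γ₂.partner v) x))) →
        ¬ γ₁.partner v < γ₂.partner v := by
      intro γ₁ γ₂ a1 a2 b1 b2 hq hlt
      have e1 := hq (γ₁.partner u)
      have p1 := γ₁.partner_partner u
      have p2 := γ₂.partner_partner u
      have p3 := γ₂.partner_partner v
      have c1 := γ₁.conj_swap_cases (u := u) (d := γ₁.partner v)
        (by simp only [ne_eq, Fin.ext_iff, Fin.lt_def] at *; omega) (γ₁.partner u)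
      have c2 := γ₂.conj_swap_cases (u := u) (d := γ₂.partner v)
        (by simp only [ne_eq, Fin.ext_iff, Fin.lt_def] at *; omega) (γ₁.partner u)
      rw [e1, γ₁.partner_partner] at c1
      have n1 := γ₂.noncrossing (γ₂.partner u) (γ₁.partner u)
      have n2 := γ₂.noncrossing (γ₁.partner u) (γ₂.partner u)
      have n3 := γ₂.noncrossing (γ₁.partner u) u
      have n4 := γ₂.noncrossing (γ₁.partner u) v
      rw [p3] at c2
      generalize Equiv.swap u (γ₂.partner v) (γ₂.partner (Equiv.swap u (γ₂.partner v)
        (γ₁.partner u))) = q at *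
      rw [p1] at c1
      rw [p2] at n1 n2
      generalize γ₂.partner (γ₁.partner u) = p at *
      generalize γ₁.partner u = c at *
      clear hq h1 hp h e1
      simp only [ne_eq, Fin.ext_iff, Fin.lt_def] at *
      omega
    rcases lt_or_gt_of_ne hd with hd | hd
    · exact main β₁ β₂ hu₁ hv₁ hu₂ hv₂ hp hd
    · exact main β₂ β₁ hu₂ hv₂ hu₁ hv₁ (fun x => (hp x).symm) hd

/-- A peak which does not start at height zero can be lowered to a valley. -/
theorem exists_close_eq {γ : LinkPattern N} (huv : v.val = u.val + 1) (h : γ.partner u = v)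
    (hpos : 0 < γ.height u) :
    ∃ (β : LinkPattern N) (hu : β.partner u < u) (hv : v < β.partner v),
      β.close u v huv hu hv = γ := by
  classical
  obtain ⟨a, ha, ha'⟩ := γ.exists_open_of_height_pos hpos
  have hvu := γ.partner_eq_iff.1 h
  have enc : ∀ a : Fin (2 * N), a < u → u ≤ γ.partner a → v < γ.partner a := by
    intro a h1 h2
    have h3 : γ.partner a ≠ u := fun h3 => by
      have := γ.partner_eq_iff.1 h3
      rw [h] at this
      simp only [Fin.ext_iff, Fin.lt_def, Fin.le_def] at *
      omega
    have h4 : γ.partner a ≠ v := fun h4 => by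
      have := γ.partner_eq_iff.1 h4
      rw [hvu] at this
      simp only [Fin.ext_iff, Fin.lt_def, Fin.le_def] at *
      omega
    simp only [ne_eq, Fin.ext_iff, Fin.lt_def, Fin.le_def] at *
    omega
  have hne : (Finset.univ.filter fun a : Fin (2 * N) => a < u ∧ v < γ.partner a).Nonempty :=
    ⟨a, by simpa using ⟨ha, enc a ha ha'⟩⟩
  obtain ⟨c, hc, hmax⟩ := Finset.exists_max_image _ id hne
  simp only [Finset.mem_filter, Finset.mem_univ, true_and, id] at hc hmax
  have hin : ∀ a, c < a → a < u → ¬ v < γ.partner a := fun a h1 h2 h3 =>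
    absurd (hmax a ⟨h2, h3⟩) (not_le.2 h1)
  have hvd := hc.2
  have hcu := hc.1
  obtain ⟨d, hd⟩ : ∃ d, γ.partner c = d := ⟨_, rfl⟩
  rw [hd] at hvd
  have hdc := γ.partner_eq_iff.1 hd
  have hud : u ≠ d := by simp only [ne_eq, Fin.ext_iff, Fin.lt_def] at *; omega
  have e1 : (γ.openPeak u v c d huv h hd hcu hvd hin).partner u = c := by
    simp only [openPeak, Equiv.swap_apply_left, hdc]
    exact Equiv.swap_apply_of_ne_of_ne hcu.ne (by
      simp only [ne_eq, Fin.ext_iff, Fin.lt_def] at *; omega)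
  have e2 : (γ.openPeak u v c d huv h hd hcu hvd hin).partner v = d := by
    simp only [openPeak]
    rw [Equiv.swap_apply_of_ne_of_ne (x := v), hvu, Equiv.swap_apply_left] <;>
      simp only [ne_eq, Fin.ext_iff, Fin.lt_def] at * <;> omega
  refine ⟨γ.openPeak u v c d huv h hd hcu hvd hin, by rw [e1]; exact hcu, by rw [e2]; exact hvd, ?_⟩
  ext x
  simp only [close, e2]
  simp [openPeak]

end Close

/-! ### Inserting a short link -/

section Insert

variable {n : ℕ}

/-- The increasing map from `2n` to `2n + 2` indices whose image misses `j` and `j + 1`. -/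
def skip (j : ℕ) (x : Fin (2 * n)) : Fin (2 * (n + 1)) :=
  ⟨if x.val < j then x else x + 2, by split_ifs <;> omega⟩

/-- The left inverse of `skip j`, defined away from `j` and `j + 1`. -/
def unskip (j : ℕ) (hj : j ≤ 2 * n) (y : Fin (2 * (n + 1))) (h1 : y.val ≠ j)
    (h2 : y.val ≠ j + 1) : Fin (2 * n) :=
  ⟨if y.val < j then y else y - 2, by split_ifs <;> omega⟩

theorem skip_unskip {j : ℕ} (hj : j ≤ 2 * n) (y : Fin (2 * (n + 1))) (h1 : y.val ≠ j)
    (h2 : y.val ≠ j + 1) : skip j (unskip j hj y h1 h2) = y := by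
  simp only [skip, unskip, Fin.ext_iff]
  split_ifs <;> omega

theorem unskip_skip {j : ℕ} (hj : j ≤ 2 * n) (x : Fin (2 * n)) (h1 : (skip j x).val ≠ j)
    (h2 : (skip j x).val ≠ j + 1) : unskip j hj (skip j x) h1 h2 = x := by
  simp only [skip, unskip, Fin.ext_iff]
  split_ifs <;> omega

theorem skip_ne (j : ℕ) (x : Fin (2 * n)) : (skip j x).val ≠ j ∧ (skip j x).val ≠ j + 1 := by
  simp only [skip]
  split_ifs <;> omega

theorem skip_injective (j : ℕ) : Function.Injective (skip (n := n) j) := by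
  intro x y h
  simp only [skip, Fin.ext_iff] at *
  split_ifs at h <;> omega

theorem skip_lt_iff {j : ℕ} {x y : Fin (2 * n)} : skip j x < skip j y ↔ x < y := by
  simp only [skip, Fin.lt_def]
  split_ifs <;> omega

/-- Insert the short link `{j, j + 1}` into a link pattern. -/
def ins (j : ℕ) (hj : j ≤ 2 * n) (γ : LinkPattern n) : LinkPattern (n + 1) where
  partner y := if h1 : y.val = j then ⟨j + 1, by omega⟩ else if h2 : y.val = j + 1 then
    ⟨j, by omega⟩ else skip j (γ.partner (unskip j hj y h1 h2))
  partner_partner a := by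
    by_cases h1 : a.val = j
    · simp [h1, Fin.ext_iff]
    by_cases h2 : a.val = j + 1
    · simp [h2, Fin.ext_iff]
    have := skip_ne j (γ.partner (unskip j hj a h1 h2))
    simp [h1, h2, this, unskip_skip, γ.partner_partner, skip_unskip]
  partner_ne a := by
    by_cases h1 : a.val = j
    · simp [h1, Fin.ext_iff]
    by_cases h2 : a.val = j + 1
    · simp [h2, Fin.ext_iff]
    simp only [h1, h2, dite_false]
    intro h
    have h3 := γ.partner_ne (unskip j hj a h1 h2)
    apply h3
    apply skip_injective j
    rw [h, skip_unskip]
  noncrossing a b := by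
    by_cases a1 : a.val = j
    · simp only [a1, dite_true, Fin.lt_def]; omega
    by_cases a2 : a.val = j + 1
    · simp only [a2, Nat.add_eq_left, one_ne_zero, dite_true, dite_false, Fin.lt_def]; omega
    by_cases b1 : b.val = j
    · have := skip_ne j (γ.partner (unskip j hj a a1 a2))
      simp only [a1, a2, b1, dite_true, dite_false, Fin.lt_def]; omega
    by_cases b2 : b.val = j + 1
    · have := skip_ne j (γ.partner (unskip j hj a a1 a2))
      simp only [a1, a2, b2, Nat.add_eq_left, one_ne_zero, dite_true, dite_false, Fin.lt_def]; omega
    simp only [a1, a2, b1, b2, dite_false]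
    intro h1 h2 h3
    refine γ.noncrossing (unskip j hj a a1 a2) (unskip j hj b b1 b2) ?_ ?_ (skip_lt_iff.1 h3) <;>
      rw [← skip_lt_iff (j := j)] <;> simpa only [skip_unskip]

variable {j : ℕ} (hj : j ≤ 2 * n) (γ : LinkPattern n)

theorem ins_partner_left : (ins j hj γ).partner ⟨j, by omega⟩ = ⟨j + 1, by omega⟩ := by
  simp [ins]

theorem ins_partner_right : (ins j hj γ).partner ⟨j + 1, by omega⟩ = ⟨j, by omega⟩ := by
  simp [ins]

theorem ins_partner_skip (x : Fin (2 * n)) :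
    (ins j hj γ).partner (skip j x) = skip j (γ.partner x) := by
  simp [ins, skip_ne, unskip_skip]

theorem eq_skip (hj : j ≤ 2 * n) (y : Fin (2 * (n + 1))) :
    y.val = j ∨ y.val = j + 1 ∨ ∃ x, y = skip j x := by
  by_cases h1 : y.val = j
  · exact Or.inl h1
  by_cases h2 : y.val = j + 1
  · exact Or.inr (Or.inl h2)
  exact Or.inr (Or.inr ⟨_, (skip_unskip hj y h1 h2).symm⟩)

theorem ins_injective : Function.Injective (ins j hj : LinkPattern n → LinkPattern (n + 1)) := by
  intro γ₁ γ₂ h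
  ext x : 2
  apply skip_injective j
  rw [← ins_partner_skip hj, ← ins_partner_skip hj, h]

theorem exists_ins_eq (β : LinkPattern (n + 1))
    (h : β.partner ⟨j, by omega⟩ = ⟨j + 1, by omega⟩) : ∃ γ, ins j hj γ = β := by
  have h' := β.partner_eq_iff.1 h
  have hne : ∀ x : Fin (2 * n), (β.partner (skip j x)).val ≠ j ∧
      (β.partner (skip j x)).val ≠ j + 1 := by
    intro x
    have h1 := skip_ne j x
    constructor
    · intro h2
      have h3 : β.partner (skip j x) = ⟨j, by omega⟩ := Fin.ext h2
      rw [β.partner_eq_iff, h] at h3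
      exact h1.2 (Fin.ext_iff.1 h3).symm
    · intro h2
      have h3 : β.partner (skip j x) = ⟨j + 1, by omega⟩ := Fin.ext h2
      rw [β.partner_eq_iff, h'] at h3
      exact h1.1 (Fin.ext_iff.1 h3).symm
  refine ⟨⟨fun x => unskip j hj (β.partner (skip j x)) (hne x).1 (hne x).2, ?_, ?_, ?_⟩, ?_⟩
  · intro a
    apply skip_injective j
    simp [skip_unskip, β.partner_partner]
  · intro a ha
    have := congrArg (skip j) ha
    rw [skip_unskip] at this
    exact β.partner_ne _ this
  · intro a b h1 h2 h3
    rw [← skip_lt_iff (j := j)] at h1 h2 h3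
    rw [skip_unskip] at h2
    rw [skip_unskip, skip_unskip] at h3
    exact β.noncrossing _ _ h1 h2 h3
  · ext y : 2
    rcases eq_skip hj y with h1 | h1 | ⟨x, rfl⟩
    · rw [show y = ⟨j, by omega⟩ from Fin.ext h1, ins_partner_left, h]
    · rw [show y = ⟨j + 1, by omega⟩ from Fin.ext h1, ins_partner_right, h']
    · rw [ins_partner_skip]
      exact skip_unskip hj _ (hne x).1 (hne x).2

theorem lt_ins_partner_skip (x : Fin (2 * n)) :
    skip j x < (ins j hj γ).partner (skip j x) ↔ x < γ.partner x := by
  rw [ins_partner_skip, skip_lt_iff]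

theorem height_ins_of_le {x : ℕ} (hx : x ≤ j) : (ins j hj γ).height x = γ.height x := by
  have := height_eq_of_lt_iff (α := ins j hj γ) (β := γ) (x := 0) (k := 0) (i := 0) x (by simp)
    (by omega) (by omega) (by
      intro r hr h1 h2
      rw [← lt_ins_partner_skip hj]
      have : skip j (⟨0 + r, h2⟩ : Fin (2 * n)) = ⟨0 + r, h1⟩ := by
        simp only [skip, Fin.ext_iff]; rw [if_pos]; omega
      rw [this])
  simpa using this

theorem height_ins_peak : (ins j hj γ).height (j + 1) = γ.height j + 1 := by
  have := (ins j hj γ).height_succ ⟨j, by omega⟩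
  rw [ins_partner_left] at this
  simpa [height_ins_of_le] using this

theorem height_ins_add_two {x : ℕ} (hx : j ≤ x) : (ins j hj γ).height (x + 2) = γ.height x := by
  have h0 := (ins j hj γ).height_succ ⟨j + 1, by omega⟩
  rw [ins_partner_right] at h0
  simp only [height_ins_peak, Fin.lt_def] at h0
  rw [if_neg (by omega)] at h0
  by_cases hx' : x ≤ 2 * n
  · obtain ⟨t, rfl⟩ := Nat.exists_eq_add_of_le hx
    have := height_eq_of_lt_iff (α := ins j hj γ) (β := γ) (x := j + 2) (k := j) (i := 0) t
      (by rw [h0]; ring) (by omega) (by omega) (by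
        intro r hr h1 h2
        rw [← lt_ins_partner_skip hj]
        have : skip j (⟨j + r, h2⟩ : Fin (2 * n)) = ⟨j + 2 + r, h1⟩ := by
          simp only [skip, Fin.ext_iff]; rw [if_neg (by omega)]; omega
        rw [this])
    rw [show j + t + 2 = j + 2 + t by ring, this, add_zero]
  · rw [height_of_ge _ (by omega), height_of_ge _ (by omega)]

theorem ins_le_ins_iff {γ₁ γ₂ : LinkPattern n} : ins j hj γ₁ ≤ ins j hj γ₂ ↔ γ₁ ≤ γ₂ := by
  simp only [le_def]
  constructor
  · intro h x
    rcases le_total x j with hx | hx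
    · have := h x
      rwa [height_ins_of_le hj _ hx, height_ins_of_le hj _ hx] at this
    · have := h (x + 2)
      rwa [height_ins_add_two hj _ hx, height_ins_add_two hj _ hx] at this
  · intro h x
    rcases le_or_gt x j with hx | hx
    · rw [height_ins_of_le hj _ hx, height_ins_of_le hj _ hx]
      exact h x
    · rcases Nat.eq_or_lt_of_le hx with rfl | hx
      · rw [height_ins_peak, height_ins_peak]
        have := h j
        omega
      · obtain ⟨y, rfl⟩ : ∃ y, x = y + 2 := ⟨x - 2, by omega⟩
        rw [height_ins_add_two hj _ (by omega), height_ins_add_two hj _ (by omega)]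
        exact h y

end Insert

end LinkPattern


/-! ### Dyck tilings -/

/-- A Dyck tile is the graph of a lattice path on an interval which ends at its starting height and
stays weakly above it. -/
theorem isDyckTile_iff {t : Finset (ℕ × ℤ)} : IsDyckTile t ↔
    ∃ (l r : ℕ) (H : ℕ → ℤ), l ≤ r ∧ (∀ y, l ≤ y → y < r → H (y + 1) = H y + 1 ∨ H (y + 1) = H y - 1) ∧
      (∀ y, l ≤ y → y ≤ r → H l ≤ H y) ∧ H r = H l ∧
      ∀ y h, (y, h) ∈ t ↔ l ≤ y ∧ y ≤ r ∧ h = H y := by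
  constructor
  · rintro ⟨x, n, h, h1, h2, h3, rfl⟩
    refine ⟨x, x + 2 * n, fun y => h (y - x), by omega, ?_, ?_, ?_, ?_⟩
    · intro y hy hy'
      have := h1 (y - x) (by omega)
      rwa [show y - x + 1 = y + 1 - x by omega] at this
    · intro y hy hy'
      simpa using h2 (y - x) (by omega)
    · simpa using h3
    · intro y k
      simp only [Finset.mem_image, Finset.mem_range, Prod.mk.injEq]
      constructor
      · rintro ⟨i, hi, rfl, rfl⟩
        exact ⟨by omega, by omega, by simp⟩
      · rintro ⟨a, b, rfl⟩
        exact ⟨y - x, by omega, by omega, rfl⟩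
  · rintro ⟨l, r, H, hlr, h1, h2, h3, h4⟩
    have par : ∀ y, l ≤ y → y ≤ r → Even (H y - H l - (y - l : ℕ)) := by
      intro y hy
      induction y, hy using Nat.le_induction with
      | base => simp
      | succ y hy ih =>
        intro hy'
        have h5 := ih (by omega)
        have h6 := h1 y hy (by omega)
        rw [Int.even_iff] at *
        omega
    obtain ⟨n, hn⟩ : ∃ n, r = l + 2 * n := by
      have h5 := par r hlr le_rfl
      rw [h3, Int.even_iff] at h5
      exact ⟨(r - l) / 2, by omega⟩
    refine ⟨l, n, fun i => H (l + i), ?_, ?_, ?_, ?_⟩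
    · intro i hi
      exact h1 (l + i) (by omega) (by omega)
    · intro i hi
      exact h2 (l + i) (by omega) (by omega)
    · simp only [← hn, h3, add_zero]
    · ext ⟨y, k⟩
      rw [h4]
      simp only [Finset.mem_image, Finset.mem_range, Prod.mk.injEq]
      constructor
      · rintro ⟨a, b, rfl⟩
        exact ⟨y - l, by omega, by omega, by congr 1; omega⟩
      · rintro ⟨i, hi, rfl, rfl⟩
        exact ⟨by omega, by omega, rfl⟩

theorem isDyckTile_singleton (c : ℕ × ℤ) : IsDyckTile {c} := by
  refine isDyckTile_iff.2 ⟨c.1, c.1, fun _ => c.2, le_rfl, ?_, ?_, rfl, ?_⟩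
  · intro y h1 h2; omega
  · intro y h1 h2; rfl
  · intro y h
    rw [Finset.mem_singleton, Prod.ext_iff]
    simp only
    omega

theorem IsDyckTile.unique {t : Finset (ℕ × ℤ)} (ht : IsDyckTile t) {x : ℕ} {h h' : ℤ}
    (h1 : (x, h) ∈ t) (h2 : (x, h') ∈ t) : h = h' := by
  obtain ⟨l, r, H, -, -, -, -, h4⟩ := isDyckTile_iff.1 ht
  rw [((h4 _ _).1 h1).2.2, ((h4 _ _).1 h2).2.2]

theorem IsDyckTile.nonempty {t : Finset (ℕ × ℤ)} (ht : IsDyckTile t) : t.Nonempty := by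
  obtain ⟨l, r, H, h0, -, -, -, h4⟩ := isDyckTile_iff.1 ht
  exact ⟨(l, H l), (h4 _ _).2 ⟨le_rfl, h0, rfl⟩⟩

/-- The set of tiles `P` is a cover-inclusive Dyck tiling of the set of cells `D`. -/
structure IsTiling (D : Finset (ℕ × ℤ)) (P : Finset (Finset (ℕ × ℤ))) : Prop where
  isDyckTile : ∀ t ∈ P, IsDyckTile t
  subset : ∀ t ∈ P, t ⊆ D
  exists_mem : ∀ c ∈ D, ∃ t ∈ P, c ∈ t
  eq_of_mem : ∀ s ∈ P, ∀ t ∈ P, ∀ c, c ∈ s → c ∈ t → s = t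
  cover : ∀ s ∈ P, ∀ t ∈ P, (∃ x h, (x, h) ∈ s ∧ (x, h + 2) ∈ t) →
    t.image Prod.fst ⊆ s.image Prod.fst

theorem IsTiling.finite (D : Finset (ℕ × ℤ)) : {P | IsTiling D P}.Finite :=
  (Finset.finite_toSet D.powerset.powerset).subset fun P hP => by
    rw [Finset.mem_coe, Finset.mem_powerset]
    intro t ht
    exact Finset.mem_powerset.2 (hP.subset t ht)

theorem LinkPattern.numTilings_eq {N : ℕ} (α β : LinkPattern N) :
    LinkPattern.numTilings α β = {P | IsTiling (skewDiagram α β) P}.ncard := by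
  unfold numTilings
  rw [← Nat.card_coe_set_eq]
  refine Nat.card_congr (Equiv.ofBijective (fun P => ⟨P.1.parts, ?_, ?_, ?_, ?_, ?_⟩) ⟨?_, ?_⟩)
  · exact P.2.1
  · intro t ht
    exact P.1.le ht
  · intro c hc
    exact P.1.exists_mem hc
  · intro s hs t ht c h1 h2
    exact P.1.eq_of_mem_parts hs ht h1 h2
  · exact P.2.2
  · intro P Q h
    apply Subtype.ext
    apply Finpartition.ext
    simpa using h
  · rintro ⟨P, hP⟩
    refine ⟨⟨Finpartition.ofExistsUnique P hP.subset ?_ ?_, ?_, ?_⟩, ?_⟩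
    · intro c hc
      obtain ⟨t, ht, hct⟩ := hP.exists_mem c hc
      exact ⟨t, ⟨ht, hct⟩, fun s hs => hP.eq_of_mem _ hs.1 _ ht c hs.2 hct⟩
    · intro h
      exact Finset.not_nonempty_empty (hP.isDyckTile _ h).nonempty
    · exact hP.isDyckTile
    · exact hP.cover
    · rfl

/-- Adding a single cell at the top of a column: the tilings in which this cell is a tile are the
tilings of the other cells. -/
theorem ncard_tilings_insert {D : Finset (ℕ × ℤ)} {x : ℕ} {h : ℤ} (hc : (x, h) ∉ D)
    (hc' : (x, h + 2) ∉ D) :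
    {P | IsTiling (insert (x, h) D) P ∧ {(x, h)} ∈ P}.ncard = {P | IsTiling D P}.ncard := by
  classical
  symm
  refine Set.ncard_congr (fun P _ => insert {(x, h)} P) ?_ ?_ ?_
  · intro P hP
    refine ⟨⟨?_, ?_, ?_, ?_, ?_⟩, Finset.mem_insert_self _ _⟩
    · intro t ht
      rcases Finset.mem_insert.1 ht with rfl | ht
      · exact isDyckTile_singleton _
      · exact hP.isDyckTile t ht
    · intro t ht
      rcases Finset.mem_insert.1 ht with rfl | ht
      · simp
      · exact (hP.subset t ht).trans (Finset.subset_insert _ _)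
    · intro c hc
      rcases Finset.mem_insert.1 hc with rfl | hc
      · exact ⟨_, Finset.mem_insert_self _ _, by simp⟩
      · obtain ⟨t, ht, h1⟩ := hP.exists_mem c hc
        exact ⟨t, Finset.mem_insert_of_mem ht, h1⟩
    · intro s hs t ht c h1 h2
      rcases Finset.mem_insert.1 hs with rfl | hs <;> rcases Finset.mem_insert.1 ht with rfl | ht
      · rfl
      · rw [Finset.mem_singleton.1 h1] at h2
        exact absurd (hP.subset t ht h2) hc
      · rw [Finset.mem_singleton.1 h2] at h1
        exact absurd (hP.subset s hs h1) hc
      · exact hP.eq_of_mem s hs t ht c h1 h2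
    · rintro s hs t ht ⟨y, k, h1, h2⟩
      rcases Finset.mem_insert.1 hs with rfl | hs <;> rcases Finset.mem_insert.1 ht with rfl | ht
      · simp only [Finset.mem_singleton, Prod.mk.injEq] at h1 h2
        omega
      · simp only [Finset.mem_singleton, Prod.mk.injEq] at h1
        rw [h1.1, h1.2] at h2
        exact absurd (hP.subset t ht h2) hc'
      · simp only [Finset.mem_singleton, Prod.mk.injEq] at h2
        rw [Finset.image_singleton, Finset.singleton_subset_iff, Finset.mem_image]
        exact ⟨_, h1, h2.1⟩
      · exact hP.cover s hs t ht ⟨y, k, h1, h2⟩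
  · intro P Q hP hQ hPQ
    have hP' : {(x, h)} ∉ P := fun h' => hc (hP.subset _ h' (by simp))
    have hQ' : {(x, h)} ∉ Q := fun h' => hc (hQ.subset _ h' (by simp))
    rw [← Finset.erase_insert hP', ← Finset.erase_insert hQ', hPQ]
  · rintro P ⟨hP, hxP⟩
    have hne : ∀ t ∈ P.erase {(x, h)}, (x, h) ∉ t := fun t ht h' =>
      (Finset.mem_erase.1 ht).1
        (hP.eq_of_mem t (Finset.mem_erase.1 ht).2 _ hxP _ h' (by simp))
    refine ⟨P.erase {(x, h)}, ⟨?_, ?_, ?_, ?_, ?_⟩, Finset.insert_erase hxP⟩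
    · exact fun t ht => hP.isDyckTile t (Finset.mem_of_mem_erase ht)
    · intro t ht c hct
      rcases Finset.mem_insert.1 (hP.subset t (Finset.mem_of_mem_erase ht) hct) with rfl | h'
      · exact absurd hct (hne t ht)
      · exact h'
    · intro c hcD
      obtain ⟨t, ht, hct⟩ := hP.exists_mem c (Finset.mem_insert_of_mem hcD)
      refine ⟨t, Finset.mem_erase.2 ⟨?_, ht⟩, hct⟩
      rintro rfl
      rw [Finset.mem_singleton.1 hct] at hcD
      exact hc hcD
    · exact fun s hs t ht => hP.eq_of_mem s (Finset.mem_of_mem_erase hs) t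
        (Finset.mem_of_mem_erase ht)
    · exact fun s hs t ht => hP.cover s (Finset.mem_of_mem_erase hs) t
        (Finset.mem_of_mem_erase ht)

namespace LinkPattern

variable {N : ℕ} {α β : LinkPattern N}

theorem mem_skewDiagram {x : ℕ} {h : ℤ} : (x, h) ∈ skewDiagram α β ↔
    α.height x < h ∧ h < β.height x ∧ Odd ((x : ℤ) + h) := by
  simp only [skewDiagram, Finset.mem_filter, Finset.mem_product, Finset.mem_range, Finset.mem_Icc,
    and_iff_right_iff_imp]
  rintro ⟨h1, h2, -⟩
  have h3 := α.height_nonneg x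
  have h4 := β.height_le x
  refine ⟨?_, by omega, by omega⟩
  by_contra hx
  rw [β.height_of_ge (by omega)] at h2
  omega

theorem numTilings_self (α : LinkPattern N) : numTilings α α = 1 := by
  have hD : skewDiagram α α = ∅ := by
    ext ⟨x, h⟩
    rw [mem_skewDiagram]
    simp only [Finset.notMem_empty, iff_false]
    omega
  rw [numTilings_eq, hD, Set.ncard_eq_one]
  refine ⟨∅, Set.ext fun P => ⟨fun hP => ?_, ?_⟩⟩
  · rw [Set.mem_singleton_iff, Finset.eq_empty_iff_forall_notMem]
    intro t ht
    obtain ⟨c, hc⟩ := (hP.isDyckTile t ht).nonempty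
    simpa using hP.subset t ht hc
  · rintro rfl
    constructor <;> simp

/-- The number of cover-inclusive Dyck tilings in which the top cell of the column `x` is a tile. -/
noncomputable def numTopped (α β : LinkPattern N) (x : ℕ) : ℕ :=
  {P | IsTiling (skewDiagram α β) P ∧ {(x, β.height x - 1)} ∈ P}.ncard

/-- The number of cover-inclusive Dyck tilings in which the top cell of the column `x` is not a
tile. -/
noncomputable def numUntopped (α β : LinkPattern N) (x : ℕ) : ℕ :=
  {P | IsTiling (skewDiagram α β) P ∧ {(x, β.height x - 1)} ∉ P}.ncard

theorem numTilings_eq_add (x : ℕ) : numTilings α β = numTopped α β x + numUntopped α β x := by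
  have hfin := IsTiling.finite (skewDiagram α β)
  rw [numTilings_eq, numTopped, numUntopped, ← Set.ncard_union_eq _
    (hfin.subset fun P hP => hP.1) (hfin.subset fun P hP => hP.1)]
  · congr 1
    ext P
    simp only [Set.mem_union, Set.mem_ofPred_eq]
    tauto
  · rw [Set.disjoint_left]
    rintro P ⟨-, h1⟩ ⟨-, h2⟩
    exact h2 h1

section Peak

variable {u v : Fin (2 * N)}

theorem height_peak (huv : v.val = u.val + 1) (hβ : β.partner u = v) :
    β.height v = β.height u + 1 ∧ β.height (v + 1) = β.height u := by
  have h1 := β.height_succ u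
  have h2 := β.height_succ v
  rw [β.partner_eq_iff.1 hβ, if_neg (by simp only [Fin.lt_def]; omega)] at h2
  rw [hβ, if_pos (by simp only [Fin.lt_def]; omega), ← huv] at h1
  exact ⟨h1, by rw [h2, h1]; ring⟩

/-- In a cover-inclusive Dyck tiling below a peak whose top cell is not a tile, all tiles in the
column of the peak have a local maximum there. -/
theorem tile_of_peak (huv : v.val = u.val + 1) (hβ : β.partner u = v)
    {P : Finset (Finset (ℕ × ℤ))} (hP : IsTiling (skewDiagram α β) P)
    (htop : {(v.val, β.height v - 1)} ∉ P) (k : ℕ) {t : Finset (ℕ × ℤ)} (ht : t ∈ P)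
    (hk : (v.val, β.height v - 1 - 2 * k) ∈ t) :
    (u.val, β.height v - 2 - 2 * k) ∈ t ∧ (v.val + 1, β.height v - 2 - 2 * k) ∈ t := by
  obtain ⟨hb1, hb2⟩ := height_peak huv hβ
  induction k generalizing t with
  | zero =>
    obtain ⟨l, r, H, -, h1, h2, h3, h4⟩ := isDyckTile_iff.1 (hP.isDyckTile t ht)
    simp only [Nat.cast_zero, mul_zero, sub_zero] at *
    obtain ⟨hl, hr, hH⟩ := (h4 _ _).1 hk
    have hbd : ∀ y, l ≤ y → y ≤ r → H y < β.height y := fun y hy hy' =>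
      (mem_skewDiagram.1 (hP.subset t ht ((h4 _ _).2 ⟨hy, hy', rfl⟩))).2.1
    have hvr : v.val + 1 ≤ r → H (v + 1) = β.height v - 2 := by
      intro h
      have e1 := hbd _ (by omega) h
      have e2 := h1 v hl (by omega)
      omega
    have hvl : l ≤ u.val → H u = β.height v - 2 := by
      intro h
      have e1 := hbd u (by omega) (by omega)
      have e2 := h1 u h (by omega)
      rw [← huv] at e2
      omega
    have hl' : l ≤ u.val := by
      by_contra hlu
      have e : l = v := by omega
      by_cases hr' : v.val + 1 ≤ r
      · have := h2 (v + 1) (by omega) hr'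
        rw [hvr hr', e] at this
        omega
      · apply htop
        convert ht using 1
        ext ⟨y, h⟩
        rw [h4, Finset.mem_singleton, Prod.mk.injEq]
        constructor
        · rintro ⟨rfl, rfl⟩
          exact ⟨hl, hr, hH⟩
        · rintro ⟨e1, e2, e3⟩
          have e4 : y = v := by omega
          exact ⟨e4, by rw [e3, e4, hH]⟩
    have hr' : v.val + 1 ≤ r := by
      by_contra hvr
      have e : r = v := by omega
      have := h2 u hl' (by omega)
      rw [hvl hl', ← h3, e] at this
      omega
    exact ⟨(h4 _ _).2 ⟨hl', by omega, (hvl hl').symm⟩, (h4 _ _).2 ⟨by omega, hr', (hvr hr').symm⟩⟩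
  | succ k ih =>
    obtain ⟨l, r, H, -, h1, h2, h3, h4⟩ := isDyckTile_iff.1 (hP.isDyckTile t ht)
    obtain ⟨hl, hr, hH⟩ := (h4 _ _).1 hk
    have hD : (v.val, β.height v - 1 - 2 * (k : ℤ)) ∈ skewDiagram α β := by
      have := mem_skewDiagram.1 (hP.subset t ht hk)
      rw [mem_skewDiagram]
      rw [Int.odd_iff] at *
      push_cast at *
      omega
    obtain ⟨t', ht', hk'⟩ := hP.exists_mem _ hD
    obtain ⟨i1, i2⟩ := ih ht' hk'
    have hcov := hP.cover t ht t' ht' ⟨v, β.height v - 1 - 2 * ((k + 1 : ℕ) : ℤ), hk, by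
      convert hk' using 2; push_cast; ring⟩
    have hne : t ≠ t' := by
      rintro rfl
      have := (hP.isDyckTile t ht).unique hk hk'
      push_cast at this
      omega
    have hext : ∀ y h, (y, h) ∈ t' → l ≤ y ∧ y ≤ r := by
      intro y h hy
      obtain ⟨⟨y', h'⟩, e1, e2⟩ := Finset.mem_image.1 (hcov (Finset.mem_image.2 ⟨_, hy, rfl⟩))
      simp only at e2
      subst e2
      have := (h4 _ _).1 e1
      omega
    have hl' := (hext _ _ i1).1
    have hr' := (hext _ _ i2).2
    have e1 := h1 u hl' (by omega)
    have e2 := h1 v hl (by omega)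
    rw [← huv] at e1
    have f1 : H u ≠ β.height v - 2 - 2 * k := fun h =>
      hne (hP.eq_of_mem t ht t' ht' _ ((h4 _ _).2 ⟨hl', by omega, h.symm⟩) i1)
    have f2 : H (v + 1) ≠ β.height v - 2 - 2 * k := fun h =>
      hne (hP.eq_of_mem t ht t' ht' _ ((h4 _ _).2 ⟨by omega, hr', h.symm⟩) i2)
    push_cast at *
    exact ⟨(h4 _ _).2 ⟨hl', by omega, by omega⟩, (h4 _ _).2 ⟨by omega, hr', by omega⟩⟩

theorem tile_of_peak' (huv : v.val = u.val + 1) (hβ : β.partner u = v)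
    {P : Finset (Finset (ℕ × ℤ))} (hP : IsTiling (skewDiagram α β) P)
    (htop : {(v.val, β.height v - 1)} ∉ P) {h : ℤ} {t : Finset (ℕ × ℤ)} (ht : t ∈ P)
    (hk : (v.val, h) ∈ t) : (u.val, h - 1) ∈ t ∧ (v.val + 1, h - 1) ∈ t := by
  have hD := mem_skewDiagram.1 (hP.subset t ht hk)
  have hpar := β.height_parity v.2.le
  rw [Int.odd_iff] at hD
  rw [Int.even_iff] at hpar
  obtain ⟨k, hk'⟩ : ∃ k : ℕ, h = β.height v - 1 - 2 * k :=
    ⟨((β.height v - 1 - h) / 2).toNat, by omega⟩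
  subst hk'
  have := tile_of_peak huv hβ hP htop k ht hk
  rwa [show β.height v - 1 - 2 * (k : ℤ) - 1 = β.height v - 2 - 2 * k by ring]

/-- If the lower path has no peak in the column of a peak of the upper path, then the top cell of
this column is a tile. -/
theorem singleton_mem_of_not_peak (huv : v.val = u.val + 1) (hβ : β.partner u = v)
    (hα : α.partner u ≠ v) (hlt : α.height v < β.height v)
    {P : Finset (Finset (ℕ × ℤ))} (hP : IsTiling (skewDiagram α β) P) :
    {(v.val, β.height v - 1)} ∈ P := by
  by_contra htop
  have hpb := β.height_parity v.2.le
  have hpa := α.height_parity v.2.le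
  have hD : (v.val, α.height v + 1) ∈ skewDiagram α β := by
    rw [mem_skewDiagram]
    rw [Int.even_iff] at *
    rw [Int.odd_iff]
    omega
  obtain ⟨t, ht, hct⟩ := hP.exists_mem _ hD
  obtain ⟨h1, h2⟩ := tile_of_peak' huv hβ hP htop ht hct
  have h1' := (mem_skewDiagram.1 (hP.subset t ht h1)).1
  have h2' := (mem_skewDiagram.1 (hP.subset t ht h2)).1
  have e1 := α.height_succ u
  have e2 := α.height_succ v
  rw [← huv] at e1
  apply hα
  apply α.partner_eq_of_adjacent huv
  · by_contra h
    rw [if_neg h] at e1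
    omega
  · rw [← α.not_lt_partner_iff]
    intro h
    rw [if_pos h] at e2
    omega

theorem skewDiagram_close (huv : v.val = u.val + 1) (hu : β.partner u < u) (hv : v < β.partner v)
    (hle : α ≤ β) : skewDiagram α (β.close u v huv hu hv) =
      insert (v.val, (β.close u v huv hu hv).height v - 1) (skewDiagram α β) := by
  ext ⟨x, h⟩
  have hx := le_def.1 hle x
  have hpb := β.height_parity v.2.le
  rw [Finset.mem_insert, mem_skewDiagram, mem_skewDiagram, β.height_close huv hu hv,
    β.height_close huv hu hv, Prod.mk.injEq, if_pos rfl]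
  by_cases hxv : x = v
  · subst hxv
    rw [if_pos rfl]
    rw [Int.even_iff] at *
    rw [Int.odd_iff]
    omega
  · simp [hxv]

theorem numTopped_close (huv : v.val = u.val + 1) (hu : β.partner u < u)
    (hv : v < β.partner v) (hle : α ≤ β) :
    numTopped α (β.close u v huv hu hv) v = numTilings α β := by
  rw [numTopped, skewDiagram_close huv hu hv hle, ncard_tilings_insert, numTilings_eq]
  all_goals
    rw [mem_skewDiagram, β.height_close huv hu hv, if_pos rfl]
    omega

theorem numTopped_eq_zero {x : ℕ} (h : β.height x ≤ α.height x) : numTopped α β x = 0 := by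
  rw [numTopped, Set.ncard_eq_zero ((IsTiling.finite _).subset fun P hP => hP.1)]
  ext P
  simp only [Set.mem_ofPred_eq, Set.mem_empty_iff_false, iff_false, not_and]
  intro hP h'
  have := hP.subset _ h' (Finset.mem_singleton_self _)
  rw [mem_skewDiagram] at this
  omega

theorem numUntopped_eq_zero (huv : v.val = u.val + 1) (hβ : β.partner u = v)
    (hα : α.partner u ≠ v) (hle : α ≤ β) : numUntopped α β v = 0 := by
  rw [numUntopped, Set.ncard_eq_zero ((IsTiling.finite _).subset fun P hP => hP.1)]
  ext P
  simp only [Set.mem_ofPred_eq, Set.mem_empty_iff_false, iff_false, not_and, not_not]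
  refine singleton_mem_of_not_peak huv hβ hα (lt_of_le_of_ne (le_def.1 hle v) fun heq => hα ?_)
  -- equal heights at the peak of the upper path would make a peak of the lower path
  obtain ⟨hb1, hb2⟩ := height_peak huv hβ
  have h1 := le_def.1 hle u
  have h2 := le_def.1 hle (v + 1)
  have e1 := α.height_succ u
  have e2 := α.height_succ v
  rw [← huv] at e1
  apply α.partner_eq_of_adjacent huv
  · by_contra h
    rw [if_neg h] at e1
    omega
  · rw [← α.not_lt_partner_iff]
    intro h
    rw [if_pos h] at e2
    omega

end Peak

end LinkPattern


/-! ### Dyck tilings below a common peak -/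

/-- The map of cells which collapses the columns `j`, `j + 1`, `j + 2` to the column `j`. -/
def collapse (j : ℕ) (c : ℕ × ℤ) : ℕ × ℤ :=
  if c.1 ≤ j then c else if c.1 = j + 1 then (j, c.2 - 1) else (c.1 - 2, c.2)

theorem collapse_surjective (j : ℕ) : Function.Surjective (collapse j) := by
  rintro ⟨x, h⟩
  by_cases hx : x ≤ j
  · exact ⟨(x, h), by simp [collapse, hx]⟩
  · refine ⟨(x + 2, h), ?_⟩
    simp only [collapse]
    rw [if_neg (by omega), if_neg (by omega)]
    simp

theorem collapse_fst_mono (j : ℕ) {c c' : ℕ × ℤ} (h : c.1 = c'.1) :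
    (collapse j c).1 = (collapse j c').1 := by
  simp only [collapse, h]
  split_ifs <;> simp [h]

/-- Pulling a Dyck tile back along `collapse j` inserts a local maximum and gives a Dyck tile. -/
theorem IsDyckTile.preimage_collapse {j : ℕ} {t t' : Finset (ℕ × ℤ)} (ht : IsDyckTile t)
    (h : ∀ c, c ∈ t' ↔ collapse j c ∈ t) : IsDyckTile t' := by
  obtain ⟨l, r, H, h0, h1, h2, h3, h4⟩ := isDyckTile_iff.1 ht
  refine isDyckTile_iff.2 ⟨if l ≤ j then l else l + 2, if r < j then r else r + 2,
    fun y => if y ≤ j then H y else if y = j + 1 then H j + 1 else H (y - 2), ?_, ?_, ?_, ?_, ?_⟩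
  · split_ifs <;> omega
  · intro y hy hy'
    beta_reduce
    by_cases c1 : y < j
    · have := h1 y (by split_ifs at hy <;> omega) (by split_ifs at hy' <;> omega)
      simp only [show y + 1 ≤ j by omega, show y ≤ j by omega, if_true]
      exact this
    by_cases c2 : y = j
    · subst c2
      simp
    by_cases c3 : y = j + 1
    · subst c3
      simp
    have := h1 (y - 2) (by split_ifs at hy <;> omega) (by split_ifs at hy' <;> omega)
    rw [if_neg (by omega), if_neg (by omega), if_neg (by omega), if_neg (by omega)]
    rwa [show y - 2 + 1 = y + 1 - 2 by omega] at this
  · intro y hy hy'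
    beta_reduce
    have e : (if (if l ≤ j then l else l + 2) ≤ j then H (if l ≤ j then l else l + 2) else
        if (if l ≤ j then l else l + 2) = j + 1 then H j + 1 else
          H ((if l ≤ j then l else l + 2) - 2)) = H l := by
      by_cases hl : l ≤ j
      · simp [hl]
      · simp only [hl, if_false]
        rw [if_neg (by omega), if_neg (by omega)]
        simp
    rw [e]
    by_cases c1 : y ≤ j
    · simp only [c1, if_true]
      exact h2 y (by split_ifs at hy <;> omega) (by split_ifs at hy' <;> omega)
    by_cases c2 : y = j + 1
    · have := h2 j (by split_ifs at hy <;> omega) (by split_ifs at hy' <;> omega)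
      simp only [c2, if_true]
      rw [if_neg (by omega)]
      omega
    · rw [if_neg c1, if_neg c2]
      exact h2 (y - 2) (by split_ifs at hy <;> omega) (by split_ifs at hy' <;> omega)
  · by_cases hl : l ≤ j <;> by_cases hr : r < j
    · simp only [hl, hr, if_true, hr.le, h3]
    · simp only [hl, hr, if_true, if_false]
      rw [if_neg (by omega), if_neg (by omega)]
      simpa using h3
    · omega
    · simp only [hl, hr, if_false]
      rw [if_neg (by omega), if_neg (by omega), if_neg (by omega), if_neg (by omega)]
      simpa using h3
  · intro y k
    rw [h]
    simp only [collapse]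
    by_cases c1 : y ≤ j
    · rw [if_pos c1, h4, if_pos c1]
      split_ifs <;> omega
    by_cases c2 : y = j + 1
    · rw [if_neg c1, if_pos c2, h4, if_neg c1, if_pos c2]
      split_ifs <;> omega
    · rw [if_neg c1, if_neg c2, h4, if_neg c1, if_neg c2]
      split_ifs <;> omega

/-- A Dyck tile which is a full preimage under `collapse j` collapses to a Dyck tile. -/
theorem IsDyckTile.of_preimage_collapse {j : ℕ} {t t' : Finset (ℕ × ℤ)} (ht : IsDyckTile t')
    (h : ∀ c, c ∈ t' ↔ collapse j c ∈ t) : IsDyckTile t := by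
  obtain ⟨l, r, H, h0, h1, h2, h3, h4⟩ := isDyckTile_iff.1 ht
  -- the three columns which are collapsed are either all met by the tile or not at all
  have sat : ∀ k, ((j, k) ∈ t' ↔ (j + 1, k + 1) ∈ t') ∧ ((j, k) ∈ t' ↔ (j + 2, k) ∈ t') := by
    intro k
    rw [h, h, h]
    simp [collapse]
  have s1 : l ≤ j → j ≤ r → j + 2 ≤ r ∧ H (j + 1) = H j + 1 ∧ H (j + 2) = H j := by
    intro a b
    have m : (j, H j) ∈ t' := (h4 _ _).2 ⟨a, b, rfl⟩
    have m1 := (h4 _ _).1 ((sat _).1.1 m)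
    have m2 := (h4 _ _).1 ((sat _).2.1 m)
    omega
  have s2 : l ≤ j + 1 → j + 1 ≤ r → l ≤ j := by
    intro a b
    have m : (j + 1, H (j + 1) - 1 + 1) ∈ t' := (h4 _ _).2 ⟨a, b, by ring⟩
    have m1 := (h4 _ _).1 ((sat _).1.2 m)
    omega
  have s3 : l ≤ j + 2 → j + 2 ≤ r → l ≤ j := by
    intro a b
    have m : (j + 2, H (j + 2)) ∈ t' := (h4 _ _).2 ⟨a, b, rfl⟩
    have m1 := (h4 _ _).1 ((sat _).2.2 m)
    omega
  have hl : l ≤ j ∨ j + 3 ≤ l := by omega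
  have hr : r < j ∨ j + 2 ≤ r := by omega
  have hmem : ∀ y k, (y, k) ∈ t ↔ ((if y ≤ j then y else y + 2), k) ∈ t' := by
    intro y k
    rw [h]
    by_cases c : y ≤ j
    · simp [collapse, c]
    · simp only [c, if_false, collapse]
      rw [if_neg (by omega), if_neg (by omega)]
      simp
  refine isDyckTile_iff.2 ⟨if l ≤ j then l else l - 2, if r < j then r else r - 2,
    fun y => if y ≤ j then H y else H (y + 2), ?_, ?_, ?_, ?_, ?_⟩
  · split_ifs <;> omega
  · intro y hy hy'
    beta_reduce
    by_cases c1 : y < j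
    · have := h1 y (by split_ifs at hy <;> omega) (by split_ifs at hy' <;> omega)
      simp only [show y + 1 ≤ j by omega, show y ≤ j by omega, if_true]
      exact this
    · have e := h1 (y + 2) (by split_ifs at hy <;> omega) (by split_ifs at hy' <;> omega)
      rw [if_neg (by omega)]
      by_cases c2 : y = j
      · have := s1 (by split_ifs at hy <;> omega) (by split_ifs at hy' <;> omega)
        subst c2
        simp only [le_refl, if_true]
        rw [← this.2.2]
        exact e
      · rw [if_neg (by omega)]
        exact e
  · intro y hy hy'
    beta_reduce
    have e : (if (if l ≤ j then l else l - 2) ≤ j then H (if l ≤ j then l else l - 2) else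
          H ((if l ≤ j then l else l - 2) + 2)) = H l := by
      by_cases hl : l ≤ j
      · simp [hl]
      · simp only [hl, if_false]
        rw [if_neg (by omega), show l - 2 + 2 = l by omega]
    rw [e]
    split_ifs with c1
    · exact h2 y (by split_ifs at hy <;> omega) (by split_ifs at hy' <;> omega)
    · exact h2 (y + 2) (by split_ifs at hy <;> omega) (by split_ifs at hy' <;> omega)
  · beta_reduce
    have er : (if (if r < j then r else r - 2) ≤ j then H (if r < j then r else r - 2) else
          H ((if r < j then r else r - 2) + 2)) = H r := by
      by_cases hr' : r < j
      · simp [hr', hr'.le]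
      · simp only [hr', if_false]
        by_cases hr2 : r - 2 ≤ j
        · have : r = j + 2 := by omega
          have := s1 (by omega) (by omega)
          rw [if_pos hr2, show r = j + 2 by omega]
          exact this.2.2.symm
        · rw [if_neg hr2, show r - 2 + 2 = r by omega]
    have el : (if (if l ≤ j then l else l - 2) ≤ j then H (if l ≤ j then l else l - 2) else
          H ((if l ≤ j then l else l - 2) + 2)) = H l := by
      by_cases hl : l ≤ j
      · simp [hl]
      · simp only [hl, if_false]
        rw [if_neg (by omega), show l - 2 + 2 = l by omega]
    rw [er, el, h3]
  · intro y k
    beta_reduce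
    rw [hmem, h4]
    split_ifs <;> omega

section

variable {j : ℕ} {D D' : Finset (ℕ × ℤ)} (hD : ∀ c, c ∈ D ↔ collapse j c ∈ D')

/-- The cells of `D` over the cells of `t`. -/
def liftTile (j : ℕ) (D t : Finset (ℕ × ℤ)) : Finset (ℕ × ℤ) := D.filter fun c => collapse j c ∈ t

include hD in
theorem mem_liftTile {t : Finset (ℕ × ℤ)} (ht : t ⊆ D') (c : ℕ × ℤ) :
    c ∈ liftTile j D t ↔ collapse j c ∈ t := by
  simp only [liftTile, Finset.mem_filter, and_iff_right_iff_imp]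
  exact fun h => (hD c).2 (ht h)

theorem mem_extent_lift {s s' : Finset (ℕ × ℤ)} (hs : ∀ c, c ∈ s' ↔ collapse j c ∈ s) (x : ℕ) :
    (∃ h, (x, h) ∈ s') ↔ ∃ h, ((collapse j (x, 0)).1, h) ∈ s := by
  constructor
  · rintro ⟨h, hh⟩
    refine ⟨(collapse j (x, h)).2, ?_⟩
    have := (hs _).1 hh
    rwa [collapse_fst_mono j (c := (x, 0)) (c' := (x, h)) rfl]
  · rintro ⟨h, hh⟩
    by_cases c2 : x = j + 1
    · refine ⟨h + 1, (hs _).2 ?_⟩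
      simp only [collapse, c2] at *
      simpa using hh
    · refine ⟨h, (hs _).2 ?_⟩
      simp only [collapse, c2] at *
      split_ifs at * <;> simp_all

theorem extent_subset_iff {s t : Finset (ℕ × ℤ)} : t.image Prod.fst ⊆ s.image Prod.fst ↔
    ∀ x, (∃ h, (x, h) ∈ t) → ∃ h, (x, h) ∈ s := by
  constructor
  · rintro h x ⟨k, hk⟩
    obtain ⟨⟨x', k'⟩, h1, h2⟩ := Finset.mem_image.1 (h (Finset.mem_image.2 ⟨_, hk, rfl⟩))
    simp only at h2
    subst h2
    exact ⟨k', h1⟩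
  · intro h x hx
    obtain ⟨⟨x', k'⟩, h1, h2⟩ := Finset.mem_image.1 hx
    simp only at h2
    subst h2
    obtain ⟨k, hk⟩ := h _ ⟨_, h1⟩
    exact Finset.mem_image.2 ⟨_, hk, rfl⟩

theorem extent_lift_subset_iff {s t s' t' : Finset (ℕ × ℤ)}
    (hs : ∀ c, c ∈ s' ↔ collapse j c ∈ s) (ht : ∀ c, c ∈ t' ↔ collapse j c ∈ t) :
    t'.image Prod.fst ⊆ s'.image Prod.fst ↔ t.image Prod.fst ⊆ s.image Prod.fst := by
  rw [extent_subset_iff, extent_subset_iff]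
  have h1 := mem_extent_lift hs
  have h2 := mem_extent_lift ht
  simp only [h1, h2]
  constructor
  · intro h x hx
    obtain ⟨⟨y, k⟩, hy⟩ := collapse_surjective j (x, 0)
    have e : (collapse j (y, 0)).1 = x := by
      rw [collapse_fst_mono j (c := (y, 0)) (c' := (y, k)) rfl, hy]
    have := h y
    rw [e] at this
    exact this hx
  · intro h x
    exact h _

theorem above_lift_iff {s t s' t' : Finset (ℕ × ℤ)}
    (hs : ∀ c, c ∈ s' ↔ collapse j c ∈ s) (ht : ∀ c, c ∈ t' ↔ collapse j c ∈ t) :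
    (∃ x h, (x, h) ∈ s' ∧ (x, h + 2) ∈ t') ↔ ∃ x h, (x, h) ∈ s ∧ (x, h + 2) ∈ t := by
  have key : ∀ x h, collapse j (x, h + 2) = ((collapse j (x, h)).1, (collapse j (x, h)).2 + 2) := by
    intro x h
    simp only [collapse]
    split_ifs <;> simp
    ring
  constructor
  · rintro ⟨x, h, h1, h2⟩
    rw [hs] at h1
    rw [ht, key] at h2
    exact ⟨_, _, h1, h2⟩
  · rintro ⟨x, h, h1, h2⟩
    obtain ⟨⟨y, k⟩, hy⟩ := collapse_surjective j (x, h)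
    refine ⟨y, k, ?_, ?_⟩
    · rwa [hs, hy]
    · rwa [ht, key, hy]

/-- Tilings whose tiles are unions of fibres of `collapse j` correspond to tilings of the collapsed
diagram. -/
theorem ncard_saturated_tilings (hD : ∀ c, c ∈ D ↔ collapse j c ∈ D') :
    {P | IsTiling D P ∧ ∀ t ∈ P, ∀ c c', collapse j c = collapse j c' → c ∈ t → c' ∈ t}.ncard
      = {P | IsTiling D' P}.ncard := by
  classical
  symm
  have hlift : ∀ {P : Finset (Finset (ℕ × ℤ))}, IsTiling D' P → ∀ t ∈ P, ∀ c,
      c ∈ liftTile j D t ↔ collapse j c ∈ t := fun hP t ht => mem_liftTile hD (hP.subset t ht)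
  refine Set.ncard_congr (fun P _ => P.image (liftTile j D)) ?_ ?_ ?_
  · intro P hP
    refine ⟨⟨?_, ?_, ?_, ?_, ?_⟩, ?_⟩
    · rw [Finset.forall_mem_image]
      exact fun t ht => (hP.isDyckTile t ht).preimage_collapse (hlift hP t ht)
    · rw [Finset.forall_mem_image]
      exact fun t ht => Finset.filter_subset _ _
    · intro c hc
      obtain ⟨t, ht, hct⟩ := hP.exists_mem _ ((hD c).1 hc)
      exact ⟨_, Finset.mem_image_of_mem _ ht, (hlift hP t ht c).2 hct⟩
    · simp only [Finset.forall_mem_image]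
      intro s hs t ht c h1 h2
      rw [hP.eq_of_mem s hs t ht _ ((hlift hP s hs c).1 h1) ((hlift hP t ht c).1 h2)]
    · simp only [Finset.forall_mem_image]
      intro s hs t ht
      rw [above_lift_iff (hlift hP s hs) (hlift hP t ht),
        extent_lift_subset_iff (hlift hP s hs) (hlift hP t ht)]
      exact hP.cover s hs t ht
    · simp only [Finset.forall_mem_image]
      intro t ht c c' h
      rw [hlift hP t ht, hlift hP t ht, h]
      exact id
  · intro P Q hP hQ h
    have : ∀ P Q : Finset (Finset (ℕ × ℤ)), IsTiling D' P → IsTiling D' Q →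
        P.image (liftTile j D) = Q.image (liftTile j D) → P ⊆ Q := by
      intro P Q hP hQ h t ht
      have : liftTile j D t ∈ Q.image (liftTile j D) := h ▸ Finset.mem_image_of_mem _ ht
      obtain ⟨s, hs, hst⟩ := Finset.mem_image.1 this
      have : s = t := by
        ext c
        obtain ⟨b, rfl⟩ := collapse_surjective j c
        rw [← hlift hP t ht, ← hlift hQ s hs, hst]
      exact this ▸ hs
    exact (this P Q hP hQ h).antisymm (this Q P hQ hP h.symm)
  · rintro P ⟨hP, hsat⟩
    have hmem : ∀ t ∈ P, ∀ c, c ∈ t ↔ collapse j c ∈ t.image (collapse j) := by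
      intro t ht c
      refine ⟨Finset.mem_image_of_mem _, fun h => ?_⟩
      obtain ⟨b, hb, hbc⟩ := Finset.mem_image.1 h
      exact hsat t ht _ _ hbc hb
    refine ⟨P.image (Finset.image (collapse j)), ⟨?_, ?_, ?_, ?_, ?_⟩, ?_⟩
    · rw [Finset.forall_mem_image]
      exact fun t ht => (hP.isDyckTile t ht).of_preimage_collapse (hmem t ht)
    · rw [Finset.forall_mem_image]
      intro t ht c hc
      obtain ⟨b, hb, rfl⟩ := Finset.mem_image.1 hc
      exact (hD b).1 (hP.subset t ht hb)
    · intro c hc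
      obtain ⟨b, rfl⟩ := collapse_surjective j c
      obtain ⟨t, ht, hb⟩ := hP.exists_mem b ((hD b).2 hc)
      exact ⟨_, Finset.mem_image_of_mem _ ht, Finset.mem_image_of_mem _ hb⟩
    · simp only [Finset.forall_mem_image]
      intro s hs t ht c h1 h2
      rw [hP.eq_of_mem s hs t ht c h1 ((hmem t ht c).2 h2)]
    · simp only [Finset.forall_mem_image]
      intro s hs t ht
      rw [← above_lift_iff (hmem s hs) (hmem t ht),
        ← extent_lift_subset_iff (hmem s hs) (hmem t ht)]
      exact hP.cover s hs t ht
    · rw [Finset.image_image]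
      have : ∀ t ∈ P, (liftTile j D ∘ Finset.image (collapse j)) t = t := by
        intro t ht
        ext c
        simp only [Function.comp, liftTile, Finset.mem_filter]
        rw [← hmem t ht]
        exact ⟨fun h => h.2, fun h => ⟨hP.subset t ht h, h⟩⟩
      rw [Finset.image_congr this, Finset.image_id']

end

namespace LinkPattern

variable {n j : ℕ} (hj : j ≤ 2 * n) {a b : LinkPattern n}

theorem mem_skewDiagram_ins (c : ℕ × ℤ) :
    c ∈ skewDiagram (ins j hj a) (ins j hj b) ↔ collapse j c ∈ skewDiagram a b := by
  obtain ⟨x, h⟩ := c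
  simp only [collapse]
  by_cases c1 : x ≤ j
  · rw [if_pos c1, mem_skewDiagram, mem_skewDiagram, height_ins_of_le hj _ c1,
      height_ins_of_le hj _ c1]
  by_cases c2 : x = j + 1
  · subst c2
    rw [if_neg c1, if_pos rfl, mem_skewDiagram, mem_skewDiagram, height_ins_peak,
      height_ins_peak, Int.odd_iff, Int.odd_iff]
    omega
  · obtain ⟨y, rfl⟩ : ∃ y, x = y + 2 := ⟨x - 2, by omega⟩
    rw [if_neg c1, if_neg c2, mem_skewDiagram, mem_skewDiagram, height_ins_add_two hj _ (by omega),
      height_ins_add_two hj _ (by omega), Int.odd_iff, Int.odd_iff]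
    simp only [Nat.add_sub_cancel, Nat.cast_add]
    omega

/-- The tilings of the skew diagram between two paths with a peak in the same column, in which the
top cell of this column is not a tile, correspond to the tilings after the removal of the peaks. -/
theorem numUntopped_ins :
    numUntopped (ins j hj a) (ins j hj b) (j + 1) = numTilings a b := by
  rw [numUntopped, height_ins_peak, add_sub_cancel_right, numTilings_eq, ← ncard_saturated_tilings (j := j) (mem_skewDiagram_ins hj)]
  congr 1
  ext P
  simp only [Set.mem_ofPred_eq, and_congr_right_iff]
  intro hP
  constructor
  · intro htop t ht c c' hcc hct
    have key : ∀ t ∈ P, ∀ h, (j + 1, h) ∈ t → (j, h - 1) ∈ t ∧ (j + 2, h - 1) ∈ t := by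
      intro t ht h hh
      refine tile_of_peak' (u := ⟨j, by omega⟩) (v := ⟨j + 1, by omega⟩) rfl
        (ins_partner_left hj b) hP ?_ ht hh
      rwa [height_ins_peak, add_sub_cancel_right]
    -- all cells of a fibre lie in the tile of its cell in the middle column
    have key2 : ∀ h, (j, h) ∈ t ∨ (j + 2, h) ∈ t → (j + 1, h + 1) ∈ t := by
      intro h hh
      have hD : (j + 1, h + 1) ∈ skewDiagram (ins j hj a) (ins j hj b) := by
        rcases hh with hh | hh <;>
        · have := (mem_skewDiagram_ins hj _).1 (hP.subset t ht hh)
          rw [mem_skewDiagram_ins]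
          simpa [collapse] using this
      obtain ⟨t', ht', hc'⟩ := hP.exists_mem _ hD
      have := key t' ht' _ hc'
      simp only [add_sub_cancel_right] at this
      have e : t = t' := by
        rcases hh with hh | hh
        · exact hP.eq_of_mem t ht t' ht' _ hh this.1
        · exact hP.eq_of_mem t ht t' ht' _ hh this.2
      rw [e]
      exact hc'
    obtain ⟨x, h⟩ := c
    obtain ⟨x', h'⟩ := c'
    have hval : (x = x' ∧ h = h') ∨ ((x = j ∨ x = j + 1 ∨ x = j + 2) ∧
        (x' = j ∨ x' = j + 1 ∨ x' = j + 2) ∧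
        h' + (if x' = j + 1 then 0 else 1) = h + (if x = j + 1 then 0 else 1)) := by
      simp only [collapse] at hcc
      by_cases hxx : x = x'
      · left
        subst hxx
        split_ifs at hcc <;> simp only [Prod.mk.injEq] at hcc <;> exact ⟨rfl, by omega⟩
      · right
        split_ifs at hcc <;> simp only [Prod.mk.injEq] at hcc <;> obtain ⟨e1, e2⟩ := hcc <;>
          refine ⟨by omega, by omega, ?_⟩ <;> split_ifs <;> omega
    rcases hval with ⟨rfl, rfl⟩ | ⟨hx, hx', hh⟩
    · exact hct
    have hmid : (j + 1, h + (if x = j + 1 then 0 else 1)) ∈ t := by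
      rcases hx with rfl | rfl | rfl
      · simpa using key2 _ (Or.inl hct)
      · simpa using hct
      · simpa using key2 _ (Or.inr hct)
    rw [← hh] at hmid
    rcases hx' with rfl | rfl | rfl
    · simpa using (key t ht _ hmid).1
    · simpa using hmid
    · simpa using (key t ht _ hmid).2
  · intro hsat htop
    have := hsat _ htop (j + 1, b.height j) (j, b.height j - 1) (by simp [collapse]) (by simp)
    simp at this

end LinkPattern


/-! ### The tiling sum of Fomin determinants -/

section PairDet

variable {ι : Type*} [Fintype ι] [DecidableEq ι]

/-- The determinant of the matrix `(W a (p a'))`, whose rows and columns are indexed by the elements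
of `L`. -/
noncomputable def pairDet (p : ι → ι) (L : ι → Prop) [DecidablePred L] (W : ι → ι → ℝ) : ℝ :=
  Matrix.det (Matrix.of fun a a' : {a : ι // L a} => W a.val (p a'.val))

theorem pairDet_congr {p p' : ι → ι} {L : ι → Prop} [DecidablePred L] {W W' : ι → ι → ℝ}
    (h : ∀ a a', L a → L a' → W a (p a') = W' a (p' a')) : pairDet p L W = pairDet p' L W' := by
  unfold pairDet
  congr 1
  ext a a'
  exact h a a' a.2 a'.2

theorem pairDet_perm {p p' : ι → ι} {L L' : ι → Prop} [DecidablePred L] [DecidablePred L']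
    {W : ι → ι → ℝ} (s : Equiv.Perm ι) (hL : ∀ a, L a ↔ L' (s a))
    (hp : ∀ a, L a → p' (s a) = s (p a)) :
    pairDet p L (fun a b => W (s a) (s b)) = pairDet p' L' W := by
  unfold pairDet
  rw [← Matrix.det_submatrix_equiv_self (s.subtypeEquiv hL)]
  congr 1
  ext a a'
  simp [hp a' a'.2]

theorem pairDet_exchange {p p' : ι → ι} {L : ι → Prop} [DecidablePred L] {W : ι → ι → ℝ} {x y : ι}
    (hx : L x) (hy : L y) (hxy : x ≠ y) (hp : ∀ a, L a → p' a = p (Equiv.swap x y a)) :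
    pairDet p' L W = -pairDet p L W := by
  unfold pairDet
  have h := Matrix.det_permute' (Equiv.swap (⟨x, hx⟩ : {a // L a}) ⟨y, hy⟩)
    (Matrix.of fun a a' : {a : ι // L a} => W a.val (p a'.val))
  rw [Equiv.Perm.sign_swap (by simpa using hxy)] at h
  simp only [Units.val_neg, Units.val_one, Int.cast_neg, Int.cast_one, neg_mul, one_mul] at h
  rw [← h]
  congr 1
  ext a a'
  simp only [Matrix.of_apply, Matrix.submatrix_apply, id, hp a' a'.2]
  congr 2
  by_cases h1 : a'.val = x
  · have : a' = ⟨x, hx⟩ := Subtype.ext h1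
    simp [this]
  by_cases h2 : a'.val = y
  · have : a' = ⟨y, hy⟩ := Subtype.ext h2
    simp [this]
  rw [Equiv.swap_apply_of_ne_of_ne h1 h2, Equiv.swap_apply_of_ne_of_ne]
  · exact fun h => h1 (congrArg Subtype.val h)
  · exact fun h => h2 (congrArg Subtype.val h)

end PairDet

namespace LinkPattern

variable {N : ℕ}

theorem fominDet_eq_pairDet (β : LinkPattern N) (W : Fin (2 * N) → Fin (2 * N) → ℝ) :
    β.fominDet W = pairDet β.partner (fun a => a < β.partner a) W := rfl

section Swap

variable (β : LinkPattern N) {u v : Fin (2 * N)} (W : Fin (2 * N) → Fin (2 * N) → ℝ)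

theorem fominDet_swap_of_left (huv : u ≠ v) (hu : u < β.partner u) (hv : v < β.partner v) :
    β.fominDet (fun a b => W (Equiv.swap u v a) (Equiv.swap u v b)) = -β.fominDet W := by
  have hright : ∀ a, a < β.partner a → β.partner a ≠ u ∧ β.partner a ≠ v := by
    intro a ha
    constructor <;> intro h <;> rw [β.partner_eq_iff] at h <;> subst h <;>
      rw [β.partner_partner] at ha
    · exact ha.not_gt hu
    · exact ha.not_gt hv
  have hL : ∀ a, a < β.partner a ↔ Equiv.swap u v a < β.partner (Equiv.swap u v a) := by
    intro a
    by_cases h1 : a = u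
    · subst h1; simp [hu, hv]
    by_cases h2 : a = v
    · subst h2; simp [hu, hv]
    rw [Equiv.swap_apply_of_ne_of_ne h1 h2]
  rw [fominDet_eq_pairDet, fominDet_eq_pairDet, pairDet_perm
    (p' := fun a => Equiv.swap u v (β.partner (Equiv.swap u v a)))
    (L' := fun a => a < β.partner a) (Equiv.swap u v) hL (by simp)]
  refine pairDet_exchange hu hv huv fun a ha => ?_
  rw [hL] at ha
  exact Equiv.swap_apply_of_ne_of_ne (hright _ ha).1 (hright _ ha).2

theorem fominDet_swap_of_right (huv : u ≠ v) (hu : β.partner u < u) (hv : β.partner v < v) :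
    β.fominDet (fun a b => W (Equiv.swap u v a) (Equiv.swap u v b)) = -β.fominDet W := by
  have hleft : ∀ a, a < β.partner a → a ≠ u ∧ a ≠ v := by
    intro a ha
    constructor <;> rintro rfl
    · exact ha.not_gt hu
    · exact ha.not_gt hv
  have hL : ∀ a, a < β.partner a ↔ Equiv.swap u v a < β.partner (Equiv.swap u v a) := by
    intro a
    by_cases h1 : a = u
    · subst h1; simp [hu.not_gt, hv.not_gt]
    by_cases h2 : a = v
    · subst h2; simp [hu.not_gt, hv.not_gt]
    rw [Equiv.swap_apply_of_ne_of_ne h1 h2]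
  rw [fominDet_eq_pairDet, fominDet_eq_pairDet, pairDet_perm
    (p' := fun a => Equiv.swap u v (β.partner (Equiv.swap u v a)))
    (L' := fun a => a < β.partner a) (Equiv.swap u v) hL (by simp)]
  refine pairDet_exchange (x := β.partner u) (y := β.partner v) (by rwa [β.partner_partner])
    (by rwa [β.partner_partner]) (fun h => huv (β.partner_injective h)) fun a ha => ?_
  rw [Equiv.swap_apply_of_ne_of_ne (hleft a ha).1 (hleft a ha).2]
  by_cases h1 : a = β.partner u
  · rw [h1, Equiv.swap_apply_left, β.partner_partner, β.partner_partner, Equiv.swap_apply_left]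
  by_cases h2 : a = β.partner v
  · rw [h2, Equiv.swap_apply_right, β.partner_partner, β.partner_partner, Equiv.swap_apply_right]
  rw [Equiv.swap_apply_of_ne_of_ne h1 h2, Equiv.swap_apply_of_ne_of_ne]
  · exact fun h => h1 (β.partner_eq_iff.1 h).symm
  · exact fun h => h2 (β.partner_eq_iff.1 h).symm

theorem fominDet_close_swap (huv : v.val = u.val + 1) (hu : β.partner u < u)
    (hv : v < β.partner v) :
    (β.close u v huv hu hv).fominDet (fun a b => W (Equiv.swap u v a) (Equiv.swap u v b))
      = -β.fominDet W := by
  have hne : u ≠ v := by simp only [ne_eq, Fin.ext_iff]; omega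
  have hcv : β.partner u ≠ v := by simp only [ne_eq, Fin.ext_iff, Fin.lt_def] at *; omega
  have hc1 := β.close_partner_left huv hu hv
  have hc2 := ((β.close u v huv hu hv).partner_eq_iff).1 hc1
  rw [fominDet_eq_pairDet, fominDet_eq_pairDet, pairDet_perm
    (p' := (β.close u v huv hu hv).partner) (L' := fun a => a < β.partner a) (Equiv.swap u v)]
  · refine pairDet_exchange (x := β.partner u) (y := v) (by rwa [β.partner_partner]) hv hcv
      fun a ha => ?_
    have h1 : a ≠ u := by rintro rfl; exact ha.not_gt hu
    have h2 : a ≠ β.partner v := by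
      rintro rfl
      rw [β.partner_partner] at ha
      exact ha.not_gt hv
    change Equiv.swap u (β.partner v) (β.partner (Equiv.swap u (β.partner v) a)) = _
    rw [Equiv.swap_apply_of_ne_of_ne h1 h2]
    by_cases h3 : a = β.partner u
    · rw [h3, β.partner_partner, Equiv.swap_apply_left, Equiv.swap_apply_left]
    by_cases h4 : a = v
    · rw [h4, Equiv.swap_apply_right, Equiv.swap_apply_right, β.partner_partner]
    rw [Equiv.swap_apply_of_ne_of_ne h3 h4, Equiv.swap_apply_of_ne_of_ne]
    · exact fun h => h3 (β.partner_eq_iff.1 h).symm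
    · exact fun h => h4 (β.partner_injective h)
  · intro a
    rw [lt_close_partner_iff]
    by_cases h1 : a = u
    · subst h1; simp [hne, hv]
    by_cases h2 : a = v
    · subst h2; simp [hu.not_gt]
    rw [Equiv.swap_apply_of_ne_of_ne h1 h2]
    simp [h1, h2]
  · intro a _
    by_cases h1 : a = u
    · subst h1; rw [Equiv.swap_apply_left, hc1, hc2, Equiv.swap_apply_right]
    by_cases h2 : a = v
    · subst h2; rw [Equiv.swap_apply_right, hc2, hc1, Equiv.swap_apply_left]
    rw [Equiv.swap_apply_of_ne_of_ne h1 h2, Equiv.swap_apply_of_ne_of_ne]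
    · exact fun h => h2 (((partner_eq_iff _).1 h).symm.trans hc1)
    · exact fun h => h1 (((partner_eq_iff _).1 h).symm.trans hc2)

end Swap

/-- The weighted sum of Fomin determinants over the Dyck paths above the one of `α`, as a function
of an arbitrary kernel. -/
noncomputable def tilingSum (α : LinkPattern N) (W : Fin (2 * N) → Fin (2 * N) → ℝ) : ℝ :=
  ∑ β : LinkPattern N with α ≤ β, (numTilings α β : ℝ) * β.fominDet W

/-- The symmetrization of `tilingSum α` under an adjacent transposition `(u v)` is a sum over Dyck
paths with a peak at `(u, v)` only: valleys cancel against the tilings in which the top cell below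
the peak is a tile, and slopes cancel by the antisymmetry of the determinant. -/
theorem tilingSum_add_swap (α : LinkPattern N) {u v : Fin (2 * N)} (huv : v.val = u.val + 1)
    (W : Fin (2 * N) → Fin (2 * N) → ℝ) :
    tilingSum α W + tilingSum α (fun a b => W (Equiv.swap u v a) (Equiv.swap u v b)) =
      ∑ γ : LinkPattern N with γ.partner u = v ∧ α ≤ γ, (numUntopped α γ v : ℝ) *
        (γ.fominDet W + γ.fominDet (fun a b => W (Equiv.swap u v a) (Equiv.swap u v b))) := by
  classical
  have hne : u ≠ v := by simp only [ne_eq, Fin.ext_iff]; omega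
  set W' : Fin (2 * N) → Fin (2 * N) → ℝ := fun a b => W (Equiv.swap u v a) (Equiv.swap u v b)
    with hW'
  have hW : W = fun a b => W' (Equiv.swap u v a) (Equiv.swap u v b) := by
    funext a b
    simp [hW']
  set D : LinkPattern N → ℝ := fun β => β.fominDet W + β.fominDet W' with hD
  have hlhs : tilingSum α W + tilingSum α W' =
      ∑ β : LinkPattern N, if α ≤ β then (numTilings α β : ℝ) * D β else 0 := by
    unfold tilingSum
    rw [Finset.sum_filter, Finset.sum_filter, ← Finset.sum_add_distrib]
    refine Finset.sum_congr rfl fun β _ => ?_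
    split_ifs
    · simp only [hD]; ring
    · simp
  have hclose : ∀ (β : LinkPattern N) (hu : β.partner u < u) (hv : v < β.partner v),
      D (β.close u v huv hu hv) = -D β := by
    intro β hu hv
    have h1 := β.fominDet_close_swap W huv hu hv
    have h2 := β.fominDet_close_swap W' huv hu hv
    rw [← hW] at h2
    simp only [hD]
    rw [h1, h2]
    ring
  have hslope : ∀ β : LinkPattern N, β.partner u ≠ v → ¬ (β.partner u < u ∧ v < β.partner v) →
      D β = 0 := by
    intro β h1 h2
    simp only [hD]
    by_cases h3 : u < β.partner u
    · by_cases h4 : v < β.partner v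
      · rw [β.fominDet_swap_of_left W hne h3 h4]; ring
      · exact absurd (β.partner_eq_of_adjacent huv h3 (β.not_lt_partner_iff.1 h4)) h1
    · have h3' := β.not_lt_partner_iff.1 h3
      have h4 := β.not_lt_partner_iff.1 fun h => h2 ⟨h3', h⟩
      rw [β.fominDet_swap_of_right W hne h3' h4]; ring
  set closeOf : LinkPattern N → LinkPattern N := fun β =>
    if h : β.partner u < u ∧ v < β.partner v then β.close u v huv h.1 h.2 else β with hcl
  -- valleys correspond to the tilings whose top cell below the peak is a tile
  have hbij : ∑ β : LinkPattern N with β.partner u < u ∧ v < β.partner v,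
        (if α ≤ β then (numTilings α β : ℝ) * D β else 0) =
      ∑ γ : LinkPattern N with γ.partner u = v,
        -(if α ≤ γ then (numTopped α γ v : ℝ) * D γ else 0) := by
    refine Finset.sum_of_injOn closeOf ?_ ?_ ?_ ?_
    · intro β₁ h₁ β₂ h₂ h
      simp only [Finset.coe_filter, Finset.mem_univ, true_and, Set.mem_ofPred_eq] at h₁ h₂
      simp only [hcl, dif_pos h₁, dif_pos h₂] at h
      exact close_injective huv _ _ _ _ h
    · intro β h
      simp only [Finset.coe_filter, Finset.mem_univ, true_and, Set.mem_ofPred_eq] at h ⊢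
      simp only [hcl, dif_pos h]
      exact β.close_partner_left huv h.1 h.2
    · intro γ hγ hγ'
      simp only [Finset.mem_filter, Finset.mem_univ, true_and] at hγ
      split_ifs with hle
      · rw [numTopped_eq_zero]
        · simp
        · by_contra hlt
          apply hγ'
          have hpos : 0 < γ.height u := by
            obtain ⟨h1, h2⟩ := height_peak huv hγ
            have := α.height_nonneg v
            have h3 := α.height_parity v.2.le
            have h4 := γ.height_parity v.2.le
            rw [Int.even_iff] at h3 h4
            omega
          obtain ⟨β, hu, hv, hβ⟩ := exists_close_eq huv hγ hpos
          refine ⟨β, by simp [hu, hv], ?_⟩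
          simp only [hcl]
          rw [dif_pos ⟨hu, hv⟩, hβ]
      · simp
    · intro β hβ
      simp only [Finset.mem_filter, Finset.mem_univ, true_and] at hβ
      obtain ⟨hu, hv⟩ := hβ
      simp only [hcl, dif_pos (And.intro hu hv)]
      have hle' : α ≤ β → α ≤ β.close u v huv hu hv := by
        intro h
        rw [le_def] at *
        intro x
        rw [height_close]
        have := h x
        split_ifs <;> omega
      by_cases hle : α ≤ β
      · rw [if_pos hle, if_pos (hle' hle), numTopped_close huv hu hv hle, hclose]
        ring
      · rw [if_neg hle]
        split_ifs with h
        · rw [numTopped_eq_zero]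
          · simp
          · by_contra hlt
            apply hle
            rw [le_def] at *
            intro x
            by_cases hx : x = v.val
            · have h3 := α.height_parity v.2.le
              have h4 := (β.close u v huv hu hv).height_parity v.2.le
              rw [height_close, if_pos rfl] at *
              rw [Int.even_iff] at h3 h4
              subst hx
              omega
            · have := h x
              rwa [height_close, if_neg hx, add_zero] at this
        · simp
  rw [hlhs, ← Finset.sum_filter_add_sum_filter_not Finset.univ
    (fun β : LinkPattern N => β.partner u = v)]
  have h2 : ∑ β : LinkPattern N with ¬ β.partner u = v,
        (if α ≤ β then (numTilings α β : ℝ) * D β else 0) =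
      ∑ β : LinkPattern N with β.partner u < u ∧ v < β.partner v,
        (if α ≤ β then (numTilings α β : ℝ) * D β else 0) := by
    symm
    refine Finset.sum_subset ?_ ?_
    · intro β hβ
      simp only [Finset.mem_filter, Finset.mem_univ, true_and] at *
      rintro rfl
      exact absurd hβ.1 (by simp only [Fin.lt_def]; omega)
    · intro β hβ hβ'
      simp only [Finset.mem_filter, Finset.mem_univ, true_and] at *
      rw [hslope β hβ hβ']
      simp
  rw [h2, hbij, ← Finset.sum_add_distrib, ← Finset.filter_filter, Finset.sum_filter (p := (α ≤ ·))]
  refine Finset.sum_congr rfl fun γ _ => ?_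
  split_ifs
  · rw [numTilings_eq_add (α := α) (β := γ) v]
    push_cast
    ring
  · simp

/-- `tilingSum α` is antisymmetric under an adjacent transposition of two indices which are not
linked in `α`. -/
theorem tilingSum_swap (α : LinkPattern N) {u v : Fin (2 * N)} (huv : v.val = u.val + 1)
    (hα : α.partner u ≠ v) (W : Fin (2 * N) → Fin (2 * N) → ℝ) :
    tilingSum α (fun a b => W (Equiv.swap u v a) (Equiv.swap u v b)) = -tilingSum α W := by
  have h := tilingSum_add_swap α huv W
  rw [Finset.sum_eq_zero] at h
  · linarith
  · intro γ hγ
    simp only [Finset.mem_filter, Finset.mem_univ, true_and] at hγ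
    rw [numUntopped_eq_zero huv hγ.1 hα hγ.2]
    simp

/-- The adjacency matrix of the links of a link pattern. -/
def linkMatrix (α : LinkPattern N) (a b : Fin (2 * N)) : ℝ := if α.partner a = b then 1 else 0

theorem linkMatrix_swap (α : LinkPattern N) {u v : Fin (2 * N)} (h : α.partner u = v) :
    (fun a b => α.linkMatrix (Equiv.swap u v a) (Equiv.swap u v b)) = α.linkMatrix := by
  have h' := α.partner_eq_iff.1 h
  funext a b
  simp only [linkMatrix]
  have key : α.partner (Equiv.swap u v a) = Equiv.swap u v (α.partner a) := by
    by_cases h1 : a = u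
    · subst h1; simp [h, h']
    by_cases h2 : a = v
    · subst h2; simp [h, h']
    rw [Equiv.swap_apply_of_ne_of_ne h1 h2, Equiv.swap_apply_of_ne_of_ne]
    · exact fun e => h2 (by rw [← h, ← e, α.partner_partner])
    · exact fun e => h1 (by rw [← h', ← e, α.partner_partner])
  simp only [key, (Equiv.swap u v).apply_eq_iff_eq]

theorem fominDet_ins {n j : ℕ} (hj : j ≤ 2 * n) (a b : LinkPattern n) :
    (ins j hj b).fominDet (ins j hj a).linkMatrix = b.fominDet a.linkMatrix := by
  classical
  unfold fominDet
  have hj1 : (⟨j, by omega⟩ : Fin (2 * (n + 1))) < (ins j hj b).partner ⟨j, by omega⟩ := by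
    rw [ins_partner_left]; simp [Fin.lt_def]
  rw [Matrix.twoBlockTriangular_det _ (fun x => x.val.val ≠ j)]
  · have e1 : (Matrix.toSquareBlockProp (Matrix.of fun x x' : {x : Fin (2 * (n + 1)) //
        x < (ins j hj b).partner x} => (ins j hj a).linkMatrix x.val
          ((ins j hj b).partner x'.val)) fun i => ¬ i.val.val ≠ j).det = 1 := by
      have : Subsingleton {x : {x : Fin (2 * (n + 1)) // x < (ins j hj b).partner x} //
          ¬ x.val.val ≠ j} := ⟨fun x y => by
        apply Subtype.ext; apply Subtype.ext; apply Fin.ext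
        exact (not_not.1 x.2).trans (not_not.1 y.2).symm⟩
      rw [Matrix.det_eq_elem_of_subsingleton _ ⟨⟨⟨j, by omega⟩, hj1⟩, by simp⟩]
      simp only [Matrix.toSquareBlockProp_def, Matrix.of_apply, linkMatrix, ins_partner_left,
        if_true]
    rw [e1, mul_one]
    have hne : ∀ x : {x : Fin (2 * (n + 1)) // x < (ins j hj b).partner x},
        x.val.val ≠ j → x.val.val ≠ j + 1 := by
      intro x _ h2
      have h3 := x.2
      rw [show x.val = ⟨j + 1, by omega⟩ from Fin.ext h2, ins_partner_right] at h3
      simp [Fin.lt_def] at h3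
    let e : {x : Fin (2 * n) // x < b.partner x} ≃
        {x : {x : Fin (2 * (n + 1)) // x < (ins j hj b).partner x} // x.val.val ≠ j} :=
      Equiv.ofBijective (fun x => ⟨⟨skip j x.val, (lt_ins_partner_skip hj b x.val).2 x.2⟩,
        (skip_ne j x.val).1⟩) ⟨fun x y h => Subtype.ext (skip_injective j (by simpa using h)),
        fun y => by
          refine ⟨⟨unskip j hj y.val.val y.2 (hne _ y.2), ?_⟩, ?_⟩
          · rw [← lt_ins_partner_skip hj, skip_unskip]
            exact y.val.2
          · apply Subtype.ext; apply Subtype.ext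
            exact skip_unskip hj _ y.2 (hne _ y.2)⟩
    rw [← Matrix.det_submatrix_equiv_self e]
    congr 1
    ext x x'
    have he : ∀ x, (e x).val.val = skip j x.val := fun _ => rfl
    simp only [Matrix.submatrix_apply, Matrix.toSquareBlockProp_def, Matrix.of_apply, linkMatrix,
      he, ins_partner_skip, (skip_injective j).eq_iff]
  · intro x hx y hy
    have hx' : x.val = ⟨j, by omega⟩ := Fin.ext (by simpa using hx)
    simp only [Matrix.of_apply, linkMatrix, hx', ins_partner_left]
    rw [if_neg]
    intro h
    have := ((ins j hj b).partner_eq_iff).1 h.symm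
    rw [ins_partner_right] at this
    exact hy (Fin.ext_iff.1 this).symm

/-- Every nonempty link pattern has a short link. -/
theorem exists_short_link {n : ℕ} (α : LinkPattern (n + 1)) :
    ∃ (j : ℕ) (hj : j ≤ 2 * n), α.partner ⟨j, by omega⟩ = ⟨j + 1, by omega⟩ := by
  classical
  have hex : ∃ x : ℕ, ∃ h : x < 2 * (n + 1), α.partner ⟨x, h⟩ < ⟨x, h⟩ := by
    rcases lt_or_gt_of_ne (α.partner_ne ⟨0, by omega⟩) with h | h
    · exact ⟨_, _, h⟩
    · exact ⟨(α.partner ⟨0, by omega⟩).val, (α.partner ⟨0, by omega⟩).2, by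
        simpa [α.partner_partner] using h⟩
  obtain ⟨hx, hlt⟩ := Nat.find_spec hex
  have hmin : ∀ y < Nat.find hex, ∀ h : y < 2 * (n + 1), ⟨y, h⟩ < α.partner ⟨y, h⟩ := by
    intro y hy h
    have := Nat.find_min hex hy
    by_contra hc
    exact this ⟨h, α.not_lt_partner_iff.1 hc⟩
  generalize Nat.find hex = x at *
  obtain ⟨y, rfl⟩ : ∃ y, x = y + 1 := ⟨x - 1, by
    have : 0 < x := lt_of_le_of_lt (Nat.zero_le _) (Fin.lt_def.1 hlt)
    omega⟩
  exact ⟨y, by omega, α.partner_eq_of_adjacent rfl (hmin y (by omega) _) hlt⟩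

open Classical in
/-- The numbers of cover-inclusive Dyck tilings invert the signed incidence matrix of link
patterns.  By induction on the number of links: the matrix of links of `α'` is invariant under the
transposition of the endpoints of a short link of `α'`, so `tilingSum_add_swap` reduces the sum to
the paths with a peak there, and the short link can be removed everywhere. -/
theorem tilingSum_linkMatrix (α α' : LinkPattern N) :
    tilingSum α α'.linkMatrix = if α = α' then 1 else 0 := by
  induction N with
  | zero =>
    have hsub : ∀ x y : LinkPattern 0, x = y := fun x y => LinkPattern.ext (funext fun a => a.elim0)
    rw [if_pos (hsub _ _), tilingSum, Finset.sum_eq_single α]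
    · have : IsEmpty {a : Fin (2 * 0) // a < α.partner a} := ⟨fun a => a.val.elim0⟩
      rw [numTilings_self, fominDet, Matrix.det_isEmpty]
      simp
    · exact fun β _ h => absurd (hsub β α) h
    · intro h
      exact absurd (Finset.mem_filter.2 ⟨Finset.mem_univ _, α.le_refl⟩) h
  | succ n ih =>
    obtain ⟨j, hj, hα'⟩ := exists_short_link α'
    obtain ⟨a', rfl⟩ := exists_ins_eq hj α' hα'
    have key := tilingSum_add_swap α (u := ⟨j, by omega⟩) (v := ⟨j + 1, by omega⟩) rfl
      (ins j hj a').linkMatrix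
    rw [linkMatrix_swap _ hα'] at key
    by_cases hα : α.partner ⟨j, by omega⟩ = ⟨j + 1, by omega⟩
    · obtain ⟨a, rfl⟩ := exists_ins_eq hj α hα
      have hr : ∑ γ : LinkPattern (n + 1) with γ.partner ⟨j, by omega⟩ = ⟨j + 1, by omega⟩ ∧
            ins j hj a ≤ γ, (numUntopped (ins j hj a) γ (j + 1) : ℝ) *
            (γ.fominDet (ins j hj a').linkMatrix + γ.fominDet (ins j hj a').linkMatrix) =
          2 * tilingSum a a'.linkMatrix := by
        unfold tilingSum
        rw [Finset.mul_sum]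
        symm
        refine Finset.sum_of_injOn (ins j hj) ((ins_injective hj).injOn) ?_ ?_ ?_
        · intro b hb
          simp only [Finset.coe_filter, Finset.mem_univ, true_and, Set.mem_ofPred_eq] at hb ⊢
          exact ⟨ins_partner_left hj b, (ins_le_ins_iff hj).2 hb⟩
        · intro γ hγ hγ'
          simp only [Finset.mem_filter, Finset.mem_univ, true_and] at hγ
          obtain ⟨b, rfl⟩ := exists_ins_eq hj γ hγ.1
          exact absurd ⟨b, by simpa using (ins_le_ins_iff hj).1 hγ.2, rfl⟩ hγ'
        · intro b _
          rw [fominDet_ins, numUntopped_ins]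
          ring
      rw [hr, ih] at key
      simp only [(ins_injective hj).eq_iff]
      linarith
    · rw [if_neg (by rintro rfl; exact hα hα')]
      rw [Finset.sum_eq_zero] at key
      · linarith
      · intro γ hγ
        simp only [Finset.mem_filter, Finset.mem_univ, true_and] at hγ
        have := numUntopped_eq_zero (v := (⟨j + 1, by omega⟩ : Fin (2 * (n + 1)))) rfl hγ.1 hα hγ.2
        simp only at this
        rw [this]
        simp

end LinkPattern


/-! ### Fused kernels -/

namespace LinkPattern

variable {N : ℕ}

/-- A Fomin determinant is linear in each variable, since each index labels one row or one
column. -/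
theorem fominDet_add_mul (β : LinkPattern N) (i : Fin (2 * N)) (c : ℝ)
    {W₁ W₂ W₃ : Fin (2 * N) → Fin (2 * N) → ℝ}
    (h₂ : ∀ a b, a ≠ i → b ≠ i → W₁ a b = W₂ a b) (h₃ : ∀ a b, a ≠ i → b ≠ i → W₁ a b = W₃ a b)
    (hr : ∀ b, b ≠ i → W₁ i b = W₂ i b + c * W₃ i b)
    (hc : ∀ a, a ≠ i → W₁ a i = W₂ a i + c * W₃ a i) :
    β.fominDet W₁ = β.fominDet W₂ + c * β.fominDet W₃ := by
  classical
  unfold fominDet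
  set M : (Fin (2 * N) → Fin (2 * N) → ℝ) →
    Matrix {a : Fin (2 * N) // a < β.partner a} {a : Fin (2 * N) // a < β.partner a} ℝ :=
    fun W => Matrix.of fun a a' => W a.val (β.partner a'.val) with hM
  change (M W₁).det = (M W₂).det + c * (M W₃).det
  by_cases hi : i < β.partner i
  · have hne : ∀ a' : {a : Fin (2 * N) // a < β.partner a}, β.partner a'.val ≠ i := by
      intro a' h
      have h2 := a'.2
      rw [h, (β.partner_eq_iff.1 h).symm] at h2
      exact h2.not_gt hi
    have e1 : M W₁ = (M W₂).updateRow ⟨i, hi⟩ (M W₂ ⟨i, hi⟩ + c • M W₃ ⟨i, hi⟩) := by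
      ext a a'
      rw [Matrix.updateRow_apply]
      split_ifs with h
      · subst h
        simp only [hM, Matrix.of_apply, Pi.add_apply, Pi.smul_apply, smul_eq_mul]
        exact hr _ (hne a')
      · exact h₂ _ _ (fun h' => h (Subtype.ext h')) (hne a')
    have e2 : M W₃ = (M W₂).updateRow ⟨i, hi⟩ (M W₃ ⟨i, hi⟩) := by
      ext a a'
      rw [Matrix.updateRow_apply]
      split_ifs with h
      · subst h; rfl
      · have h' : a.val ≠ i := fun h' => h (Subtype.ext h')
        simp only [hM, Matrix.of_apply]
        rw [← h₂ _ _ h' (hne a'), h₃ _ _ h' (hne a')]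
    rw [e1, Matrix.det_updateRow_add, Matrix.det_updateRow_smul, Matrix.updateRow_eq_self, ← e2]
  · have hi' := β.not_lt_partner_iff.1 hi
    have hj : β.partner i < β.partner (β.partner i) := by rwa [β.partner_partner]
    have hne : ∀ a : {a : Fin (2 * N) // a < β.partner a}, a.val ≠ i := by
      rintro ⟨a, ha⟩ rfl
      exact hi ha
    have hne' : ∀ a' : {a : Fin (2 * N) // a < β.partner a}, a' ≠ ⟨β.partner i, hj⟩ →
        β.partner a'.val ≠ i := by
      intro a' h h'
      exact h (Subtype.ext (β.partner_eq_iff.1 h').symm)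
    have e1 : M W₁ = (M W₂).updateCol ⟨β.partner i, hj⟩
        ((fun a => M W₂ a ⟨β.partner i, hj⟩) + c • fun a => M W₃ a ⟨β.partner i, hj⟩) := by
      ext a a'
      rw [Matrix.updateCol_apply]
      split_ifs with h
      · subst h
        simp only [hM, Matrix.of_apply, Pi.add_apply, Pi.smul_apply, smul_eq_mul,
          β.partner_partner]
        exact hc _ (hne a)
      · exact h₂ _ _ (hne a) (hne' a' h)
    have e2 : M W₃ = (M W₂).updateCol ⟨β.partner i, hj⟩ fun a => M W₃ a ⟨β.partner i, hj⟩ := by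
      ext a a'
      rw [Matrix.updateCol_apply]
      split_ifs with h
      · subst h; rfl
      · simp only [hM, Matrix.of_apply]
        rw [← h₂ _ _ (hne a) (hne' a' h), h₃ _ _ (hne a) (hne' a' h)]
    rw [e1, Matrix.det_updateCol_add, Matrix.det_updateCol_smul, ← e2]
    congr 2
    exact Matrix.updateCol_eq_self _ _

theorem tilingSum_add_mul (α : LinkPattern N) (i : Fin (2 * N)) (c : ℝ)
    {W₁ W₂ W₃ : Fin (2 * N) → Fin (2 * N) → ℝ}
    (h₂ : ∀ a b, a ≠ i → b ≠ i → W₁ a b = W₂ a b) (h₃ : ∀ a b, a ≠ i → b ≠ i → W₁ a b = W₃ a b)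
    (hr : ∀ b, b ≠ i → W₁ i b = W₂ i b + c * W₃ i b)
    (hc : ∀ a, a ≠ i → W₁ a i = W₂ a i + c * W₃ a i) :
    tilingSum α W₁ = tilingSum α W₂ + c * tilingSum α W₃ := by
  unfold tilingSum
  rw [Finset.mul_sum, ← Finset.sum_add_distrib]
  refine Finset.sum_congr rfl fun β _ => ?_
  rw [β.fominDet_add_mul i c h₂ h₃ hr hc]
  ring

theorem tilingSum_eq_zero (α : LinkPattern N) (i : Fin (2 * N))
    {W : Fin (2 * N) → Fin (2 * N) → ℝ} (hr : ∀ b, W i b = 0) (hc : ∀ a, W a i = 0) :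
    tilingSum α W = 0 := by
  have := tilingSum_add_mul α i 1 (W₁ := W) (W₂ := W) (W₃ := W) (fun _ _ _ _ => rfl)
    (fun _ _ _ _ => rfl) (fun b _ => by rw [hr]; simp) (fun a _ => by rw [hc]; simp)
  linarith

section Antisymmetry

variable (α : LinkPattern N) {i k : Fin (2 * N)}

/-- If no two indices of an interval are linked in `α`, then `tilingSum α` is antisymmetric under
all transpositions of indices of the interval. -/
theorem tilingSum_swap_of_interval (hik : i < k)
    (hα : ∀ a, i ≤ a → a ≤ k → ∀ b, i ≤ b → b ≤ k → α.partner a ≠ b)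
    (W : Fin (2 * N) → Fin (2 * N) → ℝ) :
    tilingSum α (fun a b => W (Equiv.swap i k a) (Equiv.swap i k b)) = -tilingSum α W := by
  obtain ⟨m, hm⟩ : ∃ m, k.val = i.val + 1 + m := ⟨k.val - i.val - 1, by
    rw [Fin.lt_def] at hik; omega⟩
  induction m generalizing i W with
  | zero => exact tilingSum_swap α hm (hα _ le_rfl hik.le _ hik.le le_rfl) W
  | succ m ih =>
    obtain ⟨l, hl⟩ : ∃ l : Fin (2 * N), l.val = i.val + 1 := ⟨⟨i.val + 1, by omega⟩, rfl⟩
    have hil : i < l := by rw [Fin.lt_def]; omega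
    have hlk : l < k := by rw [Fin.lt_def]; omega
    have hs : ∀ a, Equiv.swap i k a = Equiv.swap i l (Equiv.swap l k (Equiv.swap i l a)) := by
      intro a
      rw [Equiv.swap_comm i l]
      by_cases h1 : a = i
      · subst h1
        rw [Equiv.swap_apply_left, Equiv.swap_apply_right, Equiv.swap_apply_left,
          Equiv.swap_apply_of_ne_of_ne hlk.ne' hik.ne']
      by_cases h2 : a = l
      · subst h2
        rw [Equiv.swap_apply_left, Equiv.swap_apply_of_ne_of_ne hil.ne hik.ne,
          Equiv.swap_apply_right, Equiv.swap_apply_of_ne_of_ne hil.ne' hlk.ne]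
      by_cases h3 : a = k
      · subst h3
        rw [Equiv.swap_apply_right, Equiv.swap_apply_of_ne_of_ne h2 h1, Equiv.swap_apply_right,
          Equiv.swap_apply_left]
      rw [Equiv.swap_apply_of_ne_of_ne h1 h3, Equiv.swap_apply_of_ne_of_ne h2 h1,
        Equiv.swap_apply_of_ne_of_ne h2 h3, Equiv.swap_apply_of_ne_of_ne h2 h1]
    have ha := hα i le_rfl hik.le l hil.le hlk.le
    have e1 := tilingSum_swap α hl ha W
    have e2 := ih hlk (fun a h1 h2 b h3 h4 => hα a (hil.le.trans h1) h2 b (hil.le.trans h3) h4)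
      (fun a b => W (Equiv.swap i l a) (Equiv.swap i l b)) (by omega)
    have e3 := tilingSum_swap α hl ha
      (fun a b => W (Equiv.swap i l (Equiv.swap l k a)) (Equiv.swap i l (Equiv.swap l k b)))
    simp only [hs]
    rw [e3, e2, e1]
    ring

/-- Symmetric pairs of entries of the kernel under whose transposition `tilingSum α` is
antisymmetric do not matter. -/
theorem tilingSum_erase (hik : i ≠ k)
    (hswap : ∀ W, tilingSum α (fun a b => W (Equiv.swap i k a) (Equiv.swap i k b))
      = -tilingSum α W)
    {W W₀ : Fin (2 * N) → Fin (2 * N) → ℝ} (hsymm : W i k = W k i) (h1 : W₀ i k = 0)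
    (h2 : W₀ k i = 0) (h3 : ∀ a b, ¬ (a = i ∧ b = k) → ¬ (a = k ∧ b = i) → W₀ a b = W a b) :
    tilingSum α W = tilingSum α W₀ := by
  classical
  -- the contribution `V` of the two entries, which is unchanged (`V'`) if the other entries of
  -- these rows and columns are erased
  set V : Fin (2 * N) → Fin (2 * N) → ℝ := fun a b =>
    if a = i then (if b = k then W i k else 0) else if b = i then (if a = k then W k i else 0)
      else W a b with hV
  set V' : Fin (2 * N) → Fin (2 * N) → ℝ := fun a b =>
    if a = i then (if b = k then W i k else 0) else if b = i then (if a = k then W k i else 0)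
      else if a = k ∨ b = k then 0 else W a b with hV'
  set V'' : Fin (2 * N) → Fin (2 * N) → ℝ := fun a b =>
    if a = i ∨ b = i then 0 else W a b with hV''
  have e1 : tilingSum α W = tilingSum α W₀ + 1 * tilingSum α V := by
    refine tilingSum_add_mul α i 1 ?_ ?_ ?_ ?_
    · intro a b ha hb
      rw [h3] <;> simp [ha, hb]
    · intro a b ha hb
      simp [hV, ha, hb]
    · intro b hb
      by_cases hbk : b = k
      · simp [hV, hbk, h1]
      · rw [h3] <;> simp [hV, hbk, hik]
    · intro a ha
      by_cases hak : a = k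
      · simp [hV, hak, h2, hik.symm]
      · rw [h3] <;> simp [hV, ha, hak]
  have e2 : tilingSum α V = tilingSum α V' + 1 * tilingSum α V'' := by
    refine tilingSum_add_mul α k 1 ?_ ?_ ?_ ?_
    · intro a b ha hb
      simp [hV, hV', ha, hb]
    · intro a b ha hb
      by_cases h4 : a = i <;> by_cases h5 : b = i <;> simp [hV, hV'', ha, hb, h4, h5, hik]
    · intro b hb
      by_cases h5 : b = i <;> simp [hV, hV', hV'', h5, hik.symm]
    · intro a ha
      by_cases h5 : a = i <;> simp [hV, hV', hV'', h5, hik.symm]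
  have e3 : tilingSum α V'' = 0 := tilingSum_eq_zero α i (by simp [hV'']) (by simp [hV''])
  have e4 := hswap V'
  have e5 : (fun a b => V' (Equiv.swap i k a) (Equiv.swap i k b)) = V' := by
    funext a b
    have hval : ∀ a, (a = i ∧ Equiv.swap i k a = k) ∨ (a = k ∧ Equiv.swap i k a = i) ∨
        (a ≠ i ∧ a ≠ k ∧ Equiv.swap i k a = a) := by
      intro a
      by_cases h1 : a = i
      · subst h1; simp
      by_cases h2 : a = k
      · subst h2; simp
      exact Or.inr (Or.inr ⟨h1, h2, Equiv.swap_apply_of_ne_of_ne h1 h2⟩)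
    rcases hval a with ⟨ha, ha'⟩ | ⟨ha, ha'⟩ | ⟨ha1, ha2, ha'⟩ <;>
      rcases hval b with ⟨hb, hb'⟩ | ⟨hb, hb'⟩ | ⟨hb1, hb2, hb'⟩ <;>
      rw [ha', hb'] <;> simp_all [hik.symm]
  rw [e5] at e4
  rw [e1, e2, e3]
  linarith

end Antisymmetry

end LinkPattern

section Valences

variable {N d : ℕ} (s : Fin d → ℕ) (hs : ∑ i, s i = 2 * N)

theorem groupStart_add_le {i i' : Fin d} (h : i < i') :
    groupStart s i + s i ≤ groupStart s i' := by
  unfold groupStart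
  rw [add_comm, ← Finset.sum_insert (by simp)]
  refine Finset.sum_le_sum_of_subset fun k hk => ?_
  rcases Finset.mem_insert.1 hk with rfl | hk
  · exact Finset.mem_Iio.2 h
  · exact Finset.mem_Iio.2 ((Finset.mem_Iio.1 hk).trans h)

theorem groupOf_eq_of_le_of_lt {a : Fin (2 * N)} {i : Fin d} (h1 : groupStart s i ≤ a.val)
    (h2 : a.val < groupStart s i + s i) : groupOf s hs a = i := by
  have h3 := groupStart_add_offset s hs a
  have h4 := offset_lt s hs a
  rcases lt_trichotomy (groupOf s hs a) i with h | h | h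
  · have := groupStart_add_le s h
    omega
  · exact h
  · have := groupStart_add_le s h
    omega

theorem groupOf_eq_of_between {a b c : Fin (2 * N)} (h : groupOf s hs a = groupOf s hs b)
    (hac : a ≤ c) (hcb : c ≤ b) : groupOf s hs c = groupOf s hs a := by
  have h1 := groupStart_add_offset s hs a
  have h2 := groupStart_add_offset s hs b
  have h3 := offset_lt s hs b
  rw [Fin.le_def] at *
  rw [← h] at h2 h3
  apply groupOf_eq_of_le_of_lt <;> omega

namespace LinkPattern

variable {s hs} {α : LinkPattern N}

theorem IsValenced.tilingSum_swap (hα : α.IsValenced s hs) {i k : Fin (2 * N)} (hik : i ≠ k)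
    (hg : groupOf s hs i = groupOf s hs k) (W : Fin (2 * N) → Fin (2 * N) → ℝ) :
    tilingSum α (fun a b => W (Equiv.swap i k a) (Equiv.swap i k b)) = -tilingSum α W := by
  have main : ∀ i k : Fin (2 * N), i < k → groupOf s hs i = groupOf s hs k →
      tilingSum α (fun a b => W (Equiv.swap i k a) (Equiv.swap i k b)) = -tilingSum α W := by
    intro i k hik hg
    refine tilingSum_swap_of_interval α hik (fun a h1 h2 b h3 h4 h => hα a ?_) W
    rw [h, groupOf_eq_of_between s hs hg h1 h2, groupOf_eq_of_between s hs hg h3 h4]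
  rcases lt_or_gt_of_ne hik with h | h
  · exact main i k h hg
  · rw [Equiv.swap_comm]
    exact main k i h hg.symm

/-- The entries of a symmetric kernel between indices of the same group do not matter. -/
theorem IsValenced.tilingSum_erase_groups (hα : α.IsValenced s hs)
    {W : Fin (2 * N) → Fin (2 * N) → ℝ} (hW : ∀ a b, W a b = W b a) :
    tilingSum α (fun a b => if groupOf s hs a = groupOf s hs b then 0 else W a b)
      = tilingSum α W := by
  classical
  have main : ∀ S : Finset (Fin (2 * N) × Fin (2 * N)),
      (∀ p ∈ S, p.1 ≠ p.2 ∧ groupOf s hs p.1 = groupOf s hs p.2) →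
      tilingSum α (fun a b => if (a, b) ∈ S ∨ (b, a) ∈ S then 0 else W a b) = tilingSum α W := by
    intro S
    induction S using Finset.induction_on with
    | empty => simp
    | insert p S hp ih =>
      intro hS
      obtain ⟨i, k⟩ := p
      have hik := hS (i, k) (Finset.mem_insert_self _ _)
      rw [← ih fun q hq => hS q (Finset.mem_insert_of_mem hq)]
      symm
      refine tilingSum_erase α hik.1 (fun W => hα.tilingSum_swap hik.1 hik.2 W) ?_ ?_ ?_ ?_
      · simp only [or_comm, hW i k]
      · simp
      · simp
      · intro a b h1 h2
        simp only [Finset.mem_insert, Prod.mk.injEq]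
        congr 1
        simp only [eq_iff_iff]
        tauto
  rw [← main (Finset.univ.filter fun p => p.1 ≠ p.2 ∧ groupOf s hs p.1 = groupOf s hs p.2)
    (fun p hp => (Finset.mem_filter.1 hp).2)]
  unfold tilingSum
  refine Finset.sum_congr rfl fun β _ => ?_
  congr 1
  rw [fominDet_eq_pairDet, fominDet_eq_pairDet]
  refine pairDet_congr fun a a' ha ha' => ?_
  have hne : a ≠ β.partner a' := by
    rintro rfl
    rw [β.partner_partner] at ha
    exact ha.not_gt ha'
  simp only [Finset.mem_filter, Finset.mem_univ, true_and, hne, hne.symm, ne_eq, not_false_eq_true]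
  congr 1
  simp only [eq_iff_iff]
  constructor
  · exact Or.inl
  · rintro (h | h)
    · exact h
    · exact h.symm

/-- Linear combinations of the rows and columns of a kernel. -/
def combine (W U : Fin (2 * N) → Fin (2 * N) → ℝ) (a b : Fin (2 * N)) : ℝ :=
  ∑ x, ∑ y, U a x * U b y * W x y

theorem combine_single (W : Fin (2 * N) → Fin (2 * N) → ℝ) :
    combine W (fun a => Pi.single a 1) = W := by
  classical
  funext a b
  unfold combine
  rw [Finset.sum_eq_single a, Finset.sum_eq_single b]
  · simp
  · intro y _ hy
    simp [hy]
  · simp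
  · intro x _ hx
    simp [Pi.single_apply, hx]
  · simp

theorem tilingSum_combine_update (α : LinkPattern N) (W U : Fin (2 * N) → Fin (2 * N) → ℝ)
    (i : Fin (2 * N)) (c : ℝ) (p q : Fin (2 * N) → ℝ) :
    tilingSum α (combine W (Function.update U i (p + c • q))) =
      tilingSum α (combine W (Function.update U i p)) +
        c * tilingSum α (combine W (Function.update U i q)) := by
  refine tilingSum_add_mul α i c ?_ ?_ ?_ ?_
  · intro a b ha hb
    simp [combine, ha, hb]
  · intro a b ha hb
    simp [combine, ha, hb]
  · intro b hb
    simp only [combine, Function.update_self, Function.update_of_ne hb, Finset.mul_sum,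
      ← Finset.sum_add_distrib, Pi.add_apply, Pi.smul_apply, smul_eq_mul]
    refine Finset.sum_congr rfl fun x _ => Finset.sum_congr rfl fun y _ => ?_
    ring
  · intro a ha
    simp only [combine, Function.update_self, Function.update_of_ne ha, Finset.mul_sum,
      ← Finset.sum_add_distrib, Pi.add_apply, Pi.smul_apply, smul_eq_mul]
    refine Finset.sum_congr rfl fun x _ => Finset.sum_congr rfl fun y _ => ?_
    ring

theorem tilingSum_combine_update_sum (α : LinkPattern N) (W U : Fin (2 * N) → Fin (2 * N) → ℝ)
    (i : Fin (2 * N)) (p : Fin (2 * N) → ℝ) :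
    tilingSum α (combine W (Function.update U i p)) =
      ∑ x, p x * tilingSum α (combine W (Function.update U i (Pi.single x 1))) := by
  classical
  have hzero : tilingSum α (combine W (Function.update U i 0)) = 0 := by
    have := tilingSum_combine_update α W U i 1 0 0
    simp only [smul_zero, add_zero, one_mul] at this
    linarith
  let f : (Fin (2 * N) → ℝ) →ₗ[ℝ] ℝ :=
    { toFun := fun p => tilingSum α (combine W (Function.update U i p))
      map_add' := fun p q => by
        have := tilingSum_combine_update α W U i 1 p q
        simpa using this
      map_smul' := fun c q => by
        have := tilingSum_combine_update α W U i c 0 q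
        simpa [hzero] using this }
  have e : ∀ x : Fin (2 * N), (Pi.single x 1 : Fin (2 * N) → ℝ) = fun j => if x = j then 1 else 0 :=
    fun x => funext fun j => by simp [Pi.single_apply, eq_comm]
  simp only [e]
  exact f.pi_apply_eq_sum_univ p

/-- If the kernel is transformed by a matrix which is lower unitriangular within the groups of a
valenced link pattern `α`, then `tilingSum α` does not change. -/
theorem IsValenced.tilingSum_combine (hα : α.IsValenced s hs)
    (W : Fin (2 * N) → Fin (2 * N) → ℝ) {U : Fin (2 * N) → Fin (2 * N) → ℝ}
    (h1 : ∀ a, U a a = 1)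
    (h2 : ∀ a x, x ≠ a → U a x ≠ 0 → x < a ∧ groupOf s hs x = groupOf s hs a) :
    tilingSum α (combine W U) = tilingSum α W := by
  classical
  have hzero : ∀ (V : Fin (2 * N) → Fin (2 * N) → ℝ) (i k : Fin (2 * N)), i ≠ k →
      groupOf s hs i = groupOf s hs k → V i = V k → tilingSum α (combine W V) = 0 := by
    intro V i k hik hg hV
    have := hα.tilingSum_swap hik hg (combine W V)
    have e : (fun a b => combine W V (Equiv.swap i k a) (Equiv.swap i k b)) = combine W V := by
      have hV' : ∀ a, V (Equiv.swap i k a) = V a := by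
        intro a
        by_cases h1 : a = i
        · subst h1; simp [hV]
        by_cases h2 : a = k
        · subst h2; simp [hV]
        rw [Equiv.swap_apply_of_ne_of_ne h1 h2]
      funext a b
      simp only [combine, hV']
    rw [e] at this
    linarith
  have main : ∀ m : ℕ, tilingSum α (combine W U) =
      tilingSum α (combine W fun a => if a.val < m then Pi.single a 1 else U a) := by
    intro m
    induction m with
    | zero => simp
    | succ m ih =>
      rw [ih]
      by_cases hm : m < 2 * N
      · set i : Fin (2 * N) := ⟨m, hm⟩ with hi
        set V : Fin (2 * N) → Fin (2 * N) → ℝ :=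
          fun a => if a.val < m + 1 then Pi.single a 1 else U a with hV
        have e : (fun a : Fin (2 * N) => if a.val < m then Pi.single a 1 else U a) =
            Function.update V i (U i) := by
          funext a
          by_cases ha : a = i
          · subst ha
            simp [hi]
          · have : a.val ≠ m := fun h => ha (Fin.ext h)
            rw [Function.update_of_ne ha, hV]
            have : a.val < m ↔ a.val < m + 1 := by omega
            simp only [this]
        rw [e, tilingSum_combine_update_sum, Finset.sum_eq_single i]
        · rw [h1, one_mul]
          congr 2
          funext a
          by_cases ha : a = i
          · subst ha
            simp [hV, hi]
          · rw [Function.update_of_ne ha]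
        · intro x _ hx
          by_cases hU : U i x = 0
          · rw [hU, zero_mul]
          · obtain ⟨h3, h4⟩ := h2 i x hx hU
            rw [hzero _ x i hx h4, mul_zero]
            rw [Function.update_of_ne hx, Function.update_self, hV]
            have : x.val < m + 1 := by
              rw [Fin.lt_def] at h3
              simp only [hi] at h3
              omega
            simp only [this, if_true]
        · simp
      · congr 2
        funext a
        rw [if_pos (by omega), if_pos (by omega)]
  rw [main (2 * N)]
  simp only [Fin.is_lt, if_true]
  rw [combine_single]

end LinkPattern

theorem tangentialDiff_iterate (m q : ℕ) (f : ℕ → ℝ) : tangentialDiff^[m] f q =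
    ∑ k ∈ Finset.range (m + 1), ((-1 : ℝ) ^ (m - k) * m.choose k) * f (q + k) := by
  have h : tangentialDiff = fwdDiff 1 := rfl
  rw [h, fwdDiff_iter_eq_sum_shift]
  refine Finset.sum_congr rfl fun k _ => ?_
  simp

/-- The coefficients of the iterated tangential differences on the indices of a group. -/
noncomputable def diffCoeff (a x : Fin (2 * N)) : ℝ :=
  if x ≤ a ∧ groupOf s hs x = groupOf s hs a then
    (-1 : ℝ) ^ (offset s hs a - offset s hs x) * (offset s hs a).choose (offset s hs x) else 0

theorem tangentialDiff_iterate_eq_sum (a : Fin (2 * N)) (f : ℕ → ℝ) :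
    tangentialDiff^[offset s hs a] f (groupStart s (groupOf s hs a)) =
      ∑ x, diffCoeff s hs a x * f x := by
  classical
  rw [tangentialDiff_iterate]
  unfold diffCoeff
  simp only [ite_mul, zero_mul]
  rw [← Finset.sum_filter]
  have ha := groupStart_add_offset s hs a
  have ho := offset_lt s hs a
  symm
  refine Finset.sum_bij (fun x _ => offset s hs x) ?_ ?_ ?_ ?_
  · intro x hx
    obtain ⟨h1, h2⟩ := (Finset.mem_filter.1 hx).2
    have := groupStart_add_offset s hs x
    rw [Fin.le_def] at h1
    rw [h2] at this
    rw [Finset.mem_range]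
    omega
  · intro x hx y hy hxy
    obtain ⟨h1, h2⟩ := (Finset.mem_filter.1 hx).2
    obtain ⟨h3, h4⟩ := (Finset.mem_filter.1 hy).2
    have e1 := groupStart_add_offset s hs x
    have e2 := groupStart_add_offset s hs y
    rw [h2] at e1
    rw [h4] at e2
    apply Fin.ext
    omega
  · intro k hk
    rw [Finset.mem_range] at hk
    have hlt : groupStart s (groupOf s hs a) + k < 2 * N := by
      have := a.2
      omega
    have hg := groupOf_eq_of_le_of_lt s hs (a := ⟨_, hlt⟩) (i := groupOf s hs a) (by simp)
      (by simp only; omega)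
    have ho' := groupStart_add_offset s hs ⟨_, hlt⟩
    rw [hg] at ho'
    refine ⟨⟨_, hlt⟩, Finset.mem_filter.2 ⟨Finset.mem_univ _, ?_, hg⟩, ?_⟩
    · rw [Fin.le_def]
      simp only
      omega
    · simp only at ho'
      omega
  · intro x hx
    obtain ⟨h1, h2⟩ := (Finset.mem_filter.1 hx).2
    have e1 := groupStart_add_offset s hs x
    rw [h2] at e1
    rw [e1]

/-- The fused kernel gives the same sum as the unfused one: the entries within a group do not matter
and may be set to zero before and after taking differences, and the passage to differences is a
unitriangular transformation within each group. -/
theorem tilingSum_fusedKernel {V D : Type*} [Fintype V] [Fintype D] (G : PlaneGraph V D)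
    (e : Fin (2 * N) → D) {α : LinkPattern N} (hα : α.IsValenced s hs)
    (hsymm : ∀ a b, G.excursionKernel (e a) (e b) = G.excursionKernel (e b) (e a)) :
    LinkPattern.tilingSum α (G.fusedKernel s hs e) =
      LinkPattern.tilingSum α fun a b => G.excursionKernel (e a) (e b) := by
  classical
  rw [← hα.tilingSum_erase_groups hsymm, ← hα.tilingSum_combine (fun a b =>
    if groupOf s hs a = groupOf s hs b then 0 else G.excursionKernel (e a) (e b))
    (U := diffCoeff s hs)]
  · congr 1
    funext a b
    unfold PlaneGraph.fusedKernel
    split_ifs with h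
    · symm
      refine Finset.sum_eq_zero fun x _ => Finset.sum_eq_zero fun y _ => ?_
      beta_reduce
      split_ifs with hxy
      · simp
      · unfold diffCoeff
        split_ifs with h1 h2
        · exact absurd (h1.2.trans (h.trans h2.2.symm)) hxy
        all_goals simp
    · rw [tangentialDiff_iterate_eq_sum]
      unfold LinkPattern.combine
      refine Finset.sum_congr rfl fun x _ => ?_
      rw [tangentialDiff_iterate_eq_sum, Finset.mul_sum]
      refine Finset.sum_congr rfl fun y _ => ?_
      unfold diffCoeff
      beta_reduce
      split_ifs with h1 h2 h3
      · exact absurd (h1.2.symm.trans (h3.trans h2.2)) h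
      · simp only [PlaneGraph.edgeKernel, Fin.is_lt, and_self, dite_true, Fin.eta]
        ring
      all_goals simp
  · intro a
    simp [diffCoeff]
  · intro a x hx h
    unfold diffCoeff at h
    split_ifs at h with h1
    · exact ⟨lt_of_le_of_ne h1.1 hx, h1.2⟩
    · exact absurd rfl h

end Valences


/-! ### The Laplacian and the Green's function -/

namespace PlaneGraph

variable {V D : Type*} [Fintype V] [Fintype D] (G : PlaneGraph V D)

theorem isBoundary_org_outer : G.IsBoundary (G.org G.outer) :=
  ⟨G.outer, Equiv.Perm.SameCycle.refl _ _, rfl⟩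

theorem not_isInterior_iff {v : V} : ¬ G.IsInterior v ↔ G.IsBoundary v := not_not

theorem head_rev (d : D) : G.head (G.rev d) = G.org d := by
  unfold head
  rw [G.rev_rev]

theorem org_rev (d : D) : G.org (G.rev d) = G.head d := rfl

section Laplacian

open scoped Classical

/-- Minimum principle for the Laplacian with Dirichlet boundary conditions. -/
theorem nonneg_of_superharmonic {φ : V → ℝ} (h0 : ∀ v, G.IsBoundary v → φ v = 0)
    (h1 : ∀ v, G.IsInterior v → 0 ≤ ∑ d : {d // G.org d = v}, (φ v - φ (G.head d.1))) (v : V) :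
    0 ≤ φ v := by
  obtain ⟨m, -, hm⟩ := Finset.exists_min_image Finset.univ φ ⟨v, Finset.mem_univ v⟩
  have hm' : ∀ x, φ m ≤ φ x := fun x => hm x (Finset.mem_univ _)
  by_contra hv
  have hneg : φ m < 0 := lt_of_le_of_lt (hm' v) (not_le.1 hv)
  -- the minimum propagates along the edges to the boundary
  have hall : ∀ x, Relation.ReflTransGen (fun x y => ∃ d, G.org d = x ∧ G.org (G.rev d) = y) m x →
      φ x = φ m := by
    intro x hx
    induction hx with
    | refl => rfl
    | tail _ hxy ih =>
      rename_i x y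
      obtain ⟨d, rfl, rfl⟩ := hxy
      have hint : G.IsInterior (G.org d) := fun hb => by
        rw [h0 _ hb] at ih
        exact hneg.ne ih.symm
      have hle : ∀ d' : {d' // G.org d' = G.org d}, φ (G.org d) - φ (G.head d'.1) ≤ 0 := by
        intro d'
        rw [ih]
        linarith [hm' (G.head d'.1)]
      have hz := (Finset.sum_eq_zero_iff_of_nonpos fun d' _ => hle d').1
        (le_antisymm (Finset.sum_nonpos fun d' _ => hle d') (h1 _ hint)) ⟨d, rfl⟩
        (Finset.mem_univ _)
      have : φ (G.org d) - φ (G.org (G.rev d)) = 0 := hz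
      linarith
  have := hall _ (G.connected m (G.org G.outer))
  rw [h0 _ G.isBoundary_org_outer] at this
  exact hneg.ne this.symm

/-- The interior vertices as a type. -/
abbrev Interior : Type _ := {v : V // G.IsInterior v}

/-- The Laplacian with Dirichlet boundary conditions, as a matrix indexed by the interior
vertices. -/
noncomputable def laplacian : Matrix G.Interior G.Interior ℝ := Matrix.of fun v w =>
  ∑ d : {d // G.org d = v.1}, ((if v = w then 1 else 0) - if G.head d.1 = w.1 then 1 else 0)

/-- The extension by zero of a function on the interior vertices. -/
noncomputable def extend (φ : G.Interior → ℝ) (v : V) : ℝ :=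
  if h : G.IsInterior v then φ ⟨v, h⟩ else 0

theorem extend_boundary (φ : G.Interior → ℝ) {v : V} (h : G.IsBoundary v) : G.extend φ v = 0 :=
  dif_neg (not_not.2 h)

theorem extend_interior (φ : G.Interior → ℝ) (v : G.Interior) : G.extend φ v.1 = φ v :=
  dif_pos v.2

theorem sum_head_eq (φ : G.Interior → ℝ) (x : V) :
    ∑ w : G.Interior, (if x = w.1 then 1 else 0) * φ w = G.extend φ x := by
  unfold extend
  split_ifs with h
  · rw [Finset.sum_eq_single ⟨x, h⟩]
    · simp
    · intro w _ hw
      rw [if_neg, zero_mul]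
      exact fun h' => hw (Subtype.ext h'.symm)
    · simp
  · refine Finset.sum_eq_zero fun w _ => ?_
    rw [if_neg, zero_mul]
    rintro rfl
    exact h w.2

theorem laplacian_mulVec (φ : G.Interior → ℝ) (v : G.Interior) :
    (G.laplacian.mulVec φ) v =
      ∑ d : {d // G.org d = v.1}, (G.extend φ v.1 - G.extend φ (G.head d.1)) := by
  simp only [Matrix.mulVec, dotProduct, laplacian, Matrix.of_apply, Finset.sum_mul]
  rw [Finset.sum_comm]
  refine Finset.sum_congr rfl fun d _ => ?_
  simp only [sub_mul, Finset.sum_sub_distrib, ite_mul, one_mul, zero_mul,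
    Finset.sum_ite_eq, Finset.mem_univ, if_true, extend_interior]
  congr 1
  rw [← G.sum_head_eq]
  simp

theorem nonneg_of_laplacian_mulVec_nonneg {φ : G.Interior → ℝ}
    (h : ∀ v, 0 ≤ (G.laplacian.mulVec φ) v) (v : G.Interior) : 0 ≤ φ v := by
  rw [← G.extend_interior φ v]
  refine G.nonneg_of_superharmonic (fun v hv => G.extend_boundary φ hv) (fun v hv => ?_) v.1
  have := h ⟨v, hv⟩
  rwa [laplacian_mulVec] at this

theorem eq_zero_of_laplacian_mulVec_eq_zero {φ : G.Interior → ℝ}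
    (h : G.laplacian.mulVec φ = 0) : φ = 0 := by
  funext v
  refine le_antisymm ?_ (G.nonneg_of_laplacian_mulVec_nonneg (fun v => by rw [h]; rfl) v)
  have := G.nonneg_of_laplacian_mulVec_nonneg (φ := -φ)
    (fun v => by rw [Matrix.mulVec_neg, h]; simp) v
  simpa using this

theorem laplacian_det_ne_zero : G.laplacian.det ≠ 0 := by
  intro h
  obtain ⟨φ, hφ, h0⟩ := Matrix.exists_mulVec_eq_zero_iff.2 h
  exact hφ (G.eq_zero_of_laplacian_mulVec_eq_zero h0)

theorem laplacian_mul_inv : G.laplacian * G.laplacian⁻¹ = 1 :=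
  Matrix.mul_nonsing_inv _ (Ne.isUnit G.laplacian_det_ne_zero)

theorem laplacian_mulVec_inv_col (w : G.Interior) (v : G.Interior) :
    (G.laplacian.mulVec fun x => G.laplacian⁻¹ x w) v = if v = w then 1 else 0 := by
  have := congrFun (congrFun G.laplacian_mul_inv v) w
  rw [Matrix.mul_apply] at this
  simp only [Matrix.mulVec, dotProduct]
  rw [this, Matrix.one_apply]

theorem laplacian_inv_nonneg (v w : G.Interior) : 0 ≤ G.laplacian⁻¹ v w := by
  refine G.nonneg_of_laplacian_mulVec_nonneg (φ := fun x => G.laplacian⁻¹ x w) (fun x => ?_) v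
  rw [laplacian_mulVec_inv_col]
  split_ifs <;> norm_num

theorem laplacian_transpose : G.laplacian.transpose = G.laplacian := by
  ext v w
  simp only [Matrix.transpose_apply, laplacian, Matrix.of_apply, Finset.sum_sub_distrib]
  congr 1
  · by_cases h : v = w
    · subst h; rfl
    · simp [h, Ne.symm h]
  · rw [Finset.sum_boole, Finset.sum_boole]
    congr 1
    have key : ∀ x y : V, (Finset.univ.filter fun d : {d // G.org d = x} => G.head d.1 = y).card =
        (Finset.univ.filter fun d : D => G.org d = x ∧ G.head d = y).card := by
      intro x y
      refine Finset.card_bij (fun d _ => d.1) ?_ (fun a _ b _ h => Subtype.ext h) ?_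
      · intro d hd
        simpa [d.2] using hd
      · intro d hd
        simp only [Finset.mem_filter, Finset.mem_univ, true_and] at hd
        exact ⟨⟨d, hd.1⟩, by simpa using hd.2, rfl⟩
    rw [key, key]
    refine Finset.card_bij (fun d _ => G.rev d) ?_ (fun a _ b _ h => G.rev.injective h) ?_
    · intro d hd
      simp only [Finset.mem_filter, Finset.mem_univ, true_and] at hd ⊢
      rw [org_rev, head_rev]
      exact hd.symm
    · intro d hd
      simp only [Finset.mem_filter, Finset.mem_univ, true_and] at hd
      refine ⟨G.rev d, ?_, G.rev_rev d⟩
      simp only [Finset.mem_filter, Finset.mem_univ, true_and]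
      rw [org_rev, head_rev]
      exact hd.symm

end Laplacian

section Walks

open scoped Classical

theorem degree_eq_card (v : V) : G.degree v = Fintype.card {d // G.org d = v} := by
  unfold degree
  rw [← Nat.card_coe_set_eq, Nat.card_eq_fintype_card]
  rfl

theorem degree_pos (v : G.Interior) : 0 < G.degree v.1 := by
  have h := G.laplacian_mulVec_inv_col v v
  rw [laplacian_mulVec, if_pos rfl] at h
  rw [degree_eq_card, Fintype.card_pos_iff]
  by_contra hne
  rw [not_nonempty_iff] at hne
  rw [Finset.univ_eq_empty, Finset.sum_empty] at h
  norm_num at h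

/-- The weight of a list of darts if it is an interior walk from `v` to `w`, and zero otherwise. -/
noncomputable def walkTerm (v w : V) (l : List D) : ℝ :=
  if G.IsInteriorWalk v w l then G.walkWeight v l else 0

theorem walkTerm_nonneg (v w : V) (l : List D) : 0 ≤ G.walkTerm v w l := by
  unfold walkTerm walkWeight
  split_ifs
  · refine mul_nonneg (by positivity) (List.prod_nonneg fun x hx => ?_)
    obtain ⟨d, -, rfl⟩ := List.mem_map.1 hx
    positivity
  · rfl

theorem walkTerm_nil (v : G.Interior) (w : V) :
    G.walkTerm v.1 w [] = (G.degree v.1 : ℝ)⁻¹ * if v.1 = w then 1 else 0 := by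
  simp [walkTerm, walkWeight, IsInteriorWalk, v.2]

theorem walkTerm_cons (v : G.Interior) (w : V) (d : D) (l : List D) :
    G.walkTerm v.1 w (d :: l) = (G.degree v.1 : ℝ)⁻¹ *
      if G.org d = v.1 then G.walkTerm (G.head d) w l else 0 := by
  by_cases h : G.org d = v.1 <;> simp [walkTerm, walkWeight, IsInteriorWalk, v.2, h]

theorem walkTerm_boundary {v : V} (hv : G.IsBoundary v) (w : V) (l : List D) :
    G.walkTerm v w l = 0 := by
  unfold walkTerm
  rw [if_neg]
  cases l <;> simp [IsInteriorWalk, IsInterior, hv]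

theorem not_isInteriorWalk_of_boundary {w : V} (hw : G.IsBoundary w) (v : V) (l : List D) :
    ¬ G.IsInteriorWalk v w l := by
  induction l generalizing v with
  | nil =>
    rintro ⟨h, rfl⟩
    exact h hw
  | cons d l ih => exact fun h => ih _ h.2.2

/-- The lists of length less than `n`. -/
noncomputable def shortLists (D : Type*) [Fintype D] : ℕ → Finset (List D)
  | 0 => ∅
  | n + 1 => insert [] ((Finset.univ ×ˢ shortLists D n).image fun p => p.1 :: p.2)

theorem mem_shortLists {n : ℕ} {l : List D} : l ∈ shortLists D n ↔ l.length < n := by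
  induction n generalizing l with
  | zero => simp [shortLists]
  | succ n ih =>
    cases l with
    | nil => simp [shortLists]
    | cons d l => simp [shortLists, ih]

theorem sum_shortLists_succ (n : ℕ) (v : G.Interior) (w : V) :
    ∑ l ∈ shortLists D (n + 1), G.walkTerm v.1 w l = (G.degree v.1 : ℝ)⁻¹ *
      ((if v.1 = w then 1 else 0) + ∑ d : {d // G.org d = v.1},
        ∑ l ∈ shortLists D n, G.walkTerm (G.head d.1) w l) := by
  rw [shortLists, Finset.sum_insert (by simp), Finset.sum_image, Finset.sum_product, walkTerm_nil,
    mul_add]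
  · congr 1
    simp only [walkTerm_cons, ← Finset.mul_sum]
    congr 1
    rw [← Finset.sum_subtype (Finset.univ.filter fun d => G.org d = v.1) (by simp)
      fun d => ∑ l ∈ shortLists D n, G.walkTerm (G.head d) w l, Finset.sum_filter]
    refine Finset.sum_congr rfl fun d _ => ?_
    split_ifs <;> simp
  · rintro ⟨a, b⟩ _ ⟨c, d⟩ _ h
    simpa using h

theorem laplacian_inv_eq (v w : G.Interior) :
    G.laplacian⁻¹ v w = (G.degree v.1 : ℝ)⁻¹ * ((if v = w then 1 else 0) +
      ∑ d : {d // G.org d = v.1}, G.extend (fun x => G.laplacian⁻¹ x w) (G.head d.1)) := by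
  have h := G.laplacian_mulVec_inv_col w v
  have hdeg : (G.degree v.1 : ℝ) ≠ 0 := by exact_mod_cast (G.degree_pos v).ne'
  rw [laplacian_mulVec, Finset.sum_sub_distrib, Finset.sum_const, Finset.card_univ,
    ← degree_eq_card, nsmul_eq_mul, extend_interior] at h
  rw [← h]
  field_simp
  ring

theorem sum_shortLists_le (n : ℕ) (v : V) (w : G.Interior) :
    ∑ l ∈ shortLists D n, G.walkTerm v w.1 l ≤ G.extend (fun x => G.laplacian⁻¹ x w) v := by
  induction n generalizing v with
  | zero =>
    rw [shortLists, Finset.sum_empty]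
    unfold extend
    split_ifs
    · exact G.laplacian_inv_nonneg _ _
    · rfl
  | succ n ih =>
    by_cases hv : G.IsInterior v
    · rw [G.sum_shortLists_succ n ⟨v, hv⟩, G.extend_interior _ ⟨v, hv⟩, G.laplacian_inv_eq]
      refine mul_le_mul_of_nonneg_left (add_le_add (le_of_eq ?_) (Finset.sum_le_sum fun d _ =>
        ih _)) (by positivity)
      simp [Subtype.ext_iff]
    · rw [G.not_isInterior_iff] at hv
      rw [G.extend_boundary _ hv]
      simp [G.walkTerm_boundary hv]

theorem summable_walkTerm (v w : V) : Summable (G.walkTerm v w) := by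
  by_cases hw : G.IsInterior w
  · refine summable_of_sum_le (G.walkTerm_nonneg v w)
      (c := G.extend (fun x => G.laplacian⁻¹ x ⟨w, hw⟩) v) fun F => ?_
    refine le_trans (Finset.sum_le_sum_of_subset_of_nonneg (t := shortLists D
      (F.sup List.length + 1)) (fun l hl => ?_) fun l _ _ => G.walkTerm_nonneg v w l)
      (G.sum_shortLists_le _ v ⟨w, hw⟩)
    rw [mem_shortLists, Nat.lt_succ_iff]
    exact Finset.le_sup (f := List.length) hl
  · rw [G.not_isInterior_iff] at hw
    convert summable_zero with l
    exact if_neg (G.not_isInteriorWalk_of_boundary hw v l)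

theorem summable_walkWeight (v w : V) :
    Summable fun l : {l : List D // G.IsInteriorWalk v w l} => G.walkWeight v l.val := by
  have := (G.summable_walkTerm v w).subtype {l | G.IsInteriorWalk v w l}
  refine this.congr fun l => ?_
  exact if_pos l.2

theorem green_eq_tsum (v w : V) : G.green v w = ∑' l, G.walkTerm v w l := by
  unfold green
  rw [← tsum_subtype_eq_of_support_subset (s := {l | G.IsInteriorWalk v w l})]
  · exact tsum_congr fun l => (if_pos l.2).symm
  · intro l hl
    by_contra h
    exact hl (if_neg h)

theorem tendsto_sum_shortLists (v w : V) : Filter.Tendsto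
    (fun n => ∑ l ∈ shortLists D n, G.walkTerm v w l) Filter.atTop (nhds (G.green v w)) := by
  rw [green_eq_tsum]
  refine (G.summable_walkTerm v w).hasSum.comp (Filter.tendsto_atTop_finset_of_monotone ?_ ?_)
  · intro m n hmn l hl
    rw [mem_shortLists] at *
    omega
  · exact fun l => ⟨l.length + 1, mem_shortLists.2 (Nat.lt_succ_self _)⟩

/-- The Green's function is the inverse of the Laplacian. -/
theorem green_eq_laplacian_inv (v w : G.Interior) : G.green v.1 w.1 = G.laplacian⁻¹ v w := by
  have hrec : ∀ x : G.Interior, G.green x.1 w.1 = (G.degree x.1 : ℝ)⁻¹ *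
      ((if x.1 = w.1 then 1 else 0) + ∑ d : {d // G.org d = x.1}, G.green (G.head d.1) w.1) := by
    intro x
    refine tendsto_nhds_unique
      ((Filter.tendsto_add_atTop_iff_nat 1).2 (G.tendsto_sum_shortLists x.1 w.1)) ?_
    simp only [G.sum_shortLists_succ]
    exact (tendsto_const_nhds.add (tendsto_finsetSum _ fun d _ =>
      G.tendsto_sum_shortLists _ _)).const_mul _
  have hext : ∀ x, G.extend (fun x : G.Interior => G.green x.1 w.1) x = G.green x w.1 := by
    intro x
    by_cases hx : G.IsInterior x
    · exact G.extend_interior _ ⟨x, hx⟩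
    · rw [G.not_isInterior_iff] at hx
      rw [G.extend_boundary _ hx, green_eq_tsum]
      simp [G.walkTerm_boundary hx]
  have h0 : G.laplacian.mulVec ((fun x : G.Interior => G.green x.1 w.1) -
      fun x => G.laplacian⁻¹ x w) = 0 := by
    rw [Matrix.mulVec_sub]
    funext x
    rw [Pi.sub_apply, laplacian_mulVec_inv_col, laplacian_mulVec]
    simp only [hext]
    have hdeg : (G.degree x.1 : ℝ) ≠ 0 := by exact_mod_cast (G.degree_pos x).ne'
    have h1 := hrec x
    rw [Finset.sum_sub_distrib, Finset.sum_const, Finset.card_univ, ← degree_eq_card, nsmul_eq_mul]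
    rw [h1]
    simp only [Subtype.ext_iff, Pi.zero_apply]
    field_simp
    ring
  have h1 := congrFun (G.eq_zero_of_laplacian_mulVec_eq_zero h0) v
  simpa [sub_eq_zero] using h1

end Walks

end PlaneGraph


/-! ### Arrows, the matrix-tree theorem, and minors of the Green's function -/

namespace PlaneGraph

variable {V D : Type*} [Fintype V] [Fintype D] (G : PlaneGraph V D)

/-- A choice of an outgoing edge at each interior vertex. -/
abbrev Arrows : Type _ := ∀ v : G.Interior, {d : D // G.org d = v.1}

variable {G}

/-- Following the arrows from `v`, the boundary is reached after `n` interior steps through the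
dart `d`. -/
inductive Via (f : G.Arrows) : ℕ → G.Interior → D → Prop
  | last {v : G.Interior} (h : G.IsBoundary (G.head (f v).1)) : Via f 0 v (f v).1
  | step {n : ℕ} {v w : G.Interior} {d : D} (h : G.head (f v).1 = w.1) (hw : Via f n w d) :
      Via f (n + 1) v d

/-- Following the arrows from `v`, the boundary is reached through the dart `d`. -/
def ExitsVia (f : G.Arrows) (v : G.Interior) (d : D) : Prop := ∃ n, Via f n v d

/-- The arrows have no cycles: the boundary is reached from everywhere. -/
def Acyclic (f : G.Arrows) : Prop := ∀ v, ∃ d, ExitsVia f v d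

theorem via_iff_of_boundary {f : G.Arrows} {v : G.Interior} (h : G.IsBoundary (G.head (f v).1))
    {n : ℕ} {d : D} : Via f n v d ↔ n = 0 ∧ d = (f v).1 := by
  constructor
  · intro hv
    cases hv with
    | last _ => exact ⟨rfl, rfl⟩
    | @step _ _ w _ h' _ =>
      rw [h'] at h
      exact absurd h w.2
  · rintro ⟨rfl, rfl⟩
    exact Via.last h

theorem via_iff_of_interior {f : G.Arrows} {v w : G.Interior} (h : G.head (f v).1 = w.1)
    {n : ℕ} {d : D} : Via f n v d ↔ ∃ m, n = m + 1 ∧ Via f m w d := by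
  constructor
  · intro hv
    cases hv with
    | last h' =>
      rw [h] at h'
      exact absurd h' w.2
    | @step m _ x _ h' hw =>
      obtain rfl : w = x := Subtype.ext (h.symm.trans h')
      exact ⟨m, rfl, hw⟩
  · rintro ⟨m, rfl, hw⟩
    exact Via.step h hw

theorem Via.unique {f : G.Arrows} {n m : ℕ} {v : G.Interior} {d d' : D} (h : Via f n v d)
    (h' : Via f m v d') : n = m ∧ d = d' := by
  induction h generalizing m with
  | last h =>
    obtain ⟨rfl, rfl⟩ := (via_iff_of_boundary h).1 h'
    exact ⟨rfl, rfl⟩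
  | step h hw ih =>
    obtain ⟨k, rfl, hk⟩ := (via_iff_of_interior h).1 h'
    obtain ⟨rfl, rfl⟩ := ih hk
    exact ⟨rfl, rfl⟩

theorem ExitsVia.unique {f : G.Arrows} {v : G.Interior} {d d' : D} (h : ExitsVia f v d)
    (h' : ExitsVia f v d') : d = d' := by
  obtain ⟨n, hn⟩ := h
  obtain ⟨m, hm⟩ := h'
  exact (hn.unique hm).2

theorem exitsVia_iff_of_boundary {f : G.Arrows} {v : G.Interior}
    (h : G.IsBoundary (G.head (f v).1)) {d : D} : ExitsVia f v d ↔ d = (f v).1 := by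
  simp [ExitsVia, via_iff_of_boundary h]

theorem exitsVia_iff_of_interior {f : G.Arrows} {v w : G.Interior} (h : G.head (f v).1 = w.1)
    {d : D} : ExitsVia f v d ↔ ExitsVia f w d := by
  simp only [ExitsVia, via_iff_of_interior h]
  constructor
  · rintro ⟨n, m, rfl, hm⟩
    exact ⟨m, hm⟩
  · rintro ⟨m, hm⟩
    exact ⟨m + 1, m, rfl, hm⟩

/-- The number of steps to the boundary, as a function of the interior vertex. -/
theorem Acyclic.exists_rank {f : G.Arrows} (hf : Acyclic f) :
    ∃ r : G.Interior → ℕ, ∀ v w, G.head (f v).1 = w.1 → r v = r w + 1 := by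
  choose d n hn using hf
  refine ⟨n, fun v w h => ?_⟩
  exact ((hn v).unique (Via.step h (hn w))).1

theorem acyclic_of_rank {f : G.Arrows} (r : G.Interior → ℕ)
    (hr : ∀ v w, G.head (f v).1 = w.1 → r w < r v) : Acyclic f := by
  intro v
  induction h : r v using Nat.strong_induction_on generalizing v with
  | _ n ih =>
    by_cases hb : G.IsInterior (G.head (f v).1)
    · obtain ⟨d, m, hm⟩ := ih (r ⟨_, hb⟩) (h ▸ hr v ⟨_, hb⟩ rfl) ⟨_, hb⟩ rfl
      exact ⟨d, m + 1, Via.step rfl hm⟩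
    · exact ⟨_, 0, Via.last (G.not_isInterior_iff.1 hb)⟩

section MatrixTree

open scoped Classical

variable {κ : Type*} [Fintype κ] [DecidableEq κ]

/-- One minus the adjacency matrix of the arrows. -/
noncomputable def arrowLaplacian (f : G.Arrows) : Matrix G.Interior G.Interior ℝ :=
  Matrix.of fun v w => (if v = w then 1 else 0) - if G.head (f v).1 = w.1 then 1 else 0

/-- The matrix recording which arrows are the marked darts. -/
noncomputable def arrowMarks (f : G.Arrows) (y : κ → D) : Matrix G.Interior κ ℝ :=
  Matrix.of fun v l => if (f v).1 = y l then 1 else 0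

/-- For acyclic arrows, this matrix is unitriangular with respect to the distance to the boundary. -/
theorem det_arrowLaplacian {f : G.Arrows} (hf : Acyclic f) : (arrowLaplacian f).det = 1 := by
  obtain ⟨r, hr⟩ := hf.exists_rank
  have hb : (arrowLaplacian f).BlockTriangular (fun v => OrderDual.toDual (r v)) := by
    intro v w hvw
    simp only [OrderDual.toDual_lt_toDual] at hvw
    have h1 : v ≠ w := by rintro rfl; exact lt_irrefl _ hvw
    have h2 : G.head (f v).1 ≠ w.1 := fun h => by
      have := hr v w h
      omega
    simp [arrowLaplacian, h1, h2]
  rw [hb.det]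
  refine Finset.prod_eq_one fun k _ => ?_
  have hone : (arrowLaplacian f).toSquareBlock (fun v => OrderDual.toDual (r v)) k = 1 := by
    ext v w
    have h2 : G.head (f v.1).1 ≠ w.1.1 := fun h => by
      have h3 := hr v.1 w.1 h
      have h5 : OrderDual.toDual (r v.1) = OrderDual.toDual (r w.1) := v.2.trans w.2.symm
      rw [OrderDual.toDual_inj] at h5
      omega
    simp [Matrix.toSquareBlock_def, arrowLaplacian, h2, Matrix.one_apply, Subtype.ext_iff]
  rw [hone, Matrix.det_one]

/-- For acyclic arrows, the bordered determinant detects which marked darts end the branches from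
the marked vertices. -/
theorem det_bordered_of_acyclic {f : G.Arrows} (hf : Acyclic f) (x : κ → G.Interior) (y : κ → D)
    (hy : ∀ l, G.IsBoundary (G.head (y l))) :
    (Matrix.fromBlocks (arrowLaplacian f) (arrowMarks f y)
      (-(Matrix.of fun k v => if x k = v then 1 else 0)) 0).det =
    (Matrix.of fun k l => if ExitsVia f (x k) (y l) then (1 : ℝ) else 0).det := by
  have hdet := det_arrowLaplacian hf
  have : Invertible (arrowLaplacian f) := Matrix.invertibleOfIsUnitDet _ (by rw [hdet]; simp)
  rw [Matrix.det_fromBlocks₁₁, hdet, one_mul]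
  have hX : arrowLaplacian f * (Matrix.of fun v l => if ExitsVia f v (y l) then (1 : ℝ) else 0) =
      arrowMarks f y := by
    ext v l
    simp only [Matrix.mul_apply, arrowLaplacian, Matrix.of_apply, sub_mul, Finset.sum_sub_distrib,
      ite_mul, one_mul, zero_mul, Finset.sum_ite_eq, Finset.mem_univ, if_true, arrowMarks]
    by_cases hb : G.IsInterior (G.head (f v).1)
    · rw [Finset.sum_eq_single ⟨_, hb⟩]
      · have hne : (f v).1 ≠ y l := by
          intro h
          rw [h] at hb
          exact hb (hy l)
        simp [exitsVia_iff_of_interior (w := ⟨_, hb⟩) rfl, hne]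
      · intro w _ hw
        rw [if_neg]
        exact fun h => hw (Subtype.ext h.symm)
      · simp
    · have hb' := G.not_isInterior_iff.1 hb
      rw [Finset.sum_eq_zero]
      · simp [exitsVia_iff_of_boundary hb', eq_comm]
      · intro w _
        rw [if_neg]
        intro h
        rw [h] at hb
        exact hb w.2
  rw [← hX, Matrix.mul_assoc, Matrix.invOf_mul_cancel_left, zero_sub, Matrix.neg_mul, neg_neg]
  congr 1
  ext k l
  simp only [Matrix.mul_apply, Matrix.of_apply, ite_mul, one_mul, zero_mul, Finset.sum_ite_eq,
    Finset.mem_univ, if_true]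

/-- Arrows with a cycle do not contribute to the expansion of the bordered determinant. -/
theorem det_bordered_of_not_acyclic {f : G.Arrows} (hf : ¬ Acyclic f) (y : κ → D)
    (hy : ∀ l, G.IsBoundary (G.head (y l))) (C : Matrix κ G.Interior ℝ) :
    (Matrix.fromBlocks (arrowLaplacian f) (arrowMarks f y) C 0).det = 0 := by
  -- the rows of the vertices from which the boundary is not reached are linearly dependent
  set S : G.Interior → Prop := fun v => ¬ ∃ d, ExitsVia f v d with hS
  have hSf : ∀ v, S v → ∃ w, S w ∧ G.head (f v).1 = w.1 := by
    intro v hv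
    by_cases hb : G.IsInterior (G.head (f v).1)
    · refine ⟨⟨_, hb⟩, ?_, rfl⟩
      simpa only [hS, exitsVia_iff_of_interior (f := f) (v := v) (w := ⟨_, hb⟩) rfl] using hv
    · exact absurd ⟨_, 0, Via.last (G.not_isInterior_iff.1 hb)⟩ hv
  rw [Matrix.twoBlockTriangular_det' _ (fun i => Sum.elim S (fun _ => False) i)]
  · convert zero_mul _
    rw [← Matrix.exists_mulVec_eq_zero_iff]
    refine ⟨fun _ => 1, ?_, ?_⟩
    · obtain ⟨v, hv⟩ := not_forall.1 hf
      intro h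
      have := congrFun h ⟨Sum.inl v, hv⟩
      simp at this
    · funext ⟨i, hi⟩
      rcases i with v | k
      · obtain ⟨w, hw, hvw⟩ := hSf v hi
        have hsum : ∀ u : G.Interior, S u →
            ∑ j : {i : G.Interior ⊕ κ // Sum.elim S (fun _ => False) i},
              (Sum.elim (fun v => if u = v then (1 : ℝ) else 0) (fun _ => 0) j.1) = 1 := by
          intro u hu
          rw [Finset.sum_eq_single ⟨Sum.inl u, hu⟩]
          · simp
          · rintro ⟨j | j, hj⟩ _ hne
            · simp only [Sum.elim_inl]
              rw [if_neg]
              rintro rfl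
              exact hne rfl
            · exact absurd hj id
          · simp
        simp only [Matrix.mulVec, dotProduct, mul_one, Matrix.toSquareBlockProp_def,
          Matrix.of_apply, Pi.zero_apply]
        refine Eq.trans ?_ (sub_eq_zero.2 ((hsum v hi).trans (hsum w hw).symm))
        rw [← Finset.sum_sub_distrib]
        refine Finset.sum_congr rfl ?_
        rintro ⟨j | j, hj⟩ _
        · simp only [Matrix.fromBlocks_apply₁₁, arrowLaplacian, Matrix.of_apply, Sum.elim_inl, hvw,
            Subtype.ext_iff]
        · exact absurd hj id
      · exact absurd hi id
  · rintro (v | k) hi (w | l) hj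
    · obtain ⟨u, hu, hvu⟩ := hSf v hi
      have h1 : v ≠ w := by rintro rfl; exact hj hi
      have h2 : u.1 ≠ w.1 := fun h => hj (by rw [← Subtype.ext h]; exact hu)
      simp [arrowLaplacian, h1, h2, hvu]
    · obtain ⟨u, hu, hvu⟩ := hSf v hi
      simp only [Matrix.fromBlocks_apply₁₂, arrowMarks, Matrix.of_apply, ite_eq_right_iff]
      intro h
      have := hy l
      rw [← h, hvu] at this
      exact absurd this u.2
    · exact absurd hi id
    · exact absurd hi id

/-- Expansion of the bordered Laplacian determinant in the rows of the interior vertices: the row of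
a vertex is the sum of the contributions of the darts that start there. -/
theorem sum_det_bordered (y : κ → D) (hyo : ∀ l, G.IsInterior (G.org (y l)))
    (C : Matrix κ G.Interior ℝ) :
    ∑ f : G.Arrows, (Matrix.fromBlocks (arrowLaplacian f) (arrowMarks f y) C 0).det =
      (Matrix.fromBlocks G.laplacian
        (Matrix.of fun v l => if v = ⟨G.org (y l), hyo l⟩ then 1 else 0) C 0).det := by
  set F := (Matrix.detRowAlternating (R := ℝ) (n := G.Interior ⊕ κ)).toMultilinearMap.currySum
    with hF
  set g : ∀ v : G.Interior, {d : D // G.org d = v.1} → G.Interior ⊕ κ → ℝ := fun v d =>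
    Sum.elim (fun w => (if v = w then 1 else 0) - if G.head d.1 = w.1 then 1 else 0)
      (fun l => if d.1 = y l then 1 else 0) with hg
  set c : κ → G.Interior ⊕ κ → ℝ := fun k => Sum.elim (C k) 0 with hc
  have key := congrArg (fun m => m c) (F.map_sum g)
  simp only [_root_.sum_apply, hF, MultilinearMap.currySum_apply'] at key
  have e1 : ∀ f : G.Arrows, (Matrix.fromBlocks (arrowLaplacian f) (arrowMarks f y) C 0).det =
      Matrix.det (Sum.elim (fun v => g v (f v)) c : Matrix (G.Interior ⊕ κ) (G.Interior ⊕ κ) ℝ) := by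
    intro f
    congr 1
  have e2 : (Matrix.fromBlocks G.laplacian
        (Matrix.of fun v l => if v = ⟨G.org (y l), hyo l⟩ then 1 else 0) C 0).det =
      Matrix.det (Sum.elim (fun v => ∑ d, g v d) c :
        Matrix (G.Interior ⊕ κ) (G.Interior ⊕ κ) ℝ) := by
    congr 1
    ext (v | k) (w | l)
    · simp [hg, laplacian, Finset.sum_apply]
    · simp only [Matrix.fromBlocks_apply₁₂, Matrix.of_apply, Sum.elim_inl, hg, Finset.sum_apply,
        Sum.elim_inr]
      by_cases h : v = ⟨G.org (y l), hyo l⟩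
      · subst h
        rw [if_pos rfl, Finset.sum_eq_single ⟨y l, rfl⟩]
        · simp
        · intro d _ hd
          rw [if_neg]
          exact fun h => hd (Subtype.ext h)
        · simp
      · rw [if_neg h, Finset.sum_eq_zero]
        intro d _
        rw [if_neg]
        intro h'
        apply h
        apply Subtype.ext
        rw [← d.2, h']
    · rfl
    · rfl
  rw [e2, Finset.sum_congr rfl fun f _ => e1 f]
  exact key.symm

/-- The matrix-tree theorem: the empty case of the bordered expansion. -/
theorem card_acyclic : (Fintype.card {f : G.Arrows // Acyclic f} : ℝ) = G.laplacian.det := by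
  have h := sum_det_bordered (G := G) (κ := Empty) (fun l => l.elim) (fun l => l.elim) 0
  rw [Matrix.det_fromBlocks_zero₂₁, Matrix.det_isEmpty (A := (0 : Matrix Empty Empty ℝ)), mul_one]
    at h
  rw [← h, Fintype.card_subtype, ← Finset.sum_boole]
  refine Finset.sum_congr rfl fun f _ => ?_
  split_ifs with hf
  · rw [Matrix.det_fromBlocks_zero₂₁, Matrix.det_isEmpty (A := (0 : Matrix Empty Empty ℝ)), mul_one,
      det_arrowLaplacian hf]
  · rw [det_bordered_of_not_acyclic hf _ fun l => l.elim]

/-- Fomin's identity: minors of the Green's function count signed connections of branches. -/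
theorem sum_det_exitsVia (x : κ → G.Interior) (y : κ → D)
    (hyo : ∀ l, G.IsInterior (G.org (y l))) (hy : ∀ l, G.IsBoundary (G.head (y l))) :
    ∑ f : G.Arrows with Acyclic f,
        (Matrix.of fun k l => if ExitsVia f (x k) (y l) then (1 : ℝ) else 0).det =
      G.laplacian.det * (Matrix.of fun k l => G.laplacian⁻¹ (x k) ⟨G.org (y l), hyo l⟩).det := by
  have h := sum_det_bordered (G := G) y hyo (-(Matrix.of fun k v => if x k = v then 1 else 0))
  have : Invertible G.laplacian :=
    Matrix.invertibleOfIsUnitDet _ (Ne.isUnit G.laplacian_det_ne_zero)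
  rw [Matrix.det_fromBlocks₁₁, zero_sub, Matrix.neg_mul, Matrix.neg_mul, neg_neg,
    Matrix.invOf_eq_nonsing_inv] at h
  have e : (Matrix.of fun k v => if x k = v then 1 else 0 : Matrix κ G.Interior ℝ) *
      G.laplacian⁻¹ * (Matrix.of fun v l => if v = ⟨G.org (y l), hyo l⟩ then 1 else 0 :
        Matrix G.Interior κ ℝ) =
      Matrix.of fun k l => G.laplacian⁻¹ (x k) ⟨G.org (y l), hyo l⟩ := by
    ext k l
    simp only [Matrix.mul_apply, Matrix.of_apply, ite_mul, one_mul, zero_mul, mul_ite, mul_one,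
      mul_zero, Finset.sum_ite_eq, Finset.sum_ite_eq', Finset.mem_univ, if_true]
  rw [e] at h
  rw [← h, Finset.sum_filter]
  refine Finset.sum_congr rfl fun f _ => ?_
  split_ifs with hf
  · rw [det_bordered_of_acyclic hf x y hy]
  · rw [det_bordered_of_not_acyclic hf y hy]

end MatrixTree

end PlaneGraph


/-! ### Spanning trees and arrows -/

namespace PlaneGraph

variable {V D : Type*} [Fintype V] [Fintype D] {G : PlaneGraph V D}

theorem wire_eq_iff {u v : V} : G.wire u = G.wire v ↔ u = v ∨ (G.IsBoundary u ∧ G.IsBoundary v) :=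
  Quotient.eq

theorem eq_of_wire_eq {u v : V} (hu : G.IsInterior u) (h : G.wire u = G.wire v) : u = v :=
  (wire_eq_iff.1 h).resolve_right fun h' => hu h'.1

theorem arrow_congr (f : G.Arrows) {v w : G.Interior} (h : v.1 = w.1) : (f v).1 = (f w).1 := by
  rw [Subtype.ext h]

theorem isInterior_org_arrow (f : G.Arrows) (v : G.Interior) : G.IsInterior (G.org (f v).1) := by
  rw [(f v).2]
  exact v.2

/-- The dart set of the edges chosen by the arrows. -/
def treeOf (f : G.Arrows) : Set D := {d | ∃ v, d = (f v).1 ∨ G.rev d = (f v).1}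

theorem mem_treeOf_rev {f : G.Arrows} {d : D} : G.rev d ∈ treeOf f ↔ d ∈ treeOf f := by
  simp only [treeOf, Set.mem_ofPred_eq, G.rev_rev]
  exact exists_congr fun v => or_comm

theorem arrow_mem_treeOf (f : G.Arrows) (v : G.Interior) : (f v).1 ∈ treeOf f := ⟨v, Or.inl rfl⟩

/-- A height function on all vertices that vanishes on the boundary and decreases along the
arrows. -/
theorem Acyclic.exists_height {f : G.Arrows} (hf : Acyclic f) :
    ∃ ρ : V → ℕ, (∀ v, G.IsBoundary v → ρ v = 0) ∧ ∀ v, ρ (G.head (f v).1) < ρ v.1 := by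
  classical
  obtain ⟨r, hr⟩ := hf.exists_rank
  refine ⟨fun v => if h : G.IsInterior v then r ⟨v, h⟩ + 1 else 0, fun v hv => ?_, fun v => ?_⟩
  · exact dif_neg (not_not.2 hv)
  · simp only [v.2, dif_pos]
    split_ifs with h
    · have := hr v ⟨_, h⟩ rfl
      exact Nat.add_lt_add_right (by rw [this]; exact Nat.lt_succ_self _) 1
    · omega

/-- A dart of the tree is the arrow at its origin, or its reverse is the arrow at its end. -/
theorem mem_treeOf_cases {f : G.Arrows} {d : D} (h : d ∈ treeOf f) :
    (∃ hd : G.IsInterior (G.org d), d = (f ⟨G.org d, hd⟩).1) ∨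
      ∃ hd : G.IsInterior (G.head d), G.rev d = (f ⟨G.head d, hd⟩).1 := by
  obtain ⟨v, hv | hv⟩ := h
  · left
    have : G.org d = v.1 := by rw [hv, (f v).2]
    refine ⟨this ▸ v.2, ?_⟩
    exact hv.trans (arrow_congr f this.symm)
  · right
    have h' : G.head d = v.1 := by rw [← G.org_rev, hv, (f v).2]
    refine ⟨h' ▸ v.2, ?_⟩
    exact hv.trans (arrow_congr f h'.symm)

section Walks

/-- The list of darts `l` is a walk from `x` to `y` in the wired multigraph. -/
def IsWiredWalk (G : PlaneGraph V D) (y : G.WiredVertex) : G.WiredVertex → List D → Prop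
  | x, [] => x = y
  | x, d :: l => G.wire (G.org d) = x ∧ IsWiredWalk G y (G.wire (G.head d)) l

theorem IsWiredWalk.of_append {x y : G.WiredVertex} {s t : List D} {d : D}
    (h : G.IsWiredWalk y x (s ++ d :: t)) : G.IsWiredWalk y (G.wire (G.head d)) t := by
  induction s generalizing x with
  | nil => exact h.2
  | cons a s ih => exact ih h.2

/-- Walks can be shortened to walks that use no edge twice. -/
theorem IsWiredWalk.exists_pairwise {x y : G.WiredVertex} {l : List D} (h : G.IsWiredWalk y x l) :
    ∃ l' : List D, G.IsWiredWalk y x l' ∧ l' ⊆ l ∧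
      l'.Pairwise fun d d' => d ≠ d' ∧ d ≠ G.rev d' := by
  induction l generalizing x with
  | nil => exact ⟨[], h, List.Subset.refl _, List.Pairwise.nil⟩
  | cons d l ih =>
    obtain ⟨l', h1, h2, h3⟩ := ih h.2
    by_cases hd : d ∈ l'
    · obtain ⟨s, t, rfl⟩ := List.append_of_mem hd
      refine ⟨d :: t, ⟨h.1, h1.of_append⟩, fun z hz => ?_, (List.pairwise_append.1 h3).2.1⟩
      rcases List.mem_cons.1 hz with rfl | hz
      · exact List.mem_cons_self
      · exact List.mem_cons_of_mem _ (h2 (by simp [hz]))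
    by_cases hd' : G.rev d ∈ l'
    · obtain ⟨s, t, rfl⟩ := List.append_of_mem hd'
      refine ⟨t, ?_, fun z hz => List.mem_cons_of_mem _ (h2 (by simp [hz])),
        (List.pairwise_cons.1 (List.pairwise_append.1 h3).2.1).2⟩
      have := h1.of_append
      rwa [G.head_rev, h.1] at this
    · refine ⟨d :: l', ⟨h.1, h1⟩, List.cons_subset_cons d h2, List.pairwise_cons.2 ⟨?_, h3⟩⟩
      intro z hz
      refine ⟨?_, ?_⟩
      · rintro rfl
        exact hd hz
      · rintro rfl
        rw [G.rev_rev] at hd'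
        exact hd' hz

theorem exists_isWiredWalk {T : Set D} {x y : G.WiredVertex} (h : Relation.ReflTransGen
    (fun x y => ∃ d ∈ T, G.wire (G.org d) = x ∧ G.wire (G.head d) = y) x y) :
    ∃ l, G.IsWiredWalk y x l ∧ ∀ d ∈ l, d ∈ T := by
  induction h using Relation.ReflTransGen.head_induction_on with
  | refl => exact ⟨[], rfl, by simp⟩
  | head h _ ih =>
    obtain ⟨d, hd, rfl, rfl⟩ := h
    obtain ⟨l, hl, hT⟩ := ih
    refine ⟨d :: l, ⟨rfl, hl⟩, ?_⟩
    intro z hz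
    rcases List.mem_cons.1 hz with rfl | hz
    · exact hd
    · exact hT z hz

theorem IsWiredWalk.getElem {x y : G.WiredVertex} {l : List D} (h : G.IsWiredWalk y x l) (i : ℕ)
    (hi : i < l.length) :
    G.wire (G.head l[i]) = if h' : i + 1 < l.length then G.wire (G.org l[i + 1]) else y := by
  induction l generalizing x i with
  | nil => simp at hi
  | cons d l ih =>
    cases i with
    | zero =>
      cases l with
      | nil => exact h.2
      | cons d' l => simpa using h.2.1.symm
    | succ i =>
      have := ih h.2 i (by simpa using hi)
      simpa using this

/-- A spanning tree is a maximal set of edges without cycles. -/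
theorem IsWiredSpanningTree.eq_of_subset {T T' : Set D} (h : G.IsWiredSpanningTree T)
    (h' : G.IsWiredSpanningTree T') (hT : T' ⊆ T) : T' = T := by
  refine Set.Subset.antisymm hT fun d hd => ?_
  by_contra hd'
  obtain ⟨l₀, hl₀, hmem⟩ := exists_isWiredWalk (h'.2.1 (G.wire (G.head d)) (G.wire (G.org d)))
  obtain ⟨l, hl, hsub, hpw⟩ := hl₀.exists_pairwise
  have hw : G.IsWiredWalk (G.wire (G.org d)) (G.wire (G.org d)) (d :: l) := ⟨rfl, hl⟩
  have hpw' : (d :: l).Pairwise fun d d' => d ≠ d' ∧ d ≠ G.rev d' := by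
    refine List.pairwise_cons.2 ⟨fun z hz => ⟨?_, ?_⟩, hpw⟩
    · rintro rfl
      exact hd' (hmem _ (hsub hz))
    · rintro rfl
      exact hd' ((h'.1 z).1 (hmem _ (hsub hz)))
  refine h.2.2 ⟨l.length, fun i => (d :: l)[i.val], fun i => ?_, fun i => ?_, fun i i' hii => ?_⟩
  · rcases List.mem_cons.1 (List.getElem_mem (l := d :: l) (n := i.val) i.2) with h | h
    · have hm : (d :: l)[i.val] ∈ T := by
        rw [h]
        exact hd
      exact hm
    · exact hT (hmem _ (hsub h))
  · have := hw.getElem i.val i.2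
    rw [this]
    induction i using Fin.lastCases with
    | last => simp
    | cast j => simp
  · rw [List.pairwise_iff_getElem] at hpw'
    rcases lt_or_gt_of_ne hii with hlt | hlt
    · exact hpw' _ _ i.2 i'.2 hlt
    · obtain ⟨h1, h2⟩ := hpw' _ _ i'.2 i.2 hlt
      refine ⟨h1.symm, fun h3 => h2 ?_⟩
      have h4 : (d :: l)[i.val] = G.rev (d :: l)[i'.val] := h3
      rw [h4, G.rev_rev]

end Walks

theorem Acyclic.isWiredSpanningTree {f : G.Arrows} (hf : Acyclic f) :
    G.IsWiredSpanningTree (treeOf f) := by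
  obtain ⟨ρ, hρ0, hρ⟩ := hf.exists_height
  have hρw : ∀ u v, G.wire u = G.wire v → ρ u = ρ v := by
    intro u v h
    rcases wire_eq_iff.1 h with rfl | ⟨h1, h2⟩
    · rfl
    · rw [hρ0 _ h1, hρ0 _ h2]
  refine ⟨fun d => mem_treeOf_rev.symm, ?_, ?_⟩
  · have key : ∀ v : V, Relation.ReflTransGen
        (fun x y => ∃ d ∈ treeOf f, G.wire (G.org d) = x ∧ G.wire (G.head d) = y)
        (G.wire v) (G.wire (G.org G.outer)) := by
      intro v
      induction h : ρ v using Nat.strong_induction_on generalizing v with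
      | _ n ih =>
        by_cases hv : G.IsInterior v
        · refine Relation.ReflTransGen.head
            ⟨_, arrow_mem_treeOf f ⟨v, hv⟩, by rw [(f ⟨v, hv⟩).2], rfl⟩
            (ih _ (h ▸ hρ ⟨v, hv⟩) _ rfl)
        · rw [wire_eq_iff.2 (Or.inr ⟨G.not_isInterior_iff.1 hv, G.isBoundary_org_outer⟩)]
    have hsymm : Std.Symm
        (fun x y => ∃ d ∈ treeOf f, G.wire (G.org d) = x ∧ G.wire (G.head d) = y) := by
      refine ⟨?_⟩
      rintro x y ⟨d, hd, rfl, rfl⟩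
      exact ⟨G.rev d, mem_treeOf_rev.2 hd, rfl, by rw [G.head_rev]⟩
    intro x y
    induction x using Quotient.inductionOn with | _ u =>
    induction y using Quotient.inductionOn with | _ v =>
    exact (key u).trans (Relation.ReflTransGen.stdSymm.symm _ _ (key v))
  · -- at a highest vertex of a cycle, both edges of the cycle would be the arrow of this vertex
    rintro ⟨n, c, hc, hcc, hne⟩
    obtain ⟨i, -, hi⟩ := Finset.exists_max_image Finset.univ (fun i => ρ (G.org (c i)))
      ⟨0, Finset.mem_univ _⟩
    have hi' : ∀ j, ρ (G.org (c j)) ≤ ρ (G.org (c i)) := fun j => hi j (Finset.mem_univ _)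
    have hfwd : ∃ hd : G.IsInterior (G.org (c i)), c i = (f ⟨G.org (c i), hd⟩).1 := by
      refine (mem_treeOf_cases (hc i)).resolve_right ?_
      rintro ⟨hd, h⟩
      have h1 := hρ ⟨G.head (c i), hd⟩
      rw [← h, G.head_rev] at h1
      have h2 := hi' (i + 1)
      rw [← hρw _ _ (hcc i)] at h2
      exact absurd h1 (not_lt.2 h2)
    obtain ⟨hint, hfi⟩ := hfwd
    have hw := hcc (i - 1)
    rw [sub_add_cancel] at hw
    have hw' : G.head (c (i - 1)) = G.org (c i) := (eq_of_wire_eq hint hw.symm).symm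
    rcases mem_treeOf_cases (hc (i - 1)) with ⟨hd, h⟩ | ⟨hd, h⟩
    · have h1 := hρ ⟨_, hd⟩
      rw [← h, hw'] at h1
      exact absurd h1 (not_lt.2 (hi' _))
    · have h1 : G.rev (c (i - 1)) = c i := by
        rw [h, hfi]
        exact arrow_congr f hw'
      by_cases h2 : i = i - 1
      · rw [← h2] at h1
        exact G.rev_ne _ h1
      · exact (hne _ _ h2).2 h1.symm

theorem Acyclic.treeOf_injective {f g : G.Arrows} (hf : Acyclic f)
    (h : treeOf f = treeOf g) : f = g := by
  obtain ⟨ρ, -, hρ⟩ := hf.exists_height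
  have key : ∀ v : G.Interior, f v = g v := by
    intro v
    induction hn : ρ v.1 using Nat.strong_induction_on generalizing v with
    | _ n ih =>
      have hmem := arrow_mem_treeOf f v
      rw [h] at hmem
      apply Subtype.ext
      rcases mem_treeOf_cases hmem with ⟨hd, h1⟩ | ⟨hd, h1⟩
      · rw [h1]
        exact arrow_congr g (f v).2
      · have h2 := ih _ (hn ▸ hρ v) ⟨_, hd⟩ rfl
        rw [← h2] at h1
        have h3 := hρ ⟨_, hd⟩
        rw [← h1, G.head_rev, (f v).2] at h3
        exact absurd h3 (not_lt.2 (hρ v).le)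
  exact funext key

theorem IsWiredSpanningTree.exists_arrows {T : Set D} (hT : G.IsWiredSpanningTree T) :
    ∃ f : G.Arrows, Acyclic f ∧ treeOf f = T := by
  classical
  set b := G.wire (G.org G.outer) with hb
  -- the distance to the boundary within `T`
  have hex : ∀ x : G.WiredVertex, ∃ n l, G.IsWiredWalk b x l ∧ (∀ d ∈ l, d ∈ T) ∧ l.length = n := by
    intro x
    obtain ⟨l, h1, h2⟩ := exists_isWiredWalk (hT.2.1 x b)
    exact ⟨_, l, h1, h2, rfl⟩
  have hstep : ∀ v : G.Interior, ∃ d : {d // G.org d = v.1}, d.1 ∈ T ∧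
      Nat.find (hex (G.wire (G.head d.1))) < Nat.find (hex (G.wire v.1)) := by
    intro v
    obtain ⟨l, h1, h2, h3⟩ := Nat.find_spec (hex (G.wire v.1))
    cases l with
    | nil =>
      have h4 : G.wire v.1 = b := h1
      have h5 := eq_of_wire_eq v.2 h4
      exact absurd (h5 ▸ G.isBoundary_org_outer) v.2
    | cons d l =>
      refine ⟨⟨d, (eq_of_wire_eq v.2 h1.1.symm).symm⟩, h2 d List.mem_cons_self, ?_⟩
      rw [← h3]
      exact lt_of_le_of_lt (Nat.find_min' _
        ⟨l, h1.2, fun z hz => h2 z (List.mem_cons_of_mem _ hz), rfl⟩) (by simp)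
  choose f hfT hf using hstep
  have hac : Acyclic f := by
    refine acyclic_of_rank (fun v => Nat.find (hex (G.wire v.1))) fun v w h => ?_
    have := hf v
    simpa only [h] using this
  refine ⟨f, hac, hT.eq_of_subset hac.isWiredSpanningTree ?_⟩
  rintro d ⟨v, h | h⟩
  · rw [h]
    exact hfT v
  · rw [hT.1, h]
    exact hfT v

/-- The boundary branches in the tree of acyclic arrows follow the arrows. -/
theorem Acyclic.branchVia_iff {f : G.Arrows} (hf : Acyclic f) (v : G.Interior) (d : D) :
    G.BranchVia (treeOf f) v.1 d ↔ ExitsVia f v d := by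
  constructor
  · rintro ⟨l, hl, hd⟩
    have key : ∀ (l : List D) (v : G.Interior), G.IsBoundaryBranch (treeOf f) v.1 l →
        l.getLast? = some d → l.head? = some (f v).1 ∧ ExitsVia f v d := by
      intro l
      induction l with
      | nil => intro v _ h; simp at h
      | cons x t ih =>
        intro v hl hd
        obtain ⟨h1, h2, h3, h4, h5⟩ := hl
        have hxv : G.org x = v.1 := by simpa using h2
        have hx := h1 x List.mem_cons_self
        cases t with
        | nil =>
          obtain rfl : x = d := by simpa using hd
          have hbd : G.IsBoundary (G.head x) := by simpa using h5
          rcases mem_treeOf_cases hx.1 with ⟨hi, h⟩ | ⟨hi, -⟩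
          · have hxf : x = (f v).1 := h.trans (arrow_congr f hxv)
            rw [exitsVia_iff_of_boundary (hxf ▸ hbd)]
            exact ⟨by simp [← hxf], hxf⟩
          · exact absurd hbd hi
        | cons x' t =>
          have hx' := h1 x' (by simp)
          have hcon : G.head x = G.org x' := (List.isChain_cons_cons.1 h3).1
          have hbr : G.IsBoundaryBranch (treeOf f) (G.org x') (x' :: t) := by
            refine ⟨fun z hz => h1 z (List.mem_cons_of_mem _ hz), rfl,
              (List.isChain_cons_cons.1 h3).2, ?_, ?_⟩
            · rw [List.map_cons] at h4
              exact (List.nodup_cons.1 h4).2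
            · simpa [List.getLast?_cons_cons] using h5
          obtain ⟨ih1, ih2⟩ := ih ⟨G.org x', hx'.2⟩ hbr (by simpa [List.getLast?_cons_cons] using hd)
          have hx'f : x' = (f ⟨G.org x', hx'.2⟩).1 := by simpa using ih1
          rcases mem_treeOf_cases hx.1 with ⟨hi, h⟩ | ⟨hi, h⟩
          · have hxf : x = (f v).1 := h.trans (arrow_congr f hxv)
            refine ⟨by simp [← hxf], ?_⟩
            rwa [exitsVia_iff_of_interior (w := ⟨G.org x', hx'.2⟩) (by rw [← hxf]; exact hcon)]
          · -- the branch cannot go back along the same edge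
            exfalso
            have hrev : x' = G.rev x := by
              rw [h, hx'f]
              exact arrow_congr f hcon.symm
            have hback : G.head x' = G.org x := by rw [hrev, G.head_rev]
            cases t with
            | nil =>
              have hbd : G.IsBoundary (G.head x') := by simpa using h5
              rw [hback] at hbd
              exact hx.2 hbd
            | cons x'' t =>
              have h6 : G.head x' = G.org x'' :=
                (List.isChain_cons_cons.1 (List.isChain_cons_cons.1 h3).2).1
              rw [hback] at h6
              simp [h6] at h4
    exact (key l v hl hd).2
  · obtain ⟨ρ, -, hρ⟩ := hf.exists_height
    rintro ⟨n, hn⟩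
    suffices h : ∃ l, G.IsBoundaryBranch (treeOf f) v.1 l ∧ l.getLast? = some d ∧
        ∀ x ∈ l, ρ (G.org x) ≤ ρ v.1 by
      obtain ⟨l, h1, h2, -⟩ := h
      exact ⟨l, h1, h2⟩
    induction hn with
    | @last v h =>
      refine ⟨[(f v).1], ⟨?_, ?_, ?_, ?_, ?_⟩, rfl, ?_⟩
      · intro x hx
        rw [List.mem_singleton.1 hx]
        exact ⟨arrow_mem_treeOf f v, isInterior_org_arrow f v⟩
      · simp [(f v).2]
      · simp
      · simp
      · simpa using h
      · simp [(f v).2]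
    | @step n v w d h _ ih =>
      obtain ⟨l, ⟨h1, h2, h3, h4, h5⟩, h6, h7⟩ := ih
      have hlt : ρ w.1 < ρ v.1 := by rw [← h]; exact hρ v
      cases l with
      | nil => simp at h2
      | cons y t =>
      have hy : G.org y = w.1 := by simpa using h2
      refine ⟨(f v).1 :: y :: t, ⟨?_, ?_, ?_, ?_, ?_⟩, ?_, ?_⟩
      · intro x hx
        rcases List.mem_cons.1 hx with rfl | hx
        · exact ⟨arrow_mem_treeOf f v, isInterior_org_arrow f v⟩
        · exact h1 x hx
      · simp [(f v).2]
      · exact List.isChain_cons_cons.2 ⟨by rw [h, hy], h3⟩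
      · rw [List.map_cons, List.nodup_cons]
        refine ⟨fun hmem => ?_, h4⟩
        obtain ⟨x, hx, hxv⟩ := List.mem_map.1 hmem
        have := h7 x hx
        rw [hxv, (f v).2] at this
        omega
      · simpa [List.getLast?_cons_cons] using h5
      · simpa [List.getLast?_cons_cons] using h6
      · intro x hx
        rcases List.mem_cons.1 hx with rfl | hx
        · rw [(f v).2]
        · exact (h7 x hx).trans hlt.le

/-- Wired spanning trees correspond to acyclic arrows. -/
theorem ncard_isWiredSpanningTree (p : Set D → Prop) :
    {T : Set D | G.IsWiredSpanningTree T ∧ p T}.ncard =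
      {f : G.Arrows | Acyclic f ∧ p (treeOf f)}.ncard := by
  symm
  refine Set.ncard_congr (fun f _ => treeOf f) (fun f hf => ⟨hf.1.isWiredSpanningTree, hf.2⟩)
    (fun f g hf _ h => hf.1.treeOf_injective h) ?_
  rintro T ⟨hT, hp⟩
  obtain ⟨f, hf, rfl⟩ := hT.exists_arrows
  exact ⟨f, ⟨hf, hp⟩, rfl⟩

theorem connProb_eq {N : ℕ} (e : Fin (2 * N) → D) (he : ∀ a, G.IsInterior (G.org (e a)))
    (α : LinkPattern N) :
    G.connProb e α =
      ({f : G.Arrows | Acyclic f ∧ ∀ a : Fin (2 * N), Even a.val →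
        Odd (α.partner a).val ∧ ExitsVia f ⟨G.org (e a), he a⟩ (e (α.partner a))}.ncard : ℝ) /
      ({f : G.Arrows | Acyclic f}.ncard : ℝ) := by
  unfold connProb
  rw [ncard_isWiredSpanningTree]
  have h := ncard_isWiredSpanningTree (G := G) fun _ => True
  simp only [and_true] at h
  rw [h]
  congr 3
  ext f
  simp only [Set.mem_ofPred_eq]
  refine and_congr_right fun hf => ?_
  unfold Conn
  refine forall_congr' fun a => forall_congr' fun _ => and_congr_right fun _ => ?_
  exact hf.branchVia_iff ⟨_, he a⟩ _

end PlaneGraph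


/-! ### Reversal of branches -/

namespace PlaneGraph

variable {V D : Type*} [Fintype V] [Fintype D] {G : PlaneGraph V D}

/-- The vertex `w` is on the path that follows the arrows from `v`. -/
def OnBranch (f : G.Arrows) : G.Interior → G.Interior → Prop :=
  Relation.ReflTransGen fun y z => G.head (f y).1 = z.1

theorem OnBranch.exitsVia_iff {f : G.Arrows} {v w : G.Interior} (h : OnBranch f v w) {d : D} :
    ExitsVia f v d ↔ ExitsVia f w d := by
  induction h with
  | refl => rfl
  | tail _ h ih => rw [ih, exitsVia_iff_of_interior h]

theorem ExitsVia.exists_onBranch {f : G.Arrows} {v : G.Interior} {d : D} (h : ExitsVia f v d) :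
    ∃ u, OnBranch f v u ∧ (f u).1 = d ∧ G.IsBoundary (G.head d) := by
  obtain ⟨n, hn⟩ := h
  induction hn with
  | last h => exact ⟨_, Relation.ReflTransGen.refl, rfl, h⟩
  | step h _ ih =>
    obtain ⟨u, h1, h2⟩ := ih
    exact ⟨u, Relation.ReflTransGen.head h h1, h2⟩

/-- The last vertex of a branch is the origin of the dart through which the branch exits. -/
theorem ExitsVia.onBranch_org {f : G.Arrows} {v : G.Interior} {d : D} (h : ExitsVia f v d)
    (hd : G.IsInterior (G.org d)) : OnBranch f v ⟨G.org d, hd⟩ ∧ (f ⟨G.org d, hd⟩).1 = d := by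
  obtain ⟨u, h1, h2, -⟩ := h.exists_onBranch
  have h3 : u = ⟨G.org d, hd⟩ := Subtype.ext ((f u).2.symm.trans (congrArg G.org h2))
  rw [← h3]
  exact ⟨h1, h2⟩

/-- Two vertices on the same branch are comparable. -/
theorem OnBranch.total {f : G.Arrows} {v y z : G.Interior} (hy : OnBranch f v y)
    (hz : OnBranch f v z) : OnBranch f y z ∨ OnBranch f z y := by
  refine Relation.ReflTransGen.total_of_right_unique ?_ hy hz
  intro a b c hb hc
  exact Subtype.ext (hb.symm.trans hc)

theorem OnBranch.rank_le {f : G.Arrows} {r : G.Interior → ℕ}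
    (hr : ∀ v w, G.head (f v).1 = w.1 → r v = r w + 1) {v w : G.Interior} (h : OnBranch f v w) :
    r w ≤ r v := by
  induction h with
  | refl => exact le_rfl
  | tail _ h ih =>
    have := hr _ _ h
    omega

theorem OnBranch.eq_of_rank_eq {f : G.Arrows} {r : G.Interior → ℕ}
    (hr : ∀ v w, G.head (f v).1 = w.1 → r v = r w + 1) {v w : G.Interior} (h : OnBranch f v w)
    (hvw : r v = r w) : v = w := by
  rcases Relation.ReflTransGen.cases_head h with rfl | ⟨u, h1, h2⟩
  · rfl
  · have h3 := hr _ _ h1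
    have h4 := OnBranch.rank_le hr h2
    omega

/-- A vertex of a branch, other than its first one, has only one predecessor on the branch. -/
theorem OnBranch.pred_unique {f : G.Arrows} (hf : Acyclic f) {v y y' z : G.Interior}
    (hy : OnBranch f v y) (hy' : OnBranch f v y') (h : G.head (f y).1 = z.1)
    (h' : G.head (f y').1 = z.1) : y = y' := by
  obtain ⟨r, hr⟩ := hf.exists_rank
  have e : r y = r y' := by rw [hr _ _ h, hr _ _ h']
  rcases hy.total hy' with h1 | h1
  · exact h1.eq_of_rank_eq hr e
  · exact (h1.eq_of_rank_eq hr e.symm).symm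

/-- The arrows `f'` are obtained from `f` by reversing the branch from `v`: the arrow at `v` becomes
`x`, and the arrow at every other vertex of the branch points back to its predecessor. -/
structure IsReversal (f : G.Arrows) (v : G.Interior) (x : D) (f' : G.Arrows) : Prop where
  start : (f' v).1 = x
  pred : ∀ y z : G.Interior, OnBranch f v y → G.head (f y).1 = z.1 → (f' z).1 = G.rev (f y).1
  off : ∀ z, ¬ OnBranch f v z → f' z = f z

theorem onBranch_cases {f : G.Arrows} {v z : G.Interior} (h : OnBranch f v z) :
    z = v ∨ ∃ y, OnBranch f v y ∧ G.head (f y).1 = z.1 := by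
  rcases Relation.ReflTransGen.cases_tail h with h | h
  · exact Or.inl h
  · exact Or.inr h

theorem IsReversal.unique {f f₁ f₂ : G.Arrows} {v : G.Interior} {x : D}
    (h₁ : IsReversal f v x f₁) (h₂ : IsReversal f v x f₂) : f₁ = f₂ := by
  funext z
  by_cases hz : OnBranch f v z
  · apply Subtype.ext
    rcases onBranch_cases hz with rfl | ⟨y, hy, hyz⟩
    · rw [h₁.start, h₂.start]
    · rw [h₁.pred y z hy hyz, h₂.pred y z hy hyz]
  · rw [h₁.off z hz, h₂.off z hz]

theorem Acyclic.exists_isReversal {f : G.Arrows} (hf : Acyclic f) {x : D}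
    (hx : G.IsInterior (G.org x)) : ∃ f', IsReversal f ⟨G.org x, hx⟩ x f' := by
  classical
  obtain ⟨r, hr⟩ := hf.exists_rank
  set v : G.Interior := ⟨G.org x, hx⟩ with hv
  have hex : ∀ z : G.Interior, ∃ d : {d : D // G.org d = z.1}, (z = v → d.1 = x) ∧
      (∀ y, OnBranch f v y → G.head (f y).1 = z.1 → d.1 = G.rev (f y).1) ∧
      (¬ OnBranch f v z → d = f z) := by
    intro z
    by_cases hz : OnBranch f v z
    · rcases onBranch_cases hz with rfl | ⟨y, hy, hyz⟩
      · refine ⟨⟨x, rfl⟩, fun _ => rfl, fun y hy hyz => ?_, fun h => absurd hz h⟩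
        have h1 := hy.rank_le hr
        have h2 := hr _ _ hyz
        omega
      · refine ⟨⟨G.rev (f y).1, hyz⟩, ?_, fun y' hy' hyz' => ?_, fun h => absurd hz h⟩
        · rintro rfl
          have h1 := hy.rank_le hr
          have h2 := hr _ _ hyz
          omega
        · exact congrArg (fun u => G.rev (f u).1) (hy.pred_unique hf hy' hyz hyz')
    · refine ⟨f z, ?_, fun y hy hyz => absurd (Relation.ReflTransGen.tail hy hyz) hz, fun _ => rfl⟩
      rintro rfl
      exact absurd Relation.ReflTransGen.refl hz
  choose f' h1 h2 h3 using hex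
  exact ⟨f', h1 v rfl, fun y z hy hyz => h2 z y hy hyz, h3⟩

namespace IsReversal

variable {f f' : G.Arrows} {v : G.Interior} {x : D}

theorem acyclic (h : IsReversal f v x f') (hf : Acyclic f) (hx : G.IsBoundary (G.head x)) :
    Acyclic f' := by
  classical
  obtain ⟨r, hr⟩ := hf.exists_rank
  refine acyclic_of_rank (fun z => if OnBranch f v z then r v - r z else r z + r v + 1) ?_
  intro z w hzw
  by_cases hz : OnBranch f v z
  · rcases onBranch_cases hz with rfl | ⟨y, hy, hyz⟩
    · rw [h.start] at hzw
      rw [hzw] at hx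
      exact absurd hx w.2
    · rw [h.pred y z hy hyz, G.head_rev, (f y).2] at hzw
      obtain rfl : y = w := Subtype.ext hzw
      simp only [hy, hz, if_true]
      have h1 := hy.rank_le hr
      have h2 := hr _ _ hyz
      omega
  · rw [h.off z hz] at hzw
    simp only [hz, if_false]
    have h1 := hr _ _ hzw
    split_ifs <;> omega

theorem exitsVia (h : IsReversal f v x f') (hx : G.IsBoundary (G.head x)) {z : G.Interior}
    (hz : OnBranch f v z) : ExitsVia f' z x := by
  induction hz with
  | refl =>
    have h1 := h.start
    rw [exitsVia_iff_of_boundary (by rwa [h1])]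
    exact h1.symm
  | @tail y z hy hyz ih =>
    have h1 := h.pred y z hy hyz
    rwa [exitsVia_iff_of_interior (w := y) (by rw [h1, G.head_rev, (f y).2])]

theorem exitsVia_of_ne (h : IsReversal f v x f') {d d' : D} (hd : ExitsVia f v d)
    {w : G.Interior} (hw : ExitsVia f w d') (hne : d' ≠ d) : ExitsVia f' w d' := by
  obtain ⟨n, hn⟩ := hw
  have hoff : ∀ {n z}, Via f n z d' → f' z = f z := by
    intro n z hz
    refine h.off z fun hb => hne ?_
    exact ExitsVia.unique ⟨n, hz⟩ (hb.exitsVia_iff.1 hd)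
  induction hn with
  | last hb =>
    have h1 := hoff (Via.last hb)
    rw [exitsVia_iff_of_boundary (by rwa [h1]), h1]
  | step hb hw ih =>
    have h1 := hoff (Via.step hb hw)
    rw [exitsVia_iff_of_interior (by rw [h1]; exact hb)]
    exact ih hne hoff

/-- Reversing the reversed branch gives back the original arrows. -/
theorem symm (h : IsReversal f v x f') (hx : G.IsBoundary (G.head x)) {d : D}
    (hd : ExitsVia f v d) (hdi : G.IsInterior (G.org d)) :
    IsReversal f' ⟨G.org d, hdi⟩ d f := by
  obtain ⟨hu, hfu⟩ := hd.onBranch_org hdi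
  have hback : ∀ z, OnBranch f' ⟨G.org d, hdi⟩ z →
      OnBranch f v z ∧ ∀ w : G.Interior, G.head (f' z).1 = w.1 →
        OnBranch f v w ∧ G.head (f w).1 = z.1 ∧ (f' z).1 = G.rev (f w).1 := by
    intro z hz
    have key : ∀ z, OnBranch f v z → ∀ w : G.Interior, G.head (f' z).1 = w.1 →
        OnBranch f v w ∧ G.head (f w).1 = z.1 ∧ (f' z).1 = G.rev (f w).1 := by
      intro z hz w hw
      rcases onBranch_cases hz with rfl | ⟨y, hy, hyz⟩
      · rw [h.start] at hw
        rw [hw] at hx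
        exact absurd hx w.2
      · have h1 := h.pred y z hy hyz
        rw [h1, G.head_rev, (f y).2] at hw
        obtain rfl : y = w := Subtype.ext hw
        exact ⟨hy, hyz, h1⟩
    have hz' : OnBranch f v z := by
      induction hz with
      | refl => exact hu
      | tail _ hyz ih => exact (key _ ih _ hyz).1
    exact ⟨hz', key z hz'⟩
  have hfwd : ∀ z, OnBranch f v z → OnBranch f' ⟨G.org d, hdi⟩ z := by
    intro z hz
    obtain ⟨hzu, -⟩ := (hz.exitsVia_iff.1 hd).onBranch_org hdi
    clear hback
    induction hzu using Relation.ReflTransGen.head_induction_on with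
    | refl => exact Relation.ReflTransGen.refl
    | @head y z hyz _ ih =>
      refine Relation.ReflTransGen.tail (ih (Relation.ReflTransGen.tail hz hyz)) ?_
      rw [h.pred y z hz hyz, G.head_rev, (f y).2]
  refine ⟨hfu, fun y z hy hyz => ?_, fun z hz => ?_⟩
  · rw [((hback y hy).2 z hyz).2.2, G.rev_rev]
  · exact (h.off z fun h' => hz (hfwd z h')).symm

end IsReversal

theorem ncard_le_of_reversal {ι : Type*} {x d : D} (hx : G.IsInterior (G.org x))
    (hx' : G.IsBoundary (G.head x)) (hd : G.IsInterior (G.org d)) (w : ι → G.Interior) (y : ι → D)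
    (hy : ∀ i, y i ≠ d) :
    {f : G.Arrows | Acyclic f ∧ ExitsVia f ⟨G.org x, hx⟩ d ∧ ∀ i, ExitsVia f (w i) (y i)}.ncard ≤
      {f : G.Arrows | Acyclic f ∧ ExitsVia f ⟨G.org d, hd⟩ x ∧ ∀ i, ExitsVia f (w i) (y i)}.ncard
      := by
  have hex : ∀ f : G.Arrows, ∃ f', Acyclic f → IsReversal f ⟨G.org x, hx⟩ x f' := by
    intro f
    by_cases hf : Acyclic f
    · obtain ⟨f', hf'⟩ := hf.exists_isReversal hx
      exact ⟨f', fun _ => hf'⟩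
    · exact ⟨f, fun h => absurd h hf⟩
  choose R hR using hex
  refine Set.ncard_le_ncard_of_injOn R ?_ ?_
  · rintro f ⟨hf, hfd, hfw⟩
    have hr := hR f hf
    refine ⟨hr.acyclic hf hx', hr.exitsVia hx' (hfd.onBranch_org hd).1, fun i => ?_⟩
    exact hr.exitsVia_of_ne hfd (hfw i) (hy i)
  · rintro f ⟨hf, hfd, -⟩ g ⟨hg, hgd, -⟩ h
    have h1 := (hR f hf).symm hx' hfd hd
    have h2 := (hR g hg).symm hx' hgd hd
    rw [h] at h1
    exact h1.unique h2

/-- Reversal of a branch preserves the number of acyclic arrows for which other branches have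
prescribed exits. -/
theorem ncard_reversal {ι : Type*} {x d : D} (hx : G.IsInterior (G.org x))
    (hx' : G.IsBoundary (G.head x)) (hd : G.IsInterior (G.org d)) (hd' : G.IsBoundary (G.head d))
    (w : ι → G.Interior) (y : ι → D) (hyx : ∀ i, y i ≠ x) (hyd : ∀ i, y i ≠ d) :
    {f : G.Arrows | Acyclic f ∧ ExitsVia f ⟨G.org x, hx⟩ d ∧ ∀ i, ExitsVia f (w i) (y i)}.ncard =
      {f : G.Arrows | Acyclic f ∧ ExitsVia f ⟨G.org d, hd⟩ x ∧ ∀ i, ExitsVia f (w i) (y i)}.ncard :=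
  le_antisymm (ncard_le_of_reversal hx hx' hd w y hyd) (ncard_le_of_reversal hd hd' hx w y hyx)

end PlaneGraph


/-! ### Flows on a plane graph -/

namespace PlaneGraph

variable {V D : Type*} [Fintype V] [Fintype D] (G : PlaneGraph V D)

theorem faceNext_rev (d : D) : G.faceNext (G.rev d) = G.rot d := by
  simp [faceNext, G.rev_rev]

theorem org_rot (d : D) : G.org (G.rot d) = G.org d :=
  (G.org_eq_iff _ _).2 (Equiv.Perm.sameCycle_apply_left.2 (Equiv.Perm.SameCycle.refl _ _))

theorem org_faceNext (d : D) : G.org (G.faceNext d) = G.head d := G.org_rot (G.rev d)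

theorem eq_of_sameCycle {X : Type*} {f : Equiv.Perm D} {S : D → X} (hS : ∀ d, S (f d) = S d)
    {d d' : D} (h : f.SameCycle d d') : S d = S d' := by
  obtain ⟨n, rfl⟩ := h.exists_nat_pow_eq
  induction n with
  | zero => rfl
  | succ n ih => rw [pow_succ', Equiv.Perm.mul_apply, hS, ← ih ⟨n, by simp⟩]

/-- A function of the darts that is invariant under the reversal and the rotation is constant. -/
theorem eq_of_rev_of_rot {X : Type*} {S : D → X} (h1 : ∀ d, S (G.rev d) = S d)
    (h2 : ∀ d, S (G.rot d) = S d) (d d' : D) : S d' = S d := by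
  have key : ∀ y, Relation.ReflTransGen (fun x y => ∃ d, G.org d = x ∧ G.org (G.rev d) = y)
      (G.org d) y → ∀ d', G.org d' = y → S d' = S d := by
    intro y hy
    induction hy with
    | refl => exact fun d' hd' => eq_of_sameCycle h2 ((G.org_eq_iff _ _).1 hd')
    | tail _ hxy ih =>
      obtain ⟨t, rfl, rfl⟩ := hxy
      intro d' hd'
      rw [eq_of_sameCycle h2 ((G.org_eq_iff _ _).1 hd'), h1, ih t rfl]
  exact key _ (G.connected _ _) d' rfl

/-- The faces of the embedding. -/
abbrev Face : Type _ := Quotient (Equiv.Perm.SameCycle.setoid (G.rot * G.rev))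

/-- The face on the right-hand side of a dart. -/
def face (d : D) : G.Face := Quotient.mk _ d

theorem face_faceNext (d : D) : G.face (G.faceNext d) = G.face d :=
  Quotient.sound (Equiv.Perm.sameCycle_apply_left.2 (Equiv.Perm.SameCycle.refl _ _))

theorem face_rev (d : D) : G.face (G.rev d) = G.face (G.rot d) := by
  rw [← G.face_faceNext (G.rev d), faceNext_rev]

section Potential

open scoped Classical

/-- The flows: antisymmetric functions of the darts. -/
def flows : Submodule ℝ (D → ℝ) where
  carrier := {z | ∀ d, z (G.rev d) = -z d}
  add_mem' h h' d := by simp [h d, h' d, add_comm]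
  zero_mem' d := by simp
  smul_mem' c z h d := by simp [h d]

/-- The total flow out of a vertex. -/
noncomputable def outflow (z : D → ℝ) (v : V) : ℝ := ∑ d with G.org d = v, z d

/-- The flows without sources and sinks. -/
noncomputable def closedFlows : Submodule ℝ (D → ℝ) where
  carrier := {z | z ∈ G.flows ∧ ∀ v, G.outflow z v = 0}
  add_mem' h h' := ⟨add_mem h.1 h'.1, fun v => by
    have h1 := h.2 v
    have h2 := h'.2 v
    simp only [outflow, Pi.add_apply, Finset.sum_add_distrib] at h1 h2 ⊢
    rw [h1, h2, add_zero]⟩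
  zero_mem' := ⟨zero_mem _, fun v => by simp [outflow]⟩
  smul_mem' c z h := ⟨Submodule.smul_mem _ c h.1, fun v => by
    have h1 := h.2 v
    simp only [outflow, Pi.smul_apply, smul_eq_mul, ← Finset.mul_sum] at h1 ⊢
    rw [h1, mul_zero]⟩

/-- The differences of a function on the vertices along the darts. -/
def vertexDiff : (V → ℝ) →ₗ[ℝ] (D → ℝ) :=
  LinearMap.funLeft ℝ ℝ G.org - LinearMap.funLeft ℝ ℝ G.head

/-- The differences of a function on the faces across the darts. -/
def faceDiff : (G.Face → ℝ) →ₗ[ℝ] (D → ℝ) :=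
  LinearMap.funLeft ℝ ℝ G.face - LinearMap.funLeft ℝ ℝ fun d => G.face (G.rev d)

theorem vertexDiff_apply (u : V → ℝ) (d : D) :
    G.vertexDiff u d = u (G.org d) - u (G.head d) := rfl

theorem faceDiff_apply (S : G.Face → ℝ) (d : D) :
    G.faceDiff S d = S (G.face d) - S (G.face (G.rev d)) := rfl

theorem two_mul_finrank_flows_le : 2 * Module.finrank ℝ G.flows ≤ Fintype.card D := by
  -- a flow is determined by its values on one dart of every edge
  set i := Fintype.equivFin D with hi
  set P := Finset.univ.filter fun d : D => i d < i (G.rev d) with hP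
  have hne : ∀ d, i d ≠ i (G.rev d) := fun d h => G.rev_ne d (i.injective h).symm
  have h1 : Module.finrank ℝ G.flows ≤ P.card := by
    have hle := LinearMap.finrank_le_finrank_of_injective
      (f := (LinearMap.funLeft ℝ ℝ fun d : P => d.1) ∘ₗ G.flows.subtype) ?_
    · simpa using hle
    · rw [← LinearMap.ker_eq_bot, LinearMap.ker_eq_bot']
      intro z hz
      apply Subtype.ext
      funext d
      have hz' : ∀ d ∈ P, z.1 d = 0 := fun d hd => congrFun hz ⟨d, hd⟩
      rcases lt_or_gt_of_ne (hne d) with h | h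
      · exact hz' d (by simp [hP, h])
      · have h1 := hz' (G.rev d) (by simp [hP, G.rev_rev, h])
        rw [z.2 d] at h1
        simpa using h1
  have h2 : P.card = (Finset.univ.filter fun d : D => ¬ i d < i (G.rev d)).card := by
    refine Finset.card_bij (fun d _ => G.rev d) ?_ (fun _ _ _ _ h => G.rev.injective h) ?_
    · intro d hd
      simp only [hP, Finset.mem_filter, Finset.mem_univ, true_and, G.rev_rev] at hd ⊢
      exact not_lt.2 hd.le
    · intro d hd
      simp only [Finset.mem_filter, Finset.mem_univ, true_and, not_lt] at hd
      refine ⟨G.rev d, ?_, G.rev_rev d⟩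
      simp only [hP, Finset.mem_filter, Finset.mem_univ, true_and, G.rev_rev]
      exact lt_of_le_of_ne hd (hne d).symm
  have h3 := Finset.card_filter_add_card_filter_not (s := (Finset.univ : Finset D))
    (fun d => i d < i (G.rev d))
  rw [Finset.card_univ, ← h2] at h3
  change P.card + P.card = _ at h3
  omega

/-- The kernel of a difference operator consists of constants. -/
theorem finrank_ker_le_one {X Y : Type*} [Finite X] {f : (X → ℝ) →ₗ[ℝ] (Y → ℝ)}
    (hf : ∀ u, f u = 0 → ∀ x y, u x = u y) : Module.finrank ℝ (LinearMap.ker f) ≤ 1 := by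
  have hle : LinearMap.ker f ≤ Submodule.span ℝ {fun _ : X => (1 : ℝ)} := by
    intro u hu
    rw [Submodule.mem_span_singleton]
    rcases isEmpty_or_nonempty X with h | ⟨⟨x⟩⟩
    · exact ⟨0, funext fun x => h.elim x⟩
    · exact ⟨u x, funext fun y => by simp [hf u hu x y]⟩
  refine (Submodule.finrank_mono hle).trans ?_
  refine (finrank_span_le_card _).trans ?_
  simp

theorem card_le_finrank_range_vertexDiff :
    Fintype.card V ≤ Module.finrank ℝ (LinearMap.range G.vertexDiff) + 1 := by
  have h := LinearMap.finrank_range_add_finrank_ker G.vertexDiff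
  rw [Module.finrank_fintype_fun_eq_card] at h
  have h1 : Module.finrank ℝ (LinearMap.ker G.vertexDiff) ≤ 1 := by
    refine finrank_ker_le_one fun u hu x y => ?_
    have hy := G.connected x y
    induction hy with
    | refl => rfl
    | tail _ hxy ih =>
      obtain ⟨d, rfl, rfl⟩ := hxy
      have := congrFun hu d
      rw [vertexDiff_apply] at this
      rw [ih]
      exact sub_eq_zero.1 this
  omega

theorem card_le_finrank_range_faceDiff :
    Nat.card G.Face ≤ Module.finrank ℝ (LinearMap.range G.faceDiff) + 1 := by
  have h := LinearMap.finrank_range_add_finrank_ker G.faceDiff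
  rw [Module.finrank_fintype_fun_eq_card, ← Nat.card_eq_fintype_card] at h
  have h1 : Module.finrank ℝ (LinearMap.ker G.faceDiff) ≤ 1 := by
    refine finrank_ker_le_one fun u hu x y => ?_
    have hrev : ∀ d, u (G.face (G.rev d)) = u (G.face d) := by
      intro d
      have := congrFun hu d
      rw [faceDiff_apply] at this
      exact (sub_eq_zero.1 this).symm
    induction x using Quotient.inductionOn with | _ d =>
    induction y using Quotient.inductionOn with | _ d' =>
    exact G.eq_of_rev_of_rot (S := fun d => u (G.face d)) hrev
      (fun d => by rw [← G.face_rev, hrev]) d' d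
  omega

theorem sum_mul_org_eq (z : D → ℝ) (u : V → ℝ) :
    ∑ d, z d * u (G.org d) = ∑ v, G.outflow z v * u v := by
  rw [← Finset.sum_fiberwise (s := Finset.univ) (g := G.org)]
  refine Finset.sum_congr rfl fun v _ => ?_
  rw [outflow, Finset.sum_mul]
  refine Finset.sum_congr rfl fun d hd => ?_
  rw [(Finset.mem_filter.1 hd).2]

theorem disjoint_closedFlows : Disjoint G.closedFlows (LinearMap.range G.vertexDiff) := by
  rw [Submodule.disjoint_def]
  rintro z ⟨hz, hz0⟩ ⟨u, rfl⟩
  set z := G.vertexDiff u with hzu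
  have h1 : ∑ d, z d * u (G.org d) = 0 := by
    rw [sum_mul_org_eq]
    exact Finset.sum_eq_zero fun v _ => by rw [hz0, zero_mul]
  have h2 : ∑ d, z d * u (G.head d) = 0 := by
    rw [← Equiv.sum_comp G.rev, ← neg_eq_zero, ← Finset.sum_neg_distrib, ← h1]
    refine Finset.sum_congr rfl fun d _ => ?_
    rw [hz d, G.head_rev]
    ring
  have h3 : ∑ d, z d * z d = 0 := by
    rw [← sub_self (0 : ℝ)]
    nth_rw 1 [← h1]
    rw [← h2, ← Finset.sum_sub_distrib]
    refine Finset.sum_congr rfl fun d _ => ?_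
    rw [← mul_sub, ← vertexDiff_apply]
  funext d
  have h4 := (Finset.sum_eq_zero_iff_of_nonneg fun d _ => mul_self_nonneg (z d)).1 h3 d
    (Finset.mem_univ d)
  exact mul_self_eq_zero.1 h4

theorem range_faceDiff_le : LinearMap.range G.faceDiff ≤ G.closedFlows := by
  rintro _ ⟨S, rfl⟩
  refine ⟨fun d => ?_, fun v => ?_⟩
  · rw [faceDiff_apply, faceDiff_apply, G.rev_rev]
    ring
  · simp only [outflow, faceDiff_apply, face_rev, Finset.sum_sub_distrib]
    rw [sub_eq_zero]
    symm
    refine Finset.sum_bij (fun d _ => G.rot d) ?_ (fun _ _ _ _ h => G.rot.injective h) ?_ ?_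
    · intro d hd
      simpa [G.org_rot] using hd
    · intro d hd
      refine ⟨G.rot.symm d, ?_, by simp⟩
      have h1 := G.org_rot (G.rot.symm d)
      rw [Equiv.apply_symm_apply] at h1
      simpa [← h1] using hd
    · intro d _
      rfl

/-- On a plane graph, a flow without sources and sinks is the difference of a function on the faces:
the first homology of the sphere vanishes.  The dimensions fit by Euler's formula. -/
theorem exists_faceDiff_eq {z : D → ℝ} (hz : z ∈ G.closedFlows) : ∃ S, G.faceDiff S = z := by
  have hle : G.closedFlows ⊔ LinearMap.range G.vertexDiff ≤ G.flows := by
    refine sup_le (fun z hz => hz.1) ?_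
    rintro _ ⟨u, rfl⟩ d
    rw [vertexDiff_apply, vertexDiff_apply, G.org_rev, G.head_rev]
    ring
  have h1 := Submodule.finrank_mono hle
  have h2 := Submodule.finrank_sup_add_finrank_inf_eq G.closedFlows (LinearMap.range G.vertexDiff)
  rw [G.disjoint_closedFlows.eq_bot, finrank_bot, add_zero] at h2
  have h3 := G.two_mul_finrank_flows_le
  have h4 := G.card_le_finrank_range_vertexDiff
  have h5 := G.card_le_finrank_range_faceDiff
  have h6 : 2 * Fintype.card V + 2 * Nat.card G.Face = Fintype.card D + 4 := G.euler
  have h7 := Submodule.eq_of_le_of_finrank_le G.range_faceDiff_le (by omega)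
  rw [← h7] at hz
  exact hz

end Potential

end PlaneGraph


/-! ### Crossing branches -/

namespace PlaneGraph

variable {V D : Type*} [Fintype V] [Fintype D] (G : PlaneGraph V D)

/-- The `k`-th dart of the counterclockwise walk along the infinite face. -/
def contour (k : ℕ) : D := G.faceNext^[k] G.outer

/-- The `i`-th dart seen during the turn after the `k`-th step along the infinite face. -/
def turn (k i : ℕ) : D := G.rot.symm^[i] (G.rev (G.contour k))

variable {G}

theorem contour_succ (k : ℕ) : G.contour (k + 1) = G.faceNext (G.contour k) :=
  Function.iterate_succ_apply' _ _ _

theorem onOuter_faceNext {d : D} : G.OnOuter (G.faceNext d) ↔ G.OnOuter d :=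
  Equiv.Perm.sameCycle_apply_right

theorem onOuter_contour (k : ℕ) : G.OnOuter (G.contour k) := by
  induction k with
  | zero => exact Equiv.Perm.SameCycle.refl _ _
  | succ k ih =>
    rw [contour_succ]
    exact onOuter_faceNext.2 ih

theorem OnOuter.isBoundary_org {d : D} (h : G.OnOuter d) : G.IsBoundary (G.org d) := ⟨d, h, rfl⟩

theorem OnOuter.isBoundary_head {d : D} (h : G.OnOuter d) : G.IsBoundary (G.head d) := by
  rw [← G.org_faceNext]
  exact (onOuter_faceNext.2 h).isBoundary_org

theorem org_turn (k i : ℕ) : G.org (G.turn k i) = G.head (G.contour k) := by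
  induction i with
  | zero => rfl
  | succ i ih =>
    rw [← ih, turn, Function.iterate_succ_apply', ← G.org_rot, Equiv.apply_symm_apply]
    rfl

theorem rot_turn_succ (k i : ℕ) : G.rot (G.turn k (i + 1)) = G.turn k i := by
  rw [turn, Function.iterate_succ_apply', Equiv.apply_symm_apply]
  rfl

theorem rot_turn_zero (k : ℕ) : G.rot (G.turn k 0) = G.contour (k + 1) := by
  rw [contour_succ]
  rfl

/-- The function `S` on the faces changes during a turn by the sum of its differences. -/
theorem face_turn (S : G.Face → ℝ) (k j : ℕ) : S (G.face (G.turn k j)) =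
    S (G.face G.outer) + ∑ i ∈ Finset.range (j + 1), G.faceDiff S (G.turn k i) := by
  induction j with
  | zero =>
    rw [zero_add, Finset.sum_range_one, faceDiff_apply, face_rev, rot_turn_zero]
    have : G.face (G.contour (k + 1)) = G.face G.outer :=
      (Quotient.sound (onOuter_contour (k + 1))).symm
    rw [this]
    ring
  | succ j ih =>
    rw [Finset.sum_range_succ, ← add_assoc, ← ih, faceDiff_apply, face_rev, rot_turn_succ]
    ring

/-- Positions in the turns along the infinite face are determined by the dart seen there. -/
theorem turn_eq_turn {k k' i j' : ℕ} (h : ∀ m < i, ¬ G.OnOuter (G.turn k m))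
    (h' : ∀ m < j', ¬ G.OnOuter (G.turn k' m)) (e : G.turn k i = G.turn k' j') :
    i = j' ∧ G.contour k = G.contour k' := by
  induction i generalizing j' with
  | zero =>
    cases j' with
    | zero => exact ⟨rfl, G.rev.injective e⟩
    | succ j' =>
      have h1 := congrArg G.rot e
      rw [rot_turn_zero, rot_turn_succ] at h1
      exact absurd (h1 ▸ onOuter_contour (k + 1)) (h' j' (Nat.lt_succ_self _))
  | succ i ih =>
    have h1 := congrArg G.rot e
    rw [rot_turn_succ] at h1
    cases j' with
    | zero =>
      rw [rot_turn_zero] at h1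
      exact absurd (h1 ▸ onOuter_contour (k' + 1)) (h i (Nat.lt_succ_self _))
    | succ j' =>
      rw [rot_turn_succ] at h1
      obtain ⟨h2, h3⟩ := ih (fun m hm => h m (hm.trans (Nat.lt_succ_self _)))
        (fun m hm => h' m (hm.trans (Nat.lt_succ_self _))) h1
      exact ⟨congrArg _ h2, h3⟩

open scoped Classical in
theorem sum_turn_eq {k k' j j' : ℕ} (h : ∀ m < j, ¬ G.OnOuter (G.turn k m))
    (h' : ∀ m < j', ¬ G.OnOuter (G.turn k' m)) :
    ∑ i ∈ Finset.range (j + 1), (if G.turn k i = G.turn k' j' then (1 : ℝ) else 0) =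
      if G.contour k = G.contour k' ∧ j' ≤ j then 1 else 0 := by
  have key : ∀ i ∈ Finset.range (j + 1), (if G.turn k i = G.turn k' j' then (1 : ℝ) else 0) =
      if i = j' then (if G.contour k = G.contour k' then 1 else 0) else 0 := by
    intro i hi
    rw [Finset.mem_range, Nat.lt_succ_iff] at hi
    have h1 : G.turn k i = G.turn k' j' ↔ i = j' ∧ G.contour k = G.contour k' := by
      refine ⟨turn_eq_turn (fun m hm => h m (hm.trans_le hi)) h', ?_⟩
      rintro ⟨rfl, h2⟩
      rw [turn, h2, turn]
    simp only [h1]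
    split_ifs <;> simp_all
  rw [Finset.sum_congr rfl key, Finset.sum_ite_eq']
  simp only [Finset.mem_range, Nat.lt_succ_iff]
  split_ifs <;> simp_all

theorem contourLength_eq : G.contourLength = Function.minimalPeriod G.faceNext G.outer := by
  have hper : G.outer ∈ Function.periodicPts G.faceNext := by
    refine Function.mem_periodicPts.2 ⟨orderOf G.faceNext, orderOf_pos _, ?_⟩
    rw [Function.IsPeriodicPt, Function.IsFixedPt, Equiv.Perm.iterate_eq_pow, pow_orderOf_eq_one]
    rfl
  have hset : {d | G.OnOuter d} = (fun k => G.faceNext^[k] G.outer) ''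
      (Finset.range (Function.minimalPeriod G.faceNext G.outer) : Set ℕ) := by
    ext d
    constructor
    · intro hd
      obtain ⟨n, rfl⟩ := Equiv.Perm.SameCycle.exists_nat_pow_eq hd
      refine ⟨n % Function.minimalPeriod G.faceNext G.outer, ?_, ?_⟩
      · simpa using Nat.mod_lt _ (Function.minimalPeriod_pos_of_mem_periodicPts hper)
      · rw [← Equiv.Perm.iterate_eq_pow]
        exact Function.iterate_mod_minimalPeriod_eq
    · rintro ⟨k, -, rfl⟩
      exact onOuter_contour k
  unfold contourLength
  rw [hset, Set.InjOn.ncard_image, Set.ncard_coe_finset, Finset.card_range]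
  rw [Finset.coe_range]
  exact Function.iterate_injOn_Iio_minimalPeriod

theorem contour_add_eq_iff {k m : ℕ} (hm : m ≤ G.contourLength) :
    G.contour (k + m) = G.contour k ↔ m = 0 ∨ m = G.contourLength := by
  have h1 : G.contour (k + m) = G.contour k ↔ Function.IsPeriodicPt G.faceNext m G.outer := by
    unfold contour
    rw [Function.iterate_add_apply]
    exact (G.faceNext.injective.iterate k).eq_iff
  rw [h1, Function.isPeriodicPt_iff_minimalPeriod_dvd, ← contourLength_eq]
  constructor
  · rintro ⟨c, rfl⟩
    rcases c with _ | _ | c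
    · simp
    · simp
    · rcases Nat.eq_zero_or_pos G.contourLength with h | h
      · simp [h]
      · nlinarith
  · rintro (rfl | rfl)
    · exact dvd_zero _
    · exact dvd_rfl

section Flow

open scoped Classical

/-- The unit flow along a dart. -/
noncomputable def edgeFlow (x : D) (G : PlaneGraph V D) : D → ℝ :=
  fun d => (if d = x then 1 else 0) - if d = G.rev x then 1 else 0

theorem edgeFlow_mem (x : D) : edgeFlow x G ∈ G.flows := by
  intro d
  have h1 : G.rev d = x ↔ d = G.rev x := by
    constructor
    · rintro rfl
      rw [G.rev_rev]
    · rintro rfl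
      rw [G.rev_rev]
  simp only [edgeFlow, h1, G.rev.injective.eq_iff]
  ring

theorem outflow_add (z z' : D → ℝ) (v : V) :
    G.outflow (z + z') v = G.outflow z v + G.outflow z' v := Finset.sum_add_distrib

theorem outflow_sub (z z' : D → ℝ) (v : V) :
    G.outflow (z - z') v = G.outflow z v - G.outflow z' v := Finset.sum_sub_distrib _ _

theorem outflow_edgeFlow (x : D) (v : V) : G.outflow (edgeFlow x G) v =
    (if v = G.org x then 1 else 0) - if v = G.head x then 1 else 0 := by
  have key : ∀ y : D, ∑ d with G.org d = v, (if d = y then (1 : ℝ) else 0) =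
      if v = G.org y then 1 else 0 := by
    intro y
    rw [Finset.sum_ite_eq']
    simp [eq_comm]
  simp only [outflow, edgeFlow, Finset.sum_sub_distrib, key]
  rfl

/-- A unit flow along a path in `A`. -/
theorem exists_pathFlow {A : Set V} {u w : V} (h : Relation.ReflTransGen
    (fun x y => ∃ d, G.org d = x ∧ G.head d = y ∧ x ∈ A ∧ y ∈ A) u w) :
    ∃ z ∈ G.flows, (∀ d, G.org d ∉ A → z d = 0) ∧
      ∀ v, G.outflow z v = (if v = u then 1 else 0) - if v = w then 1 else 0 := by
  induction h with
  | refl => exact ⟨0, zero_mem _, fun _ _ => rfl, fun v => by simp [outflow]⟩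
  | tail _ hxy ih =>
    obtain ⟨x, rfl, rfl, hx, hx'⟩ := hxy
    obtain ⟨z, h1, h2, h3⟩ := ih
    refine ⟨z + edgeFlow x G, add_mem h1 (edgeFlow_mem x), fun d hd => ?_, fun v => ?_⟩
    · have h4 : d ≠ x := by
        rintro rfl
        exact hd hx
      have h5 : d ≠ G.rev x := by
        rintro rfl
        exact hd hx'
      simp [h2 d hd, edgeFlow, h4, h5]
    · rw [outflow_add, h3, outflow_edgeFlow]
      ring

/-- The unit flow along a part of the walk along the infinite face. -/
noncomputable def contourFlow (G : PlaneGraph V D) (a b : ℕ) : D → ℝ :=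
  ∑ k ∈ Finset.Ioc a b, edgeFlow (G.contour k) G

theorem outflow_contourFlow {a b : ℕ} (hab : a ≤ b) (v : V) : G.outflow (contourFlow G a b) v =
    (if v = G.head (G.contour a) then 1 else 0) - if v = G.head (G.contour b) then 1 else 0 := by
  induction b, hab using Nat.le_induction with
  | base => simp [contourFlow, outflow]
  | succ b hab ih =>
    have h1 : contourFlow G a (b + 1) = contourFlow G a b + edgeFlow (G.contour (b + 1)) G := by
      unfold contourFlow
      rw [Finset.sum_Ioc_succ_top hab]
    rw [h1, outflow_add, ih, outflow_edgeFlow, contour_succ, G.org_faceNext]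
    ring

/-- Within one revolution along the infinite face, only the first and the last step coincide. -/
theorem contour_eq_iff {p q : ℕ} (hpq : p ≤ q) (hq : q ≤ p + G.contourLength) :
    G.contour p = G.contour q ↔ q = p ∨ q = p + G.contourLength := by
  obtain ⟨m, rfl⟩ := Nat.exists_eq_add_of_le hpq
  rw [eq_comm, contour_add_eq_iff (by omega)]
  omega

/-- The number of steps in a part of the walk along the infinite face that repeat a given step. -/
theorem sum_contour_eq {a b k : ℕ} (hb : b ≤ a + G.contourLength) (hak : a ≤ k)
    (hk : k ≤ a + G.contourLength) :
    ∑ k' ∈ Finset.Ioc a b, (if G.contour k = G.contour k' then (1 : ℝ) else 0) =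
      if a < k ∧ k ≤ b ∨ k = a ∧ a < b ∧ b = a + G.contourLength then 1 else 0 := by
  by_cases hka : k = a
  · have key : ∀ k' ∈ Finset.Ioc a b, (if G.contour k = G.contour k' then (1 : ℝ) else 0) =
        if k' = a + G.contourLength then 1 else 0 := by
      intro k' hk'
      rw [Finset.mem_Ioc] at hk'
      rw [contour_eq_iff (by omega) (by omega)]
      congr 1
      exact propext (by omega)
    rw [Finset.sum_congr rfl key, Finset.sum_ite_eq']
    congr 1
    rw [Finset.mem_Ioc]
    exact propext (by omega)
  · have key : ∀ k' ∈ Finset.Ioc a b, (if G.contour k = G.contour k' then (1 : ℝ) else 0) =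
        if k' = k then 1 else 0 := by
      intro k' hk'
      rw [Finset.mem_Ioc] at hk'
      congr 1
      rcases le_total k k' with h | h
      · rw [contour_eq_iff (by omega) (by omega)]
        exact propext (by omega)
      · rw [eq_comm (a := G.contour k), contour_eq_iff (by omega) (by omega)]
        exact propext (by omega)
    rw [Finset.sum_congr rfl key, Finset.sum_ite_eq']
    congr 1
    rw [Finset.mem_Ioc]
    exact propext (by omega)

/-- If the positions 1, 2, 3, 4 are in cyclic order, then the part of the cycle through 1 and 3 that
is met up to position 2 has total multiplicity one. -/
theorem crossing_number_eq_one {n k₁ j₁ k₂ j₂ k₃ j₃ k₄ j₄ : ℕ}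
    (h12 : k₁ < k₂ ∨ k₁ = k₂ ∧ j₁ < j₂) (h23 : k₂ < k₃ ∨ k₂ = k₃ ∧ j₂ < j₃)
    (h34 : k₃ < k₄ ∨ k₃ = k₄ ∧ j₃ < j₄) (h41 : k₄ < k₁ + n ∨ k₄ = k₁ + n ∧ j₄ < j₁) :
    (if (k₂ = k₁ ∨ k₂ = k₁ + n) ∧ j₁ ≤ j₂ then (1 : ℝ) else 0) -
      (if (k₃ = k₂ ∨ k₃ = k₂ + n) ∧ j₃ ≤ j₂ then 1 else 0) +
      (if k₁ < k₂ ∧ k₂ ≤ k₃ ∨ k₂ = k₁ ∧ k₁ < k₃ ∧ k₃ = k₁ + n then 1 else 0) = 1 := by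
  split_ifs <;> first | (norm_num; done) | omega

/-- If the positions 1, 2, 3, 4 are in cyclic order, then the part of the cycle through 1 and 3 that
is met up to position 4 has total multiplicity zero. -/
theorem crossing_number_eq_zero {n k₁ j₁ k₂ j₂ k₃ j₃ k₄ j₄ : ℕ}
    (h12 : k₁ < k₂ ∨ k₁ = k₂ ∧ j₁ < j₂) (h23 : k₂ < k₃ ∨ k₂ = k₃ ∧ j₂ < j₃)
    (h34 : k₃ < k₄ ∨ k₃ = k₄ ∧ j₃ < j₄) (h41 : k₄ < k₁ + n ∨ k₄ = k₁ + n ∧ j₄ < j₁) :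
    (if (k₄ = k₁ ∨ k₄ = k₁ + n) ∧ j₁ ≤ j₄ then (1 : ℝ) else 0) -
      (if (k₄ = k₃ ∨ k₄ = k₃ + n) ∧ j₃ ≤ j₄ then 1 else 0) +
      (if k₁ < k₄ ∧ k₄ ≤ k₃ ∨ k₄ = k₁ ∧ k₁ < k₃ ∧ k₃ = k₁ + n then 1 else 0) = 0 := by
  split_ifs <;> first | (norm_num; done) | omega

theorem VisitedAt.isBoundary_head {k j : ℕ} {x : D} (h : G.VisitedAt k j (G.rev x)) :
    G.IsBoundary (G.head x) := by
  have h1 : G.head x = G.head (G.contour k) := by rw [← G.org_rev, h.1, ← G.org_turn k j]; rfl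
  rw [h1]
  exact (onOuter_contour k).isBoundary_head

/-- Disjoint connected sets of interior vertices cannot join two crossing pairs of boundary edges.
The cycle that joins the edges `x₁` and `x₃` within the first set and closes up along the infinite
face bounds a function on the faces, and this function takes different values at `x₂` and
`x₄`. -/
theorem not_crossing {A B : Set V} (hA : ∀ v ∈ A, G.IsInterior v) (hB : ∀ v ∈ B, G.IsInterior v)
    (hAB : Disjoint A B) {x₁ x₂ x₃ x₄ : D} {k₁ j₁ k₂ j₂ k₃ j₃ k₄ j₄ : ℕ}
    (h₁ : G.VisitedAt k₁ j₁ (G.rev x₁)) (h₂ : G.VisitedAt k₂ j₂ (G.rev x₂))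
    (h₃ : G.VisitedAt k₃ j₃ (G.rev x₃)) (h₄ : G.VisitedAt k₄ j₄ (G.rev x₄))
    (h12 : k₁ < k₂ ∨ k₁ = k₂ ∧ j₁ < j₂) (h23 : k₂ < k₃ ∨ k₂ = k₃ ∧ j₂ < j₃)
    (h34 : k₃ < k₄ ∨ k₃ = k₄ ∧ j₃ < j₄)
    (h41 : k₄ < k₁ + G.contourLength ∨ k₄ = k₁ + G.contourLength ∧ j₄ < j₁)
    (hx₁ : G.org x₁ ∈ A) (hx₃ : G.org x₃ ∈ A) (hx₂ : G.org x₂ ∈ B) (hx₄ : G.org x₄ ∈ B)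
    (h13 : Relation.ReflTransGen (fun x y => ∃ d, G.org d = x ∧ G.head d = y ∧ x ∈ A ∧ y ∈ A)
      (G.org x₁) (G.org x₃))
    (h24 : Relation.ReflTransGen (fun x y => ∃ d, G.org d = x ∧ G.head d = y ∧ x ∈ B ∧ y ∈ B)
      (G.org x₂) (G.org x₄)) : False := by
  obtain ⟨zA, hzA, hzA0, hzAout⟩ := exists_pathFlow h13
  set z : D → ℝ := edgeFlow (G.rev x₁) G + zA + edgeFlow x₃ G - contourFlow G k₁ k₃ with hz
  have hb₁ := h₁.isBoundary_head
  have hb₃ := h₃.isBoundary_head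
  have hhead : ∀ {k j x}, G.VisitedAt k j (G.rev x) → G.head x = G.head (G.contour k) := by
    intro k j x h
    rw [← G.org_rev, h.1, ← G.org_turn k j]
    rfl
  have hclosed : z ∈ G.closedFlows := by
    refine ⟨sub_mem (add_mem (add_mem (edgeFlow_mem _) hzA) (edgeFlow_mem _))
      (sum_mem fun k _ => edgeFlow_mem _), fun v => ?_⟩
    rw [hz, outflow_sub, outflow_add, outflow_add, outflow_edgeFlow, outflow_edgeFlow, hzAout,
      outflow_contourFlow (by omega), G.org_rev, G.head_rev, hhead h₁, hhead h₃]
    ring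
  obtain ⟨S, hS⟩ := G.exists_faceDiff_eq hclosed
  -- `S` is constant along `B`
  have hz0 : ∀ d, G.org d ∈ B → z d = 0 := by
    intro d hd
    have hdA : G.org d ∉ A := fun h => Set.disjoint_left.1 hAB h hd
    have hne : ∀ y, G.IsBoundary (G.org y) ∨ G.org y ∈ A → d ≠ y := by
      rintro y hy rfl
      rcases hy with hy | hy
      · exact hB _ hd hy
      · exact hdA hy
    have e1 : edgeFlow (G.rev x₁) G d = 0 := by
      simp [edgeFlow, G.rev_rev, hne x₁ (Or.inr hx₁), hne (G.rev x₁) (Or.inl hb₁)]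
    have e2 : edgeFlow x₃ G d = 0 := by
      simp [edgeFlow, hne x₃ (Or.inr hx₃), hne (G.rev x₃) (Or.inl hb₃)]
    have e3 : contourFlow G k₁ k₃ d = 0 := by
      unfold contourFlow
      rw [Finset.sum_apply]
      refine Finset.sum_eq_zero fun k _ => ?_
      simp [edgeFlow, hne _ (Or.inl (onOuter_contour k).isBoundary_org),
        hne (G.rev (G.contour k)) (Or.inl (onOuter_contour k).isBoundary_head)]
    simp [hz, e1, e2, e3, hzA0 d hdA]
  have hSrev : ∀ d, G.org d ∈ B → S (G.face (G.rev d)) = S (G.face d) := by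
    intro d hd
    have h := congrFun hS d
    rw [faceDiff_apply, hz0 d hd] at h
    linarith
  have hSorg : ∀ d d', G.org d ∈ B → G.org d = G.org d' → S (G.face d) = S (G.face d') := by
    intro d d' hd hdd
    have h := eq_of_sameCycle (S := fun d => if G.org d ∈ B then S (G.face d) else 0)
      (f := G.rot) (fun t => ?_) ((G.org_eq_iff d d').1 hdd)
    · simpa [hd, hdd ▸ hd] using h
    · simp only [G.org_rot]
      split_ifs with ht
      · rw [← G.face_rev, hSrev t ht]
      · rfl
  have hSB : S (G.face (G.rev x₂)) = S (G.face (G.rev x₄)) := by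
    have key : ∀ y, Relation.ReflTransGen
        (fun x y => ∃ d, G.org d = x ∧ G.head d = y ∧ x ∈ B ∧ y ∈ B) (G.org x₂) y →
        ∀ d, G.org d = y → S (G.face d) = S (G.face x₂) := by
      intro y hy
      induction hy with
      | refl => exact fun d hd => (hSorg x₂ d hx₂ hd.symm).symm
      | tail _ hxy ih =>
        obtain ⟨t, rfl, rfl, ht, ht'⟩ := hxy
        intro d hd
        rw [← ih t rfl, ← hSrev t ht]
        exact (hSorg (G.rev t) d ht' hd.symm).symm
    rw [hSrev x₂ hx₂, hSrev x₄ hx₄, key _ h24 x₄ rfl]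
  -- but it jumps along the infinite face
  have hval : ∀ {k j : ℕ} {x : D}, G.VisitedAt k j (G.rev x) → G.IsInterior (G.org x) →
      k₁ ≤ k → k ≤ k₁ + G.contourLength → S (G.face (G.rev x)) = S (G.face G.outer) +
        ((if G.contour k = G.contour k₁ ∧ j₁ ≤ j then 1 else 0) -
          (if G.contour k = G.contour k₃ ∧ j₃ ≤ j then 1 else 0) +
          if k₁ < k ∧ k ≤ k₃ ∨ k = k₁ ∧ k₁ < k₃ ∧ k₃ = k₁ + G.contourLength then 1 else 0) := by
    intro k j x h hx hk hk'
    have hout : ∀ i ≤ j, ¬ G.OnOuter (G.turn k i) := by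
      intro i hi
      rcases hi.lt_or_eq with hi | rfl
      · exact h.2 i hi
      · have h1 : G.turn k i = G.rev x := h.1.symm
        rw [h1]
        intro h2
        exact hx (G.head_rev x ▸ h2.isBoundary_head)
    have hxt : G.rev x = G.turn k j := h.1
    rw [hxt, face_turn S, hS]
    congr 1
    have hz' : ∀ i ∈ Finset.range (j + 1), z (G.turn k i) =
        (if G.turn k i = G.turn k₁ j₁ then 1 else 0) - (if G.turn k i = G.turn k₃ j₃ then 1 else 0)
          + ∑ k' ∈ Finset.Ioc k₁ k₃, if G.turn k i = G.turn k' 0 then 1 else 0 := by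
      intro i hi
      rw [Finset.mem_range, Nat.lt_succ_iff] at hi
      have hbd : G.IsBoundary (G.org (G.turn k i)) := by
        rw [org_turn]
        exact (onOuter_contour k).isBoundary_head
      have hne : ∀ y, G.org y ∈ A → G.turn k i ≠ y := by
        rintro y hy rfl
        exact hA _ hy hbd
      have e1 : edgeFlow (G.rev x₁) G (G.turn k i) = if G.turn k i = G.turn k₁ j₁ then 1 else 0 := by
        have h1 : G.rev x₁ = G.turn k₁ j₁ := h₁.1
        rw [← h1]
        simp [edgeFlow, G.rev_rev, hne x₁ hx₁]
      have e2 : edgeFlow x₃ G (G.turn k i) = -if G.turn k i = G.turn k₃ j₃ then 1 else 0 := by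
        have h1 : G.rev x₃ = G.turn k₃ j₃ := h₃.1
        rw [← h1]
        simp [edgeFlow, hne x₃ hx₃]
      have e3 : contourFlow G k₁ k₃ (G.turn k i) =
          -∑ k' ∈ Finset.Ioc k₁ k₃, if G.turn k i = G.turn k' 0 then 1 else 0 := by
        unfold contourFlow
        rw [Finset.sum_apply, ← Finset.sum_neg_distrib]
        refine Finset.sum_congr rfl fun k' _ => ?_
        have h1 : G.turn k i ≠ G.contour k' := fun h1 => hout i hi (h1 ▸ onOuter_contour k')
        have h2 : G.turn k' 0 = G.rev (G.contour k') := rfl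
        simp [edgeFlow, h1, h2]
      rw [hz, Pi.sub_apply, Pi.add_apply, Pi.add_apply, e1, e2, e3, hzA0 _ fun h => hA _ h hbd]
      ring
    rw [Finset.sum_congr rfl hz', Finset.sum_add_distrib, Finset.sum_sub_distrib,
      Finset.sum_comm, sum_turn_eq h.2 h₁.2, sum_turn_eq h.2 h₃.2]
    congr 1
    rw [← sum_contour_eq (G := G) (by omega) hk hk']
    refine Finset.sum_congr rfl fun k' _ => ?_
    rw [sum_turn_eq h.2 fun m hm => absurd hm (Nat.not_lt_zero m)]
    simp
  have hv₂ := hval h₂ (hB _ hx₂) (by omega) (by omega)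
  have hv₄ := hval h₄ (hB _ hx₄) (by omega) (by omega)
  rw [eq_comm (a := G.contour k₂) (b := G.contour k₁),
    contour_eq_iff (p := k₁) (q := k₂) (by omega) (by omega),
    contour_eq_iff (p := k₂) (q := k₃) (by omega) (by omega)] at hv₂
  rw [eq_comm (a := G.contour k₄) (b := G.contour k₁),
    eq_comm (a := G.contour k₄) (b := G.contour k₃),
    contour_eq_iff (p := k₁) (q := k₄) (by omega) (by omega),
    contour_eq_iff (p := k₃) (q := k₄) (by omega) (by omega)] at hv₄
  rw [hSB, hv₄] at hv₂
  refine zero_ne_one (α := ℝ) ?_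
  convert add_left_cancel hv₂ using 1
  · convert (crossing_number_eq_zero h12 h23 h34 h41).symm
  · convert (crossing_number_eq_one h12 h23 h34 h41).symm

end Flow

end PlaneGraph


/-! ### Connection probabilities -/

namespace LinkPattern

variable {N : ℕ}

/-- A link encloses a set of complete links, so its endpoints have different parity. -/
theorem odd_partner_iff (α : LinkPattern N) (a : Fin (2 * N)) :
    Odd (α.partner a).val ↔ Even a.val := by
  have key : ∀ a, a < α.partner a → (Odd (α.partner a).val ↔ Even a.val) := by
    intro a ha
    have hsum : ∑ _x ∈ Finset.Ioo a (α.partner a), (1 : ZMod 2) = 0 := by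
      refine Finset.sum_involution (fun x _ => α.partner x) (fun _ _ => by decide)
        (fun x _ _ => α.partner_ne x) (fun x hx => ?_) (fun x _ => α.partner_partner x)
      rw [Finset.mem_Ioo] at hx ⊢
      constructor
      · by_contra h
        rcases (not_lt.1 h).lt_or_eq with h1 | h1
        · exact α.noncrossing (α.partner x) a h1 (by rw [α.partner_partner]; exact hx.1)
            (by rw [α.partner_partner]; exact hx.2)
        · rw [α.partner_eq_iff] at h1
          exact hx.2.ne h1.symm
      · refine lt_of_le_of_ne (not_lt.1 (α.noncrossing a x hx.1 hx.2)) fun h => ?_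
        exact hx.1.ne (α.partner_injective h).symm
    rw [Finset.sum_const, nsmul_eq_mul, mul_one, ZMod.natCast_eq_zero_iff_even, Fin.card_Ioo] at hsum
    have h1 : a.val < (α.partner a).val := ha
    rw [← Nat.not_even_iff_odd]
    constructor
    · intro h
      by_contra h2
      rw [Nat.not_even_iff_odd] at h h2
      rcases hsum with ⟨r, hr⟩
      rcases h with ⟨s, hs⟩
      rcases h2 with ⟨t, ht⟩
      omega
    · rintro ⟨s, hs⟩ ⟨t, ht⟩
      rcases hsum with ⟨r, hr⟩
      omega
  rcases lt_or_gt_of_ne (α.partner_ne a) with h | h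
  · have h1 := key (α.partner a) (by rwa [α.partner_partner])
    rw [α.partner_partner] at h1
    rw [← Nat.not_even_iff_odd, ← h1, Nat.not_odd_iff_even]
  · exact key a h

/-- The matching obtained from a link pattern by permuting the left endpoints of its links. -/
def permuted (β : LinkPattern N) (σ : Equiv.Perm {a // a < β.partner a}) (a : Fin (2 * N)) :
    Fin (2 * N) :=
  Equiv.Perm.ofSubtype σ (β.partner ((Equiv.Perm.ofSubtype σ).symm a))

section Permuted

variable (β : LinkPattern N) (σ : Equiv.Perm {a // a < β.partner a})

theorem permuted_permuted (a : Fin (2 * N)) : β.permuted σ (β.permuted σ a) = a := by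
  simp [permuted, β.partner_partner]

theorem permuted_ne (a : Fin (2 * N)) : β.permuted σ a ≠ a := by
  intro h
  rw [permuted, ← Equiv.eq_symm_apply] at h
  exact β.partner_ne _ h

theorem permuted_apply (a : {a // a < β.partner a}) : β.permuted σ (σ a) = β.partner a := by
  have h1 : ((Equiv.Perm.ofSubtype σ).symm (σ a : Fin (2 * N))) = a := by
    rw [Equiv.symm_apply_eq, Equiv.Perm.ofSubtype_apply_coe]
  rw [permuted, h1, Equiv.Perm.ofSubtype_apply_of_not_mem]
  rw [β.partner_partner]
  exact not_lt.2 a.2.le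

theorem left_iff_not_left_permuted (a : Fin (2 * N)) :
    a < β.partner a ↔ ¬ β.permuted σ a < β.partner (β.permuted σ a) := by
  have key : ∀ a, a < β.partner a → ¬ β.permuted σ a < β.partner (β.permuted σ a) := by
    intro a ha
    have h1 := β.permuted_apply σ (σ.symm ⟨a, ha⟩)
    rw [Equiv.apply_symm_apply] at h1
    rw [h1, β.partner_partner]
    exact not_lt.2 (σ.symm ⟨a, ha⟩).2.le
  refine ⟨key a, fun h => ?_⟩
  by_contra ha
  have h2 : (Equiv.Perm.ofSubtype σ).symm a = a := by
    rw [Equiv.symm_apply_eq, Equiv.Perm.ofSubtype_apply_of_not_mem (p := fun a => a < β.partner a) _ ha]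
  have h3 : β.partner a < β.partner (β.partner a) := by
    rw [β.partner_partner]
    exact β.not_lt_partner_iff.1 ha
  apply h
  rw [permuted, h2, Equiv.Perm.ofSubtype_apply_of_mem (p := fun a => a < β.partner a) _ h3]
  exact (σ ⟨_, h3⟩).2

theorem fominDet_eq_sum (W : Fin (2 * N) → Fin (2 * N) → ℝ) :
    β.fominDet W = ∑ σ : Equiv.Perm {a // a < β.partner a},
      ((Equiv.Perm.sign σ : ℤ) : ℝ) * ∏ a : {a // a < β.partner a}, W a (β.permuted σ a) := by
  unfold fominDet
  rw [Matrix.det_apply']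
  refine Finset.sum_congr rfl fun σ _ => ?_
  congr 1
  rw [← Equiv.prod_comp σ fun a => W a (β.permuted σ a)]
  refine Finset.prod_congr rfl fun a _ => ?_
  rw [permuted_apply, Matrix.of_apply]

end Permuted

end LinkPattern

namespace PlaneGraph

variable {V D : Type*} [Fintype V] [Fintype D] {G : PlaneGraph V D}

/-- Counterclockwise edges are distinct, since each dart is seen only once per revolution. -/
theorem IsCounterclockwise.injective {n : ℕ} {e : Fin n → D} (h : G.IsCounterclockwise e) :
    Function.Injective e := by
  obtain ⟨k, j, hv, hlt, hwrap⟩ := h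
  have key : ∀ a b, a < b → e a ≠ e b := by
    intro a b hab heq
    have h1 := hlt a b hab
    have h2 := hwrap a b
    rw [Prod.Lex.toLex_lt_toLex] at h1 h2
    simp only at h1 h2
    have ha : G.rev (e a) = G.turn (k a) (j a) := (hv a).1
    have hb : G.rev (e b) = G.turn (k b) (j b) := (hv b).1
    obtain ⟨h3, h4⟩ := turn_eq_turn (hv a).2 (hv b).2 (ha.symm.trans ((congrArg G.rev heq).trans hb))
    rw [contour_eq_iff (by omega) (by omega)] at h4
    omega
  intro a b heq
  by_contra hne
  rcases lt_or_gt_of_ne hne with h | h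
  · exact key a b h heq
  · exact key b a h heq.symm

/-- The connected set of vertices of a branch that joins the interior vertices of two boundary
edges, in one direction or in the other. -/
theorem exists_connected_of_exitsVia {f : G.Arrows} {x y : D} (hx : G.IsInterior (G.org x))
    (hy : G.IsInterior (G.org y)) (h : ExitsVia f ⟨G.org x, hx⟩ y ∨ ExitsVia f ⟨G.org y, hy⟩ x) :
    ∃ A : Set V, (∀ v ∈ A, ∃ hv : G.IsInterior v, ExitsVia f ⟨v, hv⟩ x ∨ ExitsVia f ⟨v, hv⟩ y) ∧
      G.org x ∈ A ∧ G.org y ∈ A ∧ Relation.ReflTransGen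
        (fun v w => ∃ d, G.org d = v ∧ G.head d = w ∧ v ∈ A ∧ w ∈ A) (G.org x) (G.org y) := by
  have key : ∀ {x y : D} (hx : G.IsInterior (G.org x)) (hy : G.IsInterior (G.org y)),
      ExitsVia f ⟨G.org x, hx⟩ y → ∃ A : Set V,
        (∀ v ∈ A, ∃ hv : G.IsInterior v, ExitsVia f ⟨v, hv⟩ y) ∧ G.org x ∈ A ∧ G.org y ∈ A ∧
        Relation.ReflTransGen
          (fun v w => ∃ d, G.org d = v ∧ G.head d = w ∧ v ∈ A ∧ w ∈ A) (G.org x) (G.org y) := by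
    intro x y hx hy h
    have hxy := (h.onBranch_org hy).1
    refine ⟨{v | ∃ hv, OnBranch f ⟨G.org x, hx⟩ ⟨v, hv⟩}, ?_, ⟨hx, Relation.ReflTransGen.refl⟩,
      ⟨hy, hxy⟩, ?_⟩
    · rintro v ⟨hv, hb⟩
      exact ⟨hv, hb.exitsVia_iff.1 h⟩
    · have hpath : ∀ w, OnBranch f ⟨G.org x, hx⟩ w → Relation.ReflTransGen
          (fun v w => ∃ d, G.org d = v ∧ G.head d = w ∧
            v ∈ {v | ∃ hv, OnBranch f ⟨G.org x, hx⟩ ⟨v, hv⟩} ∧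
            w ∈ {v | ∃ hv, OnBranch f ⟨G.org x, hx⟩ ⟨v, hv⟩}) (G.org x) w.1 := by
        intro w hw
        induction hw with
        | refl => exact Relation.ReflTransGen.refl
        | @tail v w hv hvw ih =>
          exact ih.tail ⟨(f v).1, (f v).2, hvw, ⟨v.2, hv⟩, ⟨w.2, hv.tail hvw⟩⟩
      exact hpath _ hxy
  rcases h with h | h
  · obtain ⟨A, h1, h2, h3, h4⟩ := key hx hy h
    refine ⟨A, fun v hv => ?_, h2, h3, h4⟩
    obtain ⟨hv', h5⟩ := h1 v hv
    exact ⟨hv', Or.inr h5⟩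
  · obtain ⟨A, h1, h2, h3, h4⟩ := key hy hx h
    refine ⟨A, fun v hv => ?_, h3, h2, ?_⟩
    · obtain ⟨hv', h5⟩ := h1 v hv
      exact ⟨hv', Or.inl h5⟩
    · have hsymm : Std.Symm
          (fun v w => ∃ d, G.org d = v ∧ G.head d = w ∧ v ∈ A ∧ w ∈ A) := by
        refine ⟨?_⟩
        rintro v w ⟨d, rfl, rfl, hv, hw⟩
        exact ⟨G.rev d, rfl, G.head_rev d, hw, hv⟩
      exact Relation.ReflTransGen.stdSymm.symm _ _ h4

section Marked

variable {N : ℕ} {e : Fin (2 * N) → D}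

/-- Branches between the marked edges do not cross. -/
theorem IsCounterclockwise.not_crossing (hccw : G.IsCounterclockwise e)
    (he : ∀ a, G.IsInterior (G.org (e a))) {f : G.Arrows} {a b c d : Fin (2 * N)}
    (hab : a < b) (hbc : b < c) (hcd : c < d)
    (hac : ExitsVia f ⟨_, he a⟩ (e c) ∨ ExitsVia f ⟨_, he c⟩ (e a))
    (hbd : ExitsVia f ⟨_, he b⟩ (e d) ∨ ExitsVia f ⟨_, he d⟩ (e b)) : False := by
  obtain ⟨A, hA, hA1, hA2, hA3⟩ := exists_connected_of_exitsVia (he a) (he c) hac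
  obtain ⟨B, hB, hB1, hB2, hB3⟩ := exists_connected_of_exitsVia (he b) (he d) hbd
  have hinj := hccw.injective
  obtain ⟨k, j, hv, hlt, hwrap⟩ := hccw
  have h1 := hlt a b hab
  have h2 := hlt b c hbc
  have h3 := hlt c d hcd
  have h4 := hwrap a d
  rw [Prod.Lex.toLex_lt_toLex] at h1 h2 h3 h4
  refine PlaneGraph.not_crossing (fun v hv => (hA v hv).1) (fun v hv => (hB v hv).1)
    (Set.disjoint_left.2 fun v hvA hvB => ?_) (hv a) (hv b) (hv c) (hv d) h1 h2 h3 h4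
    hA1 hA2 hB1 hB2 hA3 hB3
  obtain ⟨hv, h5⟩ := hA v hvA
  obtain ⟨_, h6⟩ := hB v hvB
  rcases h5 with h5 | h5 <;> rcases h6 with h6 | h6 <;>
  · have h7 := hinj (h5.unique h6)
    omega

/-- The number of acyclic arrows for which the branches from the marked edges in `L` exit through
their partners under the matching `p`. -/
noncomputable def exitCount (he : ∀ a, G.IsInterior (G.org (e a))) (p : Fin (2 * N) → Fin (2 * N))
    (L : Finset (Fin (2 * N))) : ℕ :=
  {f : G.Arrows | Acyclic f ∧ ∀ a ∈ L, ExitsVia f ⟨_, he a⟩ (e (p a))}.ncard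

variable (he : ∀ a, G.IsInterior (G.org (e a))) {p : Fin (2 * N) → Fin (2 * N)}

/-- The direction of a single branch can be reversed. -/
theorem exitCount_flip (he' : ∀ a, G.IsBoundary (G.head (e a))) (hinj : Function.Injective e)
    (hp : ∀ a, p (p a) = a) {L : Finset (Fin (2 * N))} (hL : ∀ a, a ∈ L ↔ p a ∉ L)
    {a : Fin (2 * N)} (ha : a ∈ L) :
    exitCount he p L = exitCount he p (insert (p a) (L.erase a)) := by
  have hrev := ncard_reversal (ι := {i // i ∈ L.erase a}) (he a) (he' a) (he (p a)) (he' (p a))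
    (fun i => ⟨_, he i.1⟩) (fun i => e (p i.1)) (fun i h => ?_) (fun i h => ?_)
  · unfold exitCount
    convert hrev using 2
    · ext f
      refine and_congr_right fun _ => ⟨fun h => ⟨h a ha, fun i => h i (Finset.mem_of_mem_erase i.2)⟩,
        fun h i hi => ?_⟩
      by_cases hia : i = a
      · subst hia
        exact h.1
      · exact h.2 ⟨i, Finset.mem_erase.2 ⟨hia, hi⟩⟩
    · ext f
      refine and_congr_right fun _ => ?_
      rw [Finset.forall_mem_insert, hp]
      exact and_congr_right fun _ => ⟨fun h i => h i.1 i.2, fun h i hi => h ⟨i, hi⟩⟩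
  · have h1 : i.1 = p a := (hp _).symm.trans (congrArg p (hinj h))
    exact (hL a).1 ha (h1 ▸ Finset.mem_of_mem_erase i.2)
  · have h1 : i.1 = a := ((hp _).symm.trans (congrArg p (hinj h))).trans (hp a)
    exact Finset.ne_of_mem_erase i.2 h1

/-- The count only depends on the matching, not on the directions of the branches. -/
theorem exitCount_eq (he' : ∀ a, G.IsBoundary (G.head (e a))) (hinj : Function.Injective e)
    (hp : ∀ a, p (p a) = a) {L L' : Finset (Fin (2 * N))} (hL : ∀ a, a ∈ L ↔ p a ∉ L)
    (hL' : ∀ a, a ∈ L' ↔ p a ∉ L') : exitCount he p L = exitCount he p L' := by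
  induction h : (L \ L').card using Nat.strong_induction_on generalizing L with
  | _ n ih =>
    rcases (L \ L').eq_empty_or_nonempty with hempty | ⟨a, ha⟩
    · rw [Finset.sdiff_eq_empty_iff_subset] at hempty
      congr 1
      refine Finset.Subset.antisymm hempty fun a ha => ?_
      by_contra h1
      have h2 : p a ∈ L := by
        rw [hL, hp]
        exact h1
      exact (hL' a).1 ha (hempty h2)
    · rw [Finset.mem_sdiff] at ha
      have hpa : p a ∉ L := (hL a).1 ha.1
      have hpa' : p a ∈ L' := by
        rw [hL', hp]
        exact ha.2
      have hpne : p a ≠ a := fun h => hpa (h.symm ▸ ha.1)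
      rw [exitCount_flip he he' hinj hp hL ha.1]
      refine ih _ ?_ (fun b => ?_) rfl
      · rw [← h]
        refine Finset.card_lt_card ⟨fun b hb => ?_, fun hsub => ?_⟩
        · simp only [Finset.mem_sdiff, Finset.mem_insert, Finset.mem_erase] at hb ⊢
          rcases hb.1 with rfl | h1
          · exact absurd hpa' hb.2
          · exact ⟨h1.2, hb.2⟩
        · have h1 := hsub (Finset.mem_sdiff.2 ha)
          simp only [Finset.mem_sdiff, Finset.mem_insert, Finset.mem_erase] at h1
          rcases h1.1 with h2 | h2
          · exact hpne h2.symm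
          · exact h2.1 rfl
      · simp only [Finset.mem_insert, Finset.mem_erase]
        by_cases hb : b = a
        · subst hb
          simp [hpne.symm]
        · by_cases hb' : b = p a
          · subst hb'
            simp [hp, hpne.symm]
          · have h1 : p b ≠ p a := fun h => hb (by rw [← hp b, h, hp])
            have h2 : p b ≠ a := fun h => hb' (by rw [← h, hp])
            simp [hb, hb', h1, h2, hL b]

/-- Crossing matchings are not realized by branches. -/
theorem exitCount_eq_zero (hccw : G.IsCounterclockwise e) (hp : ∀ a, p (p a) = a)
    {L : Finset (Fin (2 * N))} (hL : ∀ a, a ∈ L ↔ p a ∉ L) {a b : Fin (2 * N)} (hab : a < b)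
    (hba : b < p a) (hpab : p a < p b) : exitCount he p L = 0 := by
  unfold exitCount
  rw [Set.ncard_eq_zero, Set.eq_empty_iff_forall_notMem]
  rintro f ⟨-, hf⟩
  have hjoin : ∀ c, ExitsVia f ⟨_, he c⟩ (e (p c)) ∨ ExitsVia f ⟨_, he (p c)⟩ (e c) := by
    intro c
    by_cases hc : c ∈ L
    · exact Or.inl (hf c hc)
    · have h1 : p c ∈ L := by
        rw [hL, hp]
        exact hc
      have h2 := hf _ h1
      rw [hp] at h2
      exact Or.inr h2
  exact hccw.not_crossing he hab hba hpab (hjoin a) (hjoin b)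

/-- The number of acyclic arrows whose branches realize a link pattern. -/
noncomputable def connCount (α : LinkPattern N) : ℕ :=
  exitCount he α.partner (Finset.univ.filter fun a => Even a.val)

open scoped Classical in
/-- Only noncrossing matchings contribute, whatever the directions of the branches. -/
theorem exitCount_eq_sum (he' : ∀ a, G.IsBoundary (G.head (e a))) (hccw : G.IsCounterclockwise e)
    (hp : ∀ a, p (p a) = a) (hpne : ∀ a, p a ≠ a) {L : Finset (Fin (2 * N))}
    (hL : ∀ a, a ∈ L ↔ p a ∉ L) :
    exitCount he p L =
      ∑ α : LinkPattern N, if ∀ a ∈ L, α.partner a = p a then connCount he α else 0 := by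
  have hagree : ∀ α : LinkPattern N, (∀ a ∈ L, α.partner a = p a) → α.partner = p := by
    intro α h
    funext a
    by_cases ha : a ∈ L
    · exact h a ha
    · have h1 : p a ∈ L := by
        rw [hL, hp]
        exact ha
      have h2 := h _ h1
      rw [hp, α.partner_eq_iff] at h2
      exact h2
  by_cases hnc : ∀ a b, a < b → b < p a → ¬ p a < p b
  · set α : LinkPattern N := ⟨p, hp, hpne, hnc⟩ with hα
    rw [Finset.sum_eq_single α]
    · rw [if_pos fun a _ => rfl]
      refine exitCount_eq he he' hccw.injective hp hL fun a => ?_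
      simp only [Finset.mem_filter, Finset.mem_univ, true_and]
      rw [Nat.not_even_iff_odd]
      exact (α.odd_partner_iff a).symm
    · intro α' _ hne
      rw [if_neg]
      exact fun h => hne (LinkPattern.ext (hagree α' h))
    · simp
  · push Not at hnc
    obtain ⟨a, b, hab, hba, hpab⟩ := hnc
    rw [exitCount_eq_zero he hccw hp hL hab hba hpab, Finset.sum_eq_zero]
    intro α _
    rw [if_neg]
    intro h
    rw [← hagree α h] at hba hpab
    exact α.noncrossing a b hab hba hpab

open scoped Classical in
/-- The matrix recording through which marked edges the branches from the marked edges exit. -/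
noncomputable def exitMatrix (f : G.Arrows) (a b : Fin (2 * N)) : ℝ :=
  if ExitsVia f ⟨_, he a⟩ (e b) then 1 else 0

open scoped Classical in
/-- Summed over the acyclic arrows, the matrices of exits behave like matrices of link patterns. -/
theorem sum_fominDet_exitMatrix (he' : ∀ a, G.IsBoundary (G.head (e a)))
    (hccw : G.IsCounterclockwise e) (β : LinkPattern N) :
    ∑ f : G.Arrows with Acyclic f, β.fominDet (exitMatrix he f) =
      ∑ α : LinkPattern N, (connCount he α : ℝ) * β.fominDet α.linkMatrix := by
  simp only [LinkPattern.fominDet_eq_sum, Finset.mul_sum]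
  refine Finset.sum_comm.trans (Eq.trans ?_ Finset.sum_comm)
  refine Finset.sum_congr rfl fun σ _ => ?_
  set L : Finset (Fin (2 * N)) := Finset.univ.filter fun a => a < β.partner a with hLdef
  have hL : ∀ a, a ∈ L ↔ β.permuted σ a ∉ L := by
    intro a
    simp only [hLdef, Finset.mem_filter, Finset.mem_univ, true_and]
    exact β.left_iff_not_left_permuted σ a
  have h := congrArg (Nat.cast : ℕ → ℝ) (exitCount_eq_sum he he' hccw (β.permuted_permuted σ)
    (β.permuted_ne σ) hL)
  have hprod : ∀ (P : Fin (2 * N) → Prop) [DecidablePred P], ∏ a : {a // a < β.partner a},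
      (if P a.1 then (1 : ℝ) else 0) = if ∀ a ∈ L, P a then 1 else 0 := by
    intro P _
    rw [Finset.prod_ite_zero]
    simp [hLdef]
  have h1 : ∑ f : G.Arrows with Acyclic f, ((Equiv.Perm.sign σ : ℤ) : ℝ) *
      ∏ a : {a // a < β.partner a}, exitMatrix he f a.1 (β.permuted σ a.1) =
      ((Equiv.Perm.sign σ : ℤ) : ℝ) * exitCount he (β.permuted σ) L := by
    have h2 : ∀ f : G.Arrows, ∏ a : {a // a < β.partner a},
        exitMatrix he f a.1 (β.permuted σ a.1) =
        if ∀ a ∈ L, ExitsVia f ⟨_, he a⟩ (e (β.permuted σ a)) then 1 else 0 :=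
      fun f => hprod fun a => ExitsVia f ⟨_, he a⟩ (e (β.permuted σ a))
    simp only [h2]
    rw [← Finset.mul_sum, Finset.sum_boole, exitCount, Set.ncard_eq_toFinset_card']
    congr 3
    ext f
    simp
  rw [h1, h, Nat.cast_sum, Finset.mul_sum]
  refine Finset.sum_congr rfl fun α _ => ?_
  have h3 : ∏ a : {a // a < β.partner a}, α.linkMatrix a.1 (β.permuted σ a.1) =
      if ∀ a ∈ L, α.partner a = β.permuted σ a then 1 else 0 :=
    hprod fun a => α.partner a = β.permuted σ a
  rw [h3]
  split_ifs <;> simp [mul_comm]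

open scoped Classical in
/-- The tiling sum of the excursion kernel counts the arrows that realize the link pattern. -/
theorem det_mul_tilingSum (he' : ∀ a, G.IsBoundary (G.head (e a)))
    (hccw : G.IsCounterclockwise e) (α : LinkPattern N) :
    G.laplacian.det * LinkPattern.tilingSum α (fun a b => G.excursionKernel (e a) (e b)) =
      connCount he α := by
  classical
  have hfomin : ∀ β : LinkPattern N,
      G.laplacian.det * β.fominDet (fun a b => G.excursionKernel (e a) (e b)) =
        ∑ α' : LinkPattern N, (connCount he α' : ℝ) * β.fominDet α'.linkMatrix := by
    intro β
    rw [← sum_fominDet_exitMatrix he he' hccw β]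
    have h := sum_det_exitsVia (G := G) (κ := {a // a < β.partner a}) (fun a => ⟨_, he a.1⟩)
      (fun a => e (β.partner a.1)) (fun a => he _) (fun a => he' _)
    have hk : β.fominDet (fun a b => G.excursionKernel (e a) (e b)) =
        (Matrix.of fun a b : {a // a < β.partner a} =>
          G.laplacian⁻¹ ⟨_, he a.1⟩ ⟨_, he (β.partner b.1)⟩).det := by
      unfold LinkPattern.fominDet
      congr 1
      ext a b
      exact G.green_eq_laplacian_inv ⟨_, he a.1⟩ ⟨_, he (β.partner b.1)⟩
    rw [hk, ← h]
    rfl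
  have hexp : G.laplacian.det * LinkPattern.tilingSum α (fun a b => G.excursionKernel (e a) (e b)) =
      ∑ α' : LinkPattern N, (connCount he α' : ℝ) * LinkPattern.tilingSum α α'.linkMatrix := by
    simp only [LinkPattern.tilingSum, Finset.mul_sum]
    rw [Finset.sum_comm]
    refine Finset.sum_congr rfl fun β _ => ?_
    rw [mul_left_comm, hfomin β, Finset.mul_sum]
    exact Finset.sum_congr rfl fun α' _ => mul_left_comm _ _ _
  rw [hexp]
  simp [LinkPattern.tilingSum_linkMatrix]

theorem connProb_eq_tilingSum (he : ∀ a, G.IsInterior (G.org (e a)))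
    (he' : ∀ a, G.IsBoundary (G.head (e a)))
    (hccw : G.IsCounterclockwise e) (α : LinkPattern N) :
    G.connProb e α = LinkPattern.tilingSum α fun a b => G.excursionKernel (e a) (e b) := by
  classical
  have hden : ({f : G.Arrows | Acyclic f}.ncard : ℝ) = G.laplacian.det := by
    rw [← card_acyclic, ← Nat.card_coe_set_eq, Nat.card_eq_fintype_card]
    rfl
  have hnum : {f : G.Arrows | Acyclic f ∧ ∀ a : Fin (2 * N), Even a.val →
      Odd (α.partner a).val ∧ ExitsVia f ⟨G.org (e a), he a⟩ (e (α.partner a))}.ncard =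
      connCount he α := by
    unfold connCount exitCount
    congr 1
    ext f
    refine and_congr_right fun _ => forall_congr' fun a => ?_
    simp only [Finset.mem_filter, Finset.mem_univ, true_and]
    exact forall_congr' fun ha => and_iff_right ((α.odd_partner_iff a).2 ha)
  rw [connProb_eq e he α, hden, hnum, ← det_mul_tilingSum he he' hccw α,
    mul_div_cancel_left₀ _ G.laplacian_det_ne_zero]

end Marked

theorem green_comm (v w : G.Interior) : G.green v.1 w.1 = G.green w.1 v.1 := by
  classical
  rw [green_eq_laplacian_inv, green_eq_laplacian_inv, ← Matrix.transpose_apply G.laplacian⁻¹ w v,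
    Matrix.transpose_nonsing_inv, laplacian_transpose]

end PlaneGraph

theorem theorem2p1 {V D : Type*} [Fintype V] [Fintype D] (G : PlaneGraph V D)
    (N d : ℕ) (s : Fin d → ℕ) (hpos : ∀ i, 0 < s i) (hs : ∑ i, s i = 2 * N)
    (e : Fin (2 * N) → D) (he : ∀ a, G.IsBoundaryEdge (e a)) (hccw : G.IsCounterclockwise e)
    (α : LinkPattern N) (hα : α.IsValenced s hs) :
    (∀ v w : V, Summable fun l : {l : List D // G.IsInteriorWalk v w l} =>
      G.walkWeight v l.val) ∧
    G.connProb e α =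
      ∑ β : LinkPattern N with α ≤ β,
        (LinkPattern.numTilings α β : ℝ) * β.fominDet (G.fusedKernel s hs e) := by
  refine ⟨fun v w => G.summable_walkWeight v w, ?_⟩
  rw [PlaneGraph.connProb_eq_tilingSum (fun a => (he a).1) (fun a => (he a).2) hccw α]
  refine (tilingSum_fusedKernel s hs G e hα fun a b => ?_).symm
  exact PlaneGraph.green_comm ⟨_, (he a).1⟩ ⟨_, (he b).1⟩
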